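/- Let $(p_i)_{i\ge1}$ be a probability distribution on a totally ordered, finite or countably infinite alphabet $\mathcal A=\{a_1<a_2<\dots\}$ with $0<p_1<1$, and let $\mathbb P_n$ be the law on $\mathcal A^n$ of a word of $n$ independent letters with law $(p_i)$. Fix $\varepsilon\in(0,1/2)$ and $\alpha\in(0,p_1(1-p_1)/4)$, and put $\beta=\max\{p_1,1-p_1\}$. Words are compared in the lexicographic order. **Blocks.** Let $w\in\mathcal A^n$. A run of $a_1$ in $w$ is a nonempty maximal factor all of whose letters are $a_1$; a run of $\bar a_1$ is a nonempty maximal factor without the letter $a_1$. A *long run* is a run of $a_1$ of length at least $(1-\varepsilon)\log_{1/p_1}n$. A *long block* is a factor of $w$ that begins with a long run, ends just before another run of $a_1$ of $w$, and has the smallest possible length larger than $1+3\log_{1/\beta}n$ (among the factors that begin with the same long run). A *short block* is a factor consisting of a run of $a_1$ followed by a run of $\bar a_1$ that does not overlap any long block. The *blocks* of $w$ are its long and its short blocks, and $H_n(w)$ is the number of its long blocks. Factors are counted with their positions. The *normalized position* of a block $Y$ in $w=uYv$ is $|u|/n$. **Good words.** The word $w$ is *good*, $w\in\mathcal G_n$,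 if (i) $H_n(w)\ge\lfloor\alpha n^\varepsilon\rfloor$; (ii) the long blocks do not overlap; (iii) every common factor of two (distinct) long blocks is shorter than $3\log_{1/\beta}n$; (iv) each long run of $w$ is the beginning of some long block; (v) every run of $a_1$ has length at most $2\log_{1/p_1}n$; (vi) every run of $\bar a_1$ has length at most $2\log_{1/(1-p_1)}n$. Let $\mathcal L_n\subset\mathcal A^n$ be the set of Lyndon words (primitive words that are minimal among their cyclic permutations). For $1\le i\le H_n(w)$ let $d_{i,n}(w)$ be the normalized position of the $i$-th smallest block of $w$, and let $d_{i,n}(w)=0$ for $i>H_n(w)$. For $w\in\mathcal G_n\cap\mathcal L_n$ let $d_n(w)$ be the normalized position of the second smallest block of $w$. Let $\mathbb U_k$ be the uniform distribution on $[0,1]^k$ and $$\mathcal W_2(\mu,\nu)=\inf_{\mathcal L(X)=\mu,\ \mathcal L(Y)=\nu}\mathbb E\big[\|X-Y\|_2^2\big]^{1/2}.$$ **Theorem.** 1. For every fixed $k\ge1$, the distribution $\tilde\nu_{k,n}$ of $(d_{1,n},\dots,d_{k,n})$ under $\mathbb P_n(\,\cdot\mid\mathcal G_n)$ satisfies, as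 $n\to\infty$, $$\mathcal W_2(\tilde\nu_{k,n},\mathbb U_k)=O\left(\sqrt{\frac{\log n}{n}}\right).$$ 2. The distribution $\nu_n$ of $d_n$ under $\mathbb P_n(\,\cdot\mid\mathcal G_n\cap\mathcal L_n)$ satisfies, as $n\to\infty$, $$\mathcal W_2(\nu_n,\mathbb U_1)=O\left(\sqrt{\frac{\log n}{n}}\right),$$ and, for every integer $m\ge0$, the $m$-th moment of $\nu_n$ converges to the $m$-th moment of $\mathbb U_1$. The implied constants may depend on $(p_i)$, $\varepsilon$, $\alpha$ and, in part 1, on $k$, but not on $n$. Both conditioning events have positive probability for all large $n$. -/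

import Mathlib

open MeasureTheory ProbabilityTheory Filter Topology
open scoped ENNReal

namespace LyndonBlocks

/-! Letters are natural numbers, the smallest letter `a₁` being `0`; a word with `n` letters is a
function `w : Fin n → ℕ`.  A factor occurrence of `w` is a pair `b = (i, j)`, standing for the
positions `i ≤ t < j`; its length is `j - i` and it starts after a prefix of length `i`. -/

/-- The factor of `w` made of the letters at the positions `b.1 ≤ t < b.2`, as a list.
Lists of letters are compared by Mathlib's lexicographic order (a proper prefix is smaller). -/
def factor {n : ℕ} (w : Fin n → ℕ) (b : ℕ × ℕ) : List ℕ :=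
  ((List.ofFn w).take b.2).drop b.1

/-- Nonempty maximal intervals of positions of `w` whose letters all satisfy `P`. -/
def runs (P : ℕ → Prop) [DecidablePred P] {n : ℕ} (w : Fin n → ℕ) : Finset (ℕ × ℕ) :=
  (Finset.range (n + 1) ×ˢ Finset.range (n + 1)).filter fun r =>
    r.1 < r.2 ∧
    (∀ t : Fin n, r.1 ≤ (t : ℕ) → (t : ℕ) < r.2 → P (w t)) ∧
    (∀ t : Fin n, (t : ℕ) + 1 = r.1 → ¬ P (w t)) ∧
    (∀ t : Fin n, (t : ℕ) = r.2 → ¬ P (w t))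

/-- Runs of the letter `a₁`. -/
def aRuns {n : ℕ} (w : Fin n → ℕ) : Finset (ℕ × ℕ) := runs (fun x => x = 0) w

/-- Runs of letters different from `a₁` (the letters inside such a run may differ). -/
def otherRuns {n : ℕ} (w : Fin n → ℕ) : Finset (ℕ × ℕ) := runs (fun x => x ≠ 0) w

/-- The maximal length of the runs in `R` (`0` if there is none). -/
def maxLength (R : Finset (ℕ × ℕ)) : ℕ := R.sup fun r => r.2 - r.1

/-- Here and below, `q` is the probability of the letter `a₁`. -/
noncomputable def beta (q : ℝ) : ℝ := max q (1 - q)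

open Classical in
/-- Runs of `a₁` of length at least `(1 - ε) log_{1/q} n`. -/
noncomputable def longRuns (q ε : ℝ) {n : ℕ} (w : Fin n → ℕ) : Finset (ℕ × ℕ) :=
  (aRuns w).filter fun r => (1 - ε) * Real.logb (1 / q) n ≤ ((r.2 - r.1 : ℕ) : ℝ)

/-- `b` begins with a long run, ends just before another run of `a₁`, and is longer than
`1 + 3 log_{1/β} n`. -/
def IsLongFactor (q ε : ℝ) {n : ℕ} (w : Fin n → ℕ) (b : ℕ × ℕ) : Prop :=
  (∃ r ∈ longRuns q ε w, r.1 = b.1) ∧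
  (∃ r ∈ aRuns w, r.1 = b.2) ∧
  b.1 < b.2 ∧
  1 + 3 * Real.logb (1 / beta q) n < ((b.2 - b.1 : ℕ) : ℝ)

open Classical in
/-- The long blocks: for each long run, the shortest factor as above that begins with it, if there
is one. -/
noncomputable def longBlocks (q ε : ℝ) {n : ℕ} (w : Fin n → ℕ) : Finset (ℕ × ℕ) :=
  (Finset.range (n + 1) ×ˢ Finset.range (n + 1)).filter fun b =>
    IsLongFactor q ε w b ∧ ∀ c, IsLongFactor q ε w c → c.1 = b.1 → b.2 ≤ c.2

/-- Two factor occurrences do not overlap. -/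
def NoOverlap (b c : ℕ × ℕ) : Prop := b.2 ≤ c.1 ∨ c.2 ≤ b.1

/-- Good words. -/
structure IsGood (q ε α : ℝ) {n : ℕ} (w : Fin n → ℕ) : Prop where
  many : ⌊α * (n : ℝ) ^ ε⌋₊ ≤ (longBlocks q ε w).card
  noOverlap : ∀ b ∈ longBlocks q ε w, ∀ c ∈ longBlocks q ε w, b ≠ c → NoOverlap b c
  commonFactor : ∀ b ∈ longBlocks q ε w, ∀ c ∈ longBlocks q ε w, b ≠ c →
    ∀ v : List ℕ, v <:+: factor w b → v <:+: factor w c →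
      (v.length : ℝ) < 3 * Real.logb (1 / beta q) n
  everyLongRun : ∀ r ∈ longRuns q ε w, ∃ b ∈ longBlocks q ε w, b.1 = r.1
  maxRun : (maxLength (aRuns w) : ℝ) ≤ 2 * Real.logb (1 / q) n
  maxOtherRun : (maxLength (otherRuns w) : ℝ) ≤ 2 * Real.logb (1 / (1 - q)) n

open Classical in
/-- The short blocks: a run of `a₁` followed by a run of other letters, located in the gaps left by
the long blocks. -/
noncomputable def shortBlocks (q ε : ℝ) {n : ℕ} (w : Fin n → ℕ) : Finset (ℕ × ℕ) :=
  (Finset.range (n + 1) ×ˢ Finset.range (n + 1)).filter fun b =>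
    (∃ m, (b.1, m) ∈ aRuns w ∧ (m, b.2) ∈ otherRuns w) ∧
    ∀ c ∈ longBlocks q ε w, NoOverlap b c

/-- The blocks of `w` (long or short). -/
noncomputable def blocks (q ε : ℝ) {n : ℕ} (w : Fin n → ℕ) : Finset (ℕ × ℕ) :=
  longBlocks q ε w ∪ shortBlocks q ε w

/-- The number of blocks of `w` that are strictly smaller than `b` in lexicographic order. -/
noncomputable def rank (q ε : ℝ) {n : ℕ} (w : Fin n → ℕ) (b : ℕ × ℕ) : ℕ :=
  ((blocks q ε w).filter fun c => factor w c < factor w b).card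

/-- The normalized position `|u| / |w|` (`w = u Y v`) of the block `Y` with rank `i`, that is, of
the `(i + 1)`-st smallest block of `w`. -/
noncomputable def blockPos (q ε : ℝ) {n : ℕ} (w : Fin n → ℕ) (i : ℕ) : ℝ :=
  (sInf {s : ℕ | ∃ b ∈ blocks q ε w, rank q ε w b = i ∧ b.1 = s} : ℕ) / (n : ℝ)

open Classical in
/-- The sequence of the normalized positions of the `H` smallest blocks, `H` being the number of
long blocks, completed by `0`s. The index starts from `0`. -/
noncomputable def pos (q ε : ℝ) {n : ℕ} (w : Fin n → ℕ) (i : ℕ) : ℝ :=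
  if i < (longBlocks q ε w).card then blockPos q ε w i else 0

/-- The set of cyclic permutations of a word. -/
def necklace (u : List ℕ) : Finset (List ℕ) :=
  (Finset.range u.length).image fun r => u.rotate r

/-- Lyndon words: primitive (the necklace has as many elements as the word has letters) and minimal
in the necklace. -/
def IsLyndon {n : ℕ} (w : Fin n → ℕ) : Prop :=
  (necklace (List.ofFn w)).card = n ∧ ∀ v ∈ necklace (List.ofFn w), List.ofFn w ≤ v

/-- The probability of the smallest letter. -/
noncomputable def firstProb (p : PMF ℕ) : ℝ := (p 0).toReal

/-- The law `ℙ_n` of a word with `n` independent letters with law `p`. -/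
noncomputable def wordLaw (p : PMF ℕ) (n : ℕ) : Measure (Fin n → ℕ) :=
  Measure.pi fun _ => p.toMeasure

/-- The set of good words. -/
def goodWords (p : PMF ℕ) (ε α : ℝ) (n : ℕ) : Set (Fin n → ℕ) :=
  {w | IsGood (firstProb p) ε α w}

/-- The set of Lyndon words with `n` letters. -/
def lyndonWords (n : ℕ) : Set (Fin n → ℕ) := {w | IsLyndon w}

/-- The law of the normalized positions of the `k` smallest blocks of a good random word. -/
noncomputable def posLaw (p : PMF ℕ) (ε α : ℝ) (k n : ℕ) :
    Measure (EuclideanSpace ℝ (Fin k)) :=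
  (cond (wordLaw p n) (goodWords p ε α n)).map
    fun w => WithLp.toLp 2 fun i : Fin k => pos (firstProb p) ε w i

/-- The law of the normalized position of the second smallest block of a good random Lyndon
word. -/
noncomputable def secondPosLaw (p : PMF ℕ) (ε α : ℝ) (n : ℕ) : Measure ℝ :=
  (cond (wordLaw p n) (goodWords p ε α n ∩ lyndonWords n)).map
    fun w => blockPos (firstProb p) ε w 1

/-- The uniform distribution on `[0,1]^k`. -/
noncomputable def unifCube (k : ℕ) : Measure (EuclideanSpace ℝ (Fin k)) :=
  volume.restrict {x | ∀ i, x i ∈ Set.Icc (0 : ℝ) 1}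

/-- The uniform distribution on `[0,1]`. -/
noncomputable def unifIcc : Measure ℝ := volume.restrict (Set.Icc (0 : ℝ) 1)

/-- The `L²` Wasserstein distance: the infimum over all couplings (`∞` if there is none). -/
noncomputable def W2 {E : Type*} [MeasurableSpace E] [PseudoEMetricSpace E]
    (μ ν : Measure E) : ℝ≥0∞ :=
  ⨅ (γ : Measure (E × E)) (_ : γ.map Prod.fst = μ ∧ γ.map Prod.snd = ν),
    (∫⁻ z, edist z.1 z.2 ^ 2 ∂γ) ^ (1 / 2 : ℝ)

end LyndonBlocks

/-! A good word with at least one long block is cut in exactly one way as `u ++ (Ys.flatten ++ v)`.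
Here `u` has no zero and `Ys` lists the blocks in order. The tail `v` begins with the last run of
zeros outside these blocks and reaches the end of the word; it is never long. Every piece begins
with 0 and ends with a nonzero letter, so nothing is created or destroyed at the seams when pieces
are exchanged. The long blocks of the word are therefore the long pieces (`Valid.isLB_iff`), and
goodness is a condition on `u`, `v` and the unordered family `Ys` (`Valid.goodList_iff`,
`GoodPieces.perm`). Permuting the pieces is thus a bijection of the set of good words. It only
rearranges letters, so it preserves probabilities and the conditional law (`cond_map_permWord`).

Long blocks precede short ones lexicographically and are pairwise distinct, so the rank of a long
piece depends only on the family `Ys` and is unchanged by the permutation. Give independent uniform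
keys to the pieces and sort the pieces by their keys. The piece with key `θ j` is then preceded by
the pieces with smaller keys. Given `θ j`, the total length of these has mean `θ j` times the total
length of the other pieces, and variance at most the sum of the squared lengths. Runs of a good word
have logarithmic length, hence so have the pieces (`length_le_of_windows`). That sum is at most a
constant times `n log n`, and the fixed parts contribute only `O(log n)`. After division by `n`, the
position is within `O(√(log n / n))` of the key in mean square (`Dec.lintegral_edist_sq_le`).
Distinct pieces have independent keys, so sorted word and keys form a coupling (`exists_coupling`)
that bounds the Wasserstein distance.

For Lyndon words, a good word is Lyndon exactly when `u` is empty, the last letter is nonzero, and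
the first piece is long and smaller than the other long pieces (`Dec.lyndonPieces`, `Dec.isLyndon`).
The same argument applies with the first piece kept in place. The second smallest block is always
among the pieces that move.

The conditioning events only have to be non-null, so one explicit good Lyndon word for each large
`n` suffices (`exists_valid_lyndonPieces`). Moments converge because powers are Lipschitz on
`[0,1]`. -/

namespace LyndonBlocks

/-! ### Letters and runs of zeros in lists -/

/-- The letter of `W` at position `t`; beyond the end of the word the value is `1`. -/
def letter (W : List ℕ) (t : ℕ) : ℕ := W.getD t 1

lemma letter_append_left {A B : List ℕ} {t : ℕ} (h : t < A.length) :
    letter (A ++ B) t = letter A t := by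
  rw [letter, letter, List.getD_append _ _ _ _ h]

lemma letter_append_add (A B : List ℕ) (t : ℕ) :
    letter (A ++ B) (A.length + t) = letter B t := by
  rw [letter, letter, List.getD_append_right _ _ _ _ (Nat.le_add_right _ _), Nat.add_sub_cancel_left]

lemma letter_append_right {A B : List ℕ} {t : ℕ} (h : A.length ≤ t) :
    letter (A ++ B) t = letter B (t - A.length) := by
  obtain ⟨s, rfl⟩ := Nat.exists_eq_add_of_le h
  simp [letter_append_add]

lemma letter_of_le {W : List ℕ} {t : ℕ} (h : W.length ≤ t) : letter W t = 1 := by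
  simp [letter, h]

lemma letter_eq_getElem {W : List ℕ} {t : ℕ} (h : t < W.length) : letter W t = W[t] := by
  simp [letter, h]

lemma lt_length_of_letter {W : List ℕ} {t : ℕ} (h : letter W t = 0) : t < W.length := by
  by_contra h'
  rw [letter_of_le (not_lt.1 h')] at h
  exact one_ne_zero h

lemma letter_drop (W : List ℕ) (x t : ℕ) : letter (W.drop x) t = letter W (x + t) := by
  simp [letter, List.getD_eq_getElem?_getD]

lemma letter_take {W : List ℕ} {l t : ℕ} (h : t < l) : letter (W.take l) t = letter W t := by
  simp [letter, List.getD_eq_getElem?_getD, List.getElem?_take_of_lt h]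

lemma ext_letter {A B : List ℕ} (hl : A.length = B.length)
    (h : ∀ t < A.length, letter A t = letter B t) : A = B := by
  refine List.ext_getElem hl fun t h1 h2 => ?_
  have := h t h1
  rwa [letter_eq_getElem h1, letter_eq_getElem h2] at this

/-- The word is empty or its last letter is not `0`. -/
def EndsNZ (A : List ℕ) : Prop := ∀ t, t + 1 = A.length → letter A t ≠ 0

/-- A run of zeros of `W` starts at `i`. -/
def RunStart (W : List ℕ) (i : ℕ) : Prop :=
  letter W i = 0 ∧ ∀ j, j + 1 = i → letter W j ≠ 0

/-- A run of at least `T` zeros of `W` starts at `i`. -/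
def LongStart (T : ℕ) (W : List ℕ) (i : ℕ) : Prop :=
  RunStart W i ∧ ∀ t < T, letter W (i + t) = 0

/-- `Y` begins with at least `T` zeros. -/
def IsLong (T : ℕ) (Y : List ℕ) : Prop := ∀ t < T, letter Y t = 0

instance (T : ℕ) : DecidablePred (IsLong T) := fun Y =>
  inferInstanceAs (Decidable (∀ t < T, letter Y t = 0))

lemma RunStart.lt_length {W : List ℕ} {i : ℕ} (h : RunStart W i) : i < W.length :=
  lt_length_of_letter h.1

lemma runStart_zero {W : List ℕ} : RunStart W 0 ↔ letter W 0 = 0 := by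
  simp [RunStart]

lemma longStart_zero {T : ℕ} {W : List ℕ} (h : letter W 0 = 0) : LongStart T W 0 ↔ IsLong T W := by
  simp [LongStart, runStart_zero, h, IsLong]

lemma endsNZ_append {A B : List ℕ} (hA : EndsNZ A) (hB : EndsNZ B) : EndsNZ (A ++ B) := by
  intro t ht
  rw [List.length_append] at ht
  rcases Nat.eq_zero_or_pos B.length with h0 | h0
  · rw [letter_append_left (by omega)]
    exact hA t (by omega)
  · rw [letter_append_right (by omega)]
    exact hB _ (by omega)

/-- Being a run start involves only a position and its left neighbour, so what follows `A` is
irrelevant. -/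
lemma runStart_append_left {A B : List ℕ} {i : ℕ} (h : i < A.length) :
    RunStart (A ++ B) i ↔ RunStart A i := by
  unfold RunStart
  rw [letter_append_left h]
  refine and_congr_right fun _ => forall_congr' fun j => imp_congr_right fun hj => ?_
  rw [letter_append_left (by omega)]

/-- The nonzero end of `A` keeps a run at the beginning of `B` from being extended to the left. -/
lemma runStart_append_add {A B : List ℕ} (hA : EndsNZ A) (t : ℕ) :
    RunStart (A ++ B) (A.length + t) ↔ RunStart B t := by
  unfold RunStart
  rw [letter_append_add]
  refine and_congr_right fun _ => ⟨fun h j hj => ?_, fun h j hj => ?_⟩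
  · have := h (A.length + j) (by omega)
    rwa [letter_append_add] at this
  · rcases Nat.eq_zero_or_pos t with rfl | ht
    · rw [letter_append_left (by omega)]
      exact hA j (by omega)
    · rw [letter_append_right (by omega)]
      exact h _ (by omega)

/-- A window of zeros that starts inside `A` cannot cross the nonzero last letter of `A`. -/
lemma lt_of_zeros {A : List ℕ} (hA : EndsNZ A) {B : List ℕ} {i : ℕ} (hi : i < A.length) {r : ℕ}
    (h : ∀ t < r, letter (A ++ B) (i + t) = 0) : i + r < A.length + (if r = 0 then 1 else 0) := by
  split_ifs with h0
  · omega
  · by_contra hc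
    have h2 := h (A.length - 1 - i) (by omega)
    rw [letter_append_left (by omega)] at h2
    exact hA _ (by omega) h2

lemma longStart_append_left {T : ℕ} {A B : List ℕ} (hA : EndsNZ A) {i : ℕ} (h : i < A.length) :
    LongStart T (A ++ B) i ↔ LongStart T A i := by
  unfold LongStart
  rw [runStart_append_left h]
  refine and_congr_right fun _ => ⟨fun h' t ht => ?_, fun h' t ht => ?_⟩
  · have := lt_of_zeros hA h h'
    rw [if_neg (by omega)] at this
    rw [← h' t ht, letter_append_left (by omega)]
  · rw [letter_append_left (lt_length_of_letter (h' t ht)), h' t ht]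

lemma longStart_append_add {T : ℕ} {A B : List ℕ} (hA : EndsNZ A) (t : ℕ) :
    LongStart T (A ++ B) (A.length + t) ↔ LongStart T B t := by
  unfold LongStart
  rw [runStart_append_add hA]
  simp only [add_assoc, letter_append_add]

/-! ### Pieces and decompositions -/

/-- `Y` can be a block: either a run of fewer than `T` zeros followed by nonzero letters, or a word
that begins with its only run of at least `T` zeros, has length at least `K`, and is the shortest
such word. -/
structure Piece (T K : ℕ) (Y : List ℕ) : Prop where
  head : letter Y 0 = 0
  last : EndsNZ Y
  short : ¬ IsLong T Y → ∀ t, RunStart Y t → t = 0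
  length_le : IsLong T Y → K ≤ Y.length
  lt_of_runStart : IsLong T Y → ∀ t, RunStart Y t → t < K
  longStart : ∀ t, LongStart T Y t → t = 0

/-- `v` consists of a run of fewer than `T` zeros, possibly followed by nonzero letters. -/
structure Tail (T : ℕ) (v : List ℕ) : Prop where
  head : letter v 0 = 0
  runStart : ∀ t, RunStart v t → t = 0
  not_isLong : ¬ IsLong T v

/-- A decomposition into a prefix without zeros, blocks, and a tail. -/
structure Valid (T K : ℕ) (u : List ℕ) (Ys : List (List ℕ)) (v : List ℕ) : Prop where
  prefix_ne : ∀ t < u.length, letter u t ≠ 0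
  piece : ∀ Y ∈ Ys, Piece T K Y
  tail : Tail T v

lemma Piece.pos {T K : ℕ} {Y : List ℕ} (h : Piece T K Y) : 0 < Y.length := lt_length_of_letter h.head

lemma Piece.longStart_iff {T K : ℕ} {Y : List ℕ} (h : Piece T K Y) (t : ℕ) :
    LongStart T Y t ↔ IsLong T Y ∧ t = 0 := by
  constructor
  · intro ht
    have h0 := h.longStart t ht
    subst h0
    exact ⟨(longStart_zero h.head).1 ht, rfl⟩
  · rintro ⟨h1, rfl⟩
    exact (longStart_zero h.head).2 h1

lemma Tail.not_longStart {T : ℕ} {v : List ℕ} (h : Tail T v) (t : ℕ) : ¬ LongStart T v t := by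
  intro ht
  have h0 := h.runStart t ht.1
  subst h0
  exact h.not_isLong ((longStart_zero h.head).1 ht)

lemma Valid.endsNZ {T K : ℕ} {u v : List ℕ} {Ys : List (List ℕ)} (h : Valid T K u Ys v) :
    EndsNZ u := fun t ht => h.prefix_ne t (by omega)

/-- The pieces with their positions, the first one being at position `o`. -/
def marks : ℕ → List (List ℕ) → List (ℕ × List ℕ)
  | _, [] => []
  | o, Y :: Ys => (o, Y) :: marks (o + Y.length) Ys

lemma marks_map_snd (o : ℕ) (Ys : List (List ℕ)) : (marks o Ys).map Prod.snd = Ys := by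
  induction Ys generalizing o with
  | nil => rfl
  | cons Y Ys ih => simp [marks, ih]

lemma mem_of_mem_marks {o : ℕ} {Ys : List (List ℕ)} {p : ℕ × List ℕ} (h : p ∈ marks o Ys) :
    p.2 ∈ Ys := by
  rw [← marks_map_snd o Ys]
  exact List.mem_map_of_mem h

lemma exists_mem_marks (o : ℕ) {Ys : List (List ℕ)} {Y : List ℕ} (h : Y ∈ Ys) :
    ∃ p ∈ marks o Ys, p.2 = Y := by
  rw [← marks_map_snd o Ys] at h
  simpa using h

lemma le_of_mem_marks {o : ℕ} {Ys : List (List ℕ)} {p : ℕ × List ℕ} (h : p ∈ marks o Ys) :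
    o ≤ p.1 ∧ p.1 + p.2.length ≤ o + Ys.flatten.length := by
  induction Ys generalizing o with
  | nil => simp [marks] at h
  | cons Y Ys ih =>
    rcases List.mem_cons.1 h with rfl | h
    · simp
    · have := ih h
      simp only [List.flatten_cons, List.length_append]
      omega

lemma marks_pairwise (o : ℕ) (Ys : List (List ℕ)) :
    (marks o Ys).Pairwise fun p q => p.1 + p.2.length ≤ q.1 := by
  induction Ys generalizing o with
  | nil => simp [marks]
  | cons Y Ys ih =>
    refine List.Pairwise.cons (fun q hq => ?_) (ih _)
    exact (le_of_mem_marks hq).1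

lemma marks_nodup {o : ℕ} {Ys : List (List ℕ)} (h : ∀ Y ∈ Ys, 0 < Y.length) :
    (marks o Ys).Nodup := by
  induction Ys generalizing o with
  | nil => simp [marks]
  | cons Y Ys ih =>
    refine List.nodup_cons.2 ⟨fun hq => ?_, ih fun Z hZ => h Z (by simp [hZ])⟩
    have := (le_of_mem_marks hq).1
    have := h Y (by simp)
    simp only at *
    omega

lemma marks_separated {o : ℕ} {Ys : List (List ℕ)} {p q : ℕ × List ℕ}
    (hp : p ∈ marks o Ys) (hq : q ∈ marks o Ys) (hpq : p ≠ q) :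
    p.1 + p.2.length ≤ q.1 ∨ q.1 + q.2.length ≤ p.1 := by
  have hP : (marks o Ys).Pairwise fun p q => p.1 + p.2.length ≤ q.1 ∨ q.1 + q.2.length ≤ p.1 :=
    (marks_pairwise o Ys).imp Or.inl
  have : Std.Symm (fun p q : ℕ × List ℕ => p.1 + p.2.length ≤ q.1 ∨ q.1 + q.2.length ≤ p.1) :=
    ⟨fun _ _ h => h.symm⟩
  exact hP.forall hp hq hpq

lemma marks_next {o : ℕ} {Ys : List (List ℕ)} {p : ℕ × List ℕ} (hp : p ∈ marks o Ys) :
    (∃ q ∈ marks o Ys, q.1 = p.1 + p.2.length) ∨ p.1 + p.2.length = o + Ys.flatten.length := by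
  induction Ys generalizing o with
  | nil => simp [marks] at hp
  | cons Y Ys ih =>
    rcases List.mem_cons.1 hp with rfl | hp
    · cases Ys with
      | nil => right; simp
      | cons Z Ys => left; exact ⟨(o + Y.length, Z), by simp [marks], rfl⟩
    · rcases ih hp with ⟨q, hq, h⟩ | h
      · exact Or.inl ⟨q, List.mem_cons_of_mem _ hq, h⟩
      · right; rw [h]; simp [add_assoc]

/-- No run crosses a seam, so the run starts are those of the parts; the last alternative is the
single run of the tail. The prefix `A` is an arbitrary word with nonzero end so that the induction
can move the first piece into it. -/
lemma runStart_asm {T K : ℕ} {A v : List ℕ} {Ys : List (List ℕ)} (hA : EndsNZ A)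
    (hY : ∀ Y ∈ Ys, Piece T K Y) (hv : Tail T v) (x : ℕ) :
    RunStart (A ++ (Ys.flatten ++ v)) x ↔ (x < A.length ∧ RunStart A x) ∨
      (∃ p ∈ marks A.length Ys, ∃ t, RunStart p.2 t ∧ x = p.1 + t) ∨
      x = A.length + Ys.flatten.length := by
  induction Ys generalizing A with
  | nil =>
    rcases lt_or_ge x A.length with h | h
    · simp [runStart_append_left h, h, marks]
      omega
    · obtain ⟨t, rfl⟩ := Nat.exists_eq_add_of_le h
      have : RunStart v t ↔ t = 0 :=
        ⟨hv.runStart t, fun h => by rw [h]; exact runStart_zero.2 hv.head⟩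
      simp [runStart_append_add hA, marks, this]
  | cons Y Ys ih =>
    have hYp := hY Y (by simp)
    have e : A ++ ((Y :: Ys).flatten ++ v) = (A ++ Y) ++ (Ys.flatten ++ v) := by simp
    rw [e, ih (endsNZ_append hA hYp.last) (fun Z hZ => hY Z (by simp [hZ]))]
    have e2 : (x < (A ++ Y).length ∧ RunStart (A ++ Y) x) ↔
        (x < A.length ∧ RunStart A x) ∨ ∃ t, RunStart Y t ∧ x = A.length + t := by
      rcases lt_or_ge x A.length with h | h
      · rw [runStart_append_left h]
        constructor
        · exact fun h' => Or.inl ⟨h, h'.2⟩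
        · rintro (h' | ⟨t, _, ht⟩)
          · exact ⟨by simp; omega, h'.2⟩
          · omega
      · obtain ⟨t, rfl⟩ := Nat.exists_eq_add_of_le h
        rw [runStart_append_add hA]
        constructor
        · exact fun h' => Or.inr ⟨t, h'.2, rfl⟩
        · rintro (h' | ⟨s, hs, ht⟩)
          · omega
          · obtain rfl : t = s := by omega
            exact ⟨by have := hs.lt_length; simp; omega, hs⟩
    rw [e2]
    simp only [marks, List.mem_cons, exists_eq_or_imp, List.length_append, List.flatten_cons,
      or_assoc, add_assoc]

lemma longStart_asm {T K : ℕ} {A v : List ℕ} {Ys : List (List ℕ)} (hA : EndsNZ A)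
    (hY : ∀ Y ∈ Ys, Piece T K Y) (hv : Tail T v) (x : ℕ) :
    LongStart T (A ++ (Ys.flatten ++ v)) x ↔ (x < A.length ∧ LongStart T A x) ∨
      (∃ p ∈ marks A.length Ys, IsLong T p.2 ∧ x = p.1) := by
  induction Ys generalizing A with
  | nil =>
    rcases lt_or_ge x A.length with h | h
    · simp [longStart_append_left hA h, h, marks]
    · obtain ⟨t, rfl⟩ := Nat.exists_eq_add_of_le h
      simp [longStart_append_add hA, marks, hv.not_longStart]
  | cons Y Ys ih =>
    have hYp := hY Y (by simp)
    have e : A ++ ((Y :: Ys).flatten ++ v) = (A ++ Y) ++ (Ys.flatten ++ v) := by simp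
    rw [e, ih (endsNZ_append hA hYp.last) (fun Z hZ => hY Z (by simp [hZ]))]
    have e2 : (x < (A ++ Y).length ∧ LongStart T (A ++ Y) x) ↔
        (x < A.length ∧ LongStart T A x) ∨ (IsLong T Y ∧ x = A.length) := by
      rcases lt_or_ge x A.length with h | h
      · rw [longStart_append_left hA h]
        constructor
        · exact fun h' => Or.inl ⟨h, h'.2⟩
        · rintro (h' | ⟨_, ht⟩)
          · exact ⟨by simp; omega, h'.2⟩
          · omega
      · obtain ⟨t, rfl⟩ := Nat.exists_eq_add_of_le h
        rw [longStart_append_add hA, hYp.longStart_iff]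
        constructor
        · rintro ⟨_, h1, rfl⟩
          exact Or.inr ⟨h1, rfl⟩
        · rintro (h' | ⟨hs, ht⟩)
          · omega
          · exact ⟨by have := hYp.pos; simp; omega, hs, by omega⟩
    rw [e2]
    simp only [marks, List.mem_cons, exists_eq_or_imp, List.length_append,
      or_assoc]

lemma letter_asm_marks {A : List ℕ} {Ys : List (List ℕ)} {B : List ℕ} {p : ℕ × List ℕ}
    (hp : p ∈ marks A.length Ys) :
    ∃ L R, A ++ (Ys.flatten ++ B) = L ++ (p.2 ++ R) ∧ L.length = p.1 := by
  induction Ys generalizing A with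
  | nil => simp [marks] at hp
  | cons Y Ys ih =>
    rcases List.mem_cons.1 hp with rfl | hp
    · exact ⟨A, Ys.flatten ++ B, by simp, rfl⟩
    · obtain ⟨L, R, h1, h2⟩ := ih (A := A ++ Y) (by simpa using hp)
      exact ⟨L, R, by rw [← h1]; simp, h2⟩

lemma letter_of_mem_marks {A : List ℕ} {Ys : List (List ℕ)} {B : List ℕ} {p : ℕ × List ℕ}
    (hp : p ∈ marks A.length Ys) {t : ℕ} (ht : t < p.2.length) :
    letter (A ++ (Ys.flatten ++ B)) (p.1 + t) = letter p.2 t := by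
  obtain ⟨L, R, h1, h2⟩ := letter_asm_marks (B := B) hp
  rw [h1, ← h2, letter_append_add, letter_append_left ht]

lemma take_drop_of_mem_marks {A : List ℕ} {Ys : List (List ℕ)} {B : List ℕ} {p : ℕ × List ℕ}
    (hp : p ∈ marks A.length Ys) :
    ((A ++ (Ys.flatten ++ B)).take (p.1 + p.2.length)).drop p.1 = p.2 := by
  obtain ⟨L, R, h1, h2⟩ := letter_asm_marks (B := B) hp
  rw [h1, ← h2, List.take_length_add_append, List.take_left, List.drop_left]

/-! ### Long blocks of a word -/

/-- The interval `b` is a long block of the word `W`. -/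
structure IsLB (T K : ℕ) (W : List ℕ) (b : ℕ × ℕ) : Prop where
  start : LongStart T W b.1
  next : RunStart W b.2
  le : b.1 + K ≤ b.2
  min : ∀ j, RunStart W j → b.1 + K ≤ j → b.2 ≤ j

section
variable {T K : ℕ} {u v : List ℕ} {Ys : List (List ℕ)}

lemma Valid.runStart_mark (h : Valid T K u Ys v) {p : ℕ × List ℕ} (hp : p ∈ marks u.length Ys) :
    RunStart (u ++ (Ys.flatten ++ v)) p.1 :=
  (runStart_asm h.endsNZ h.piece h.tail _).2 (Or.inr (Or.inl ⟨p, hp, 0,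
    runStart_zero.2 (h.piece _ (mem_of_mem_marks hp)).head, rfl⟩))

lemma Valid.runStart_tail (h : Valid T K u Ys v) :
    RunStart (u ++ (Ys.flatten ++ v)) (u.length + Ys.flatten.length) :=
  (runStart_asm h.endsNZ h.piece h.tail _).2 (Or.inr (Or.inr rfl))

lemma Valid.runStart_next (h : Valid T K u Ys v) {p : ℕ × List ℕ} (hp : p ∈ marks u.length Ys) :
    RunStart (u ++ (Ys.flatten ++ v)) (p.1 + p.2.length) := by
  rcases marks_next hp with ⟨q, hq, h1⟩ | h1
  · rw [← h1]; exact h.runStart_mark hq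
  · rw [h1]; exact h.runStart_tail

lemma Valid.runStart_inside (h : Valid T K u Ys v) {p : ℕ × List ℕ} (hp : p ∈ marks u.length Ys)
    {t : ℕ} (ht : t < p.2.length) (hx : RunStart (u ++ (Ys.flatten ++ v)) (p.1 + t)) :
    RunStart p.2 t := by
  rcases (runStart_asm h.endsNZ h.piece h.tail _).1 hx with ⟨h1, h2⟩ | ⟨q, hq, s, hs, e⟩ | h1
  · exact absurd h2.1 (h.prefix_ne _ h1)
  · rcases eq_or_ne p q with rfl | hpq
    · obtain rfl : t = s := by omega
      exact hs
    · have := marks_separated hp hq hpq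
      have := hs.lt_length
      omega
  · have := (le_of_mem_marks hp).2
    omega

lemma Valid.longStart_iff (h : Valid T K u Ys v) (x : ℕ) :
    LongStart T (u ++ (Ys.flatten ++ v)) x ↔ ∃ p ∈ marks u.length Ys, IsLong T p.2 ∧ x = p.1 := by
  rw [longStart_asm h.endsNZ h.piece h.tail, or_iff_right]
  rintro ⟨h1, h2⟩
  exact h.prefix_ne _ h1 h2.1.1

/-- The run starts inside a long piece are all at distance less than `K` from its beginning, and the
next one is where the piece ends, at distance at least `K`. The piece is therefore the shortest
admissible factor. Long runs occur only at the beginning of long pieces, so there are no other long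
blocks. -/
lemma Valid.isLB_iff (h : Valid T K u Ys v) (b : ℕ × ℕ) :
    IsLB T K (u ++ (Ys.flatten ++ v)) b ↔
      ∃ p ∈ marks u.length Ys, IsLong T p.2 ∧ b = (p.1, p.1 + p.2.length) := by
  constructor
  · intro hb
    obtain ⟨p, hp, hl, e⟩ := (h.longStart_iff _).1 hb.start
    have hP := h.piece _ (mem_of_mem_marks hp)
    refine ⟨p, hp, hl, Prod.ext e ?_⟩
    have h1 := hb.min _ (h.runStart_next hp) (by have := hP.length_le hl; omega)
    rcases h1.lt_or_eq with h2 | h2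
    · exfalso
      have hle := hb.le
      have h3 : RunStart p.2 (b.2 - p.1) := by
        refine h.runStart_inside hp (by omega) ?_
        rw [show p.1 + (b.2 - p.1) = b.2 by omega]
        exact hb.next
      have := hP.lt_of_runStart hl _ h3
      omega
    · exact h2
  · rintro ⟨p, hp, hl, rfl⟩
    have hP := h.piece _ (mem_of_mem_marks hp)
    refine ⟨(h.longStart_iff _).2 ⟨p, hp, hl, rfl⟩, h.runStart_next hp,
      by have := hP.length_le hl; simp only; omega, fun j hj hle => ?_⟩
    by_contra hc
    simp only at hle hc
    have h3 : RunStart p.2 (j - p.1) := by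
      refine h.runStart_inside hp (by omega) ?_
      rw [show p.1 + (j - p.1) = j by omega]
      exact hj
    have := hP.lt_of_runStart hl _ h3
    omega

end

/-! ### Windows of zeros and of nonzero letters -/

/-- `W` has `r` consecutive letters `0`. -/
def HasZeros (r : ℕ) (W : List ℕ) : Prop := ∃ x, ∀ t < r, letter W (x + t) = 0

/-- `W` has `r` consecutive letters different from `0`. -/
def HasNZ (r : ℕ) (W : List ℕ) : Prop := ∃ x, x + r ≤ W.length ∧ ∀ t < r, letter W (x + t) ≠ 0

lemma hasZeros_append {r : ℕ} {A B : List ℕ} (hA : EndsNZ A) :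
    HasZeros r (A ++ B) ↔ HasZeros r A ∨ HasZeros r B := by
  constructor
  · rintro ⟨x, hx⟩
    rcases lt_or_ge x A.length with h | h
    · left
      refine ⟨x, fun t ht => ?_⟩
      have := lt_of_zeros hA h hx
      rw [if_neg (by omega)] at this
      rw [← hx t ht, letter_append_left (by omega)]
    · right
      obtain ⟨s, rfl⟩ := Nat.exists_eq_add_of_le h
      exact ⟨s, fun t ht => by rw [← hx t ht, add_assoc, letter_append_add]⟩
  · rintro (⟨x, hx⟩ | ⟨x, hx⟩)
    · exact ⟨x, fun t ht => by rw [letter_append_left (lt_length_of_letter (hx t ht)), hx t ht]⟩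
    · exact ⟨A.length + x, fun t ht => by rw [add_assoc, letter_append_add, hx t ht]⟩

/-- The zero at the beginning of `B` stops every window of nonzero letters at the seam. -/
lemma hasNZ_append {r : ℕ} {A B : List ℕ} (hB : letter B 0 = 0) :
    HasNZ r (A ++ B) ↔ HasNZ r A ∨ HasNZ r B := by
  constructor
  · rintro ⟨x, hl, hx⟩
    rw [List.length_append] at hl
    rcases lt_or_ge x A.length with h | h
    · left
      have hle : x + r ≤ A.length := by
        by_contra hc
        have := hx (A.length - x) (by omega)
        rw [show x + (A.length - x) = A.length + 0 by omega, letter_append_add] at this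
        exact this hB
      exact ⟨x, hle, fun t ht => by
        have := hx t ht
        rwa [letter_append_left (by omega)] at this⟩
    · right
      obtain ⟨s, rfl⟩ := Nat.exists_eq_add_of_le h
      exact ⟨s, by omega, fun t ht => by
        have := hx t ht
        rwa [add_assoc, letter_append_add] at this⟩
  · rintro (⟨x, hl, hx⟩ | ⟨x, hl, hx⟩)
    · exact ⟨x, by simp; omega, fun t ht => by
        rw [letter_append_left (by omega)]; exact hx t ht⟩
    · exact ⟨A.length + x, by simp; omega, fun t ht => by
        rw [add_assoc, letter_append_add]; exact hx t ht⟩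

lemma letter_flatten_append {T K : ℕ} {v : List ℕ} {Ys : List (List ℕ)}
    (hY : ∀ Y ∈ Ys, Piece T K Y) (hv : Tail T v) : letter (Ys.flatten ++ v) 0 = 0 := by
  cases Ys with
  | nil => simpa using hv.head
  | cons Y Ys =>
    have := hY Y (by simp)
    rw [List.flatten_cons, List.append_assoc, letter_append_left this.pos, this.head]

lemma hasZeros_asm {T K r : ℕ} {A v : List ℕ} {Ys : List (List ℕ)} (hA : EndsNZ A)
    (hY : ∀ Y ∈ Ys, Piece T K Y) :
    HasZeros r (A ++ (Ys.flatten ++ v)) ↔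
      HasZeros r A ∨ (∃ Y ∈ Ys, HasZeros r Y) ∨ HasZeros r v := by
  rw [hasZeros_append hA]
  refine or_congr_right ?_
  induction Ys with
  | nil => simp
  | cons Y Ys ih =>
    rw [List.flatten_cons, List.append_assoc, hasZeros_append (hY Y (by simp)).last,
      ih fun Z hZ => hY Z (by simp [hZ])]
    simp [or_assoc]

lemma hasNZ_asm {T K r : ℕ} {A v : List ℕ} {Ys : List (List ℕ)}
    (hY : ∀ Y ∈ Ys, Piece T K Y) (hv : Tail T v) :
    HasNZ r (A ++ (Ys.flatten ++ v)) ↔ HasNZ r A ∨ (∃ Y ∈ Ys, HasNZ r Y) ∨ HasNZ r v := by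
  rw [hasNZ_append (letter_flatten_append hY hv)]
  refine or_congr_right ?_
  induction Ys with
  | nil => simp
  | cons Y Ys ih =>
    have hY' : ∀ Z ∈ Ys, Piece T K Z := fun Z hZ => hY Z (by simp [hZ])
    rw [List.flatten_cons, List.append_assoc, hasNZ_append (letter_flatten_append hY' hv), ih hY']
    simp [or_assoc]

/-! ### Good words in terms of their decompositions -/

/-- Every common factor of `Y` and `Z` is shorter than `F`. -/
def CommonLT (F : ℕ) (Y Z : List ℕ) : Prop :=
  ∀ x : List ℕ, x <:+: Y → x <:+: Z → x.length < F

/-- The letters of `W` at the positions `b.1 ≤ t < b.2`. -/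
def sub (W : List ℕ) (b : ℕ × ℕ) : List ℕ := (W.take b.2).drop b.1

/-- Good words, with integer parameters. -/
structure GoodList (T K F RA RB N : ℕ) (W : List ℕ) : Prop where
  many : N ≤ {b | IsLB T K W b}.ncard
  noOverlap : ∀ b c, IsLB T K W b → IsLB T K W c → b ≠ c → NoOverlap b c
  commonFactor : ∀ b c, IsLB T K W b → IsLB T K W c → b ≠ c → CommonLT F (sub W b) (sub W c)
  everyLongRun : ∀ i, LongStart T W i → ∃ j, IsLB T K W (i, j)
  zeros : ¬ HasZeros (RA + 1) W
  nz : ¬ HasNZ (RB + 1) W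

/-- The number of long pieces in a list. -/
def countLong (T : ℕ) (Ys : List (List ℕ)) : ℕ := Ys.countP fun Y => IsLong T Y

section
variable {T K F RA RB N : ℕ} {u v : List ℕ} {Ys : List (List ℕ)}

lemma marks_ncard {o : ℕ} (h : ∀ Y ∈ Ys, 0 < Y.length) (Q : List ℕ → Prop) [DecidablePred Q] :
    {b : ℕ × ℕ | ∃ p ∈ marks o Ys, Q p.2 ∧ b = (p.1, p.1 + p.2.length)}.ncard =
      Ys.countP fun Y => Q Y := by
  have e : {b : ℕ × ℕ | ∃ p ∈ marks o Ys, Q p.2 ∧ b = (p.1, p.1 + p.2.length)} =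
      ((((marks o Ys).filter fun p => Q p.2).map fun p => (p.1, p.1 + p.2.length)).toFinset :
        Set (ℕ × ℕ)) := by
    ext b
    simp only [Set.mem_ofPred_eq, List.coe_toFinset, List.mem_map, List.mem_filter,
      decide_eq_true_eq, and_assoc, eq_comm (a := b)]
  have hn : (((marks o Ys).filter fun p => Q p.2).map
      fun p => (p.1, p.1 + p.2.length)).Nodup := by
    refine List.Nodup.map_on (fun p hp q hq hpq => ?_) ((marks_nodup h).filter _)
    by_contra hne
    have hp' := List.mem_of_mem_filter hp
    have hq' := List.mem_of_mem_filter hq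
    have h1 := marks_separated hp' hq' hne
    have h2 := h _ (mem_of_mem_marks hp')
    have h3 := h _ (mem_of_mem_marks hq')
    simp only [Prod.mk.injEq] at hpq
    omega
  rw [e, Set.ncard_coe_finset, List.toFinset_card_of_nodup hn, List.length_map,
    ← List.countP_eq_length_filter]
  conv_rhs => rw [← marks_map_snd o Ys, List.countP_map]
  rfl

lemma sub_mark {p : ℕ × List ℕ} (hp : p ∈ marks u.length Ys) :
    sub (u ++ (Ys.flatten ++ v)) (p.1, p.1 + p.2.length) = p.2 := take_drop_of_mem_marks hp

/-- The conditions on the pieces that are equivalent to goodness. -/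
structure GoodPieces (T F RA RB N : ℕ) (u : List ℕ) (Ys : List (List ℕ)) (v : List ℕ) :
    Prop where
  many : N ≤ countLong T Ys
  common : Ys.Pairwise fun Y Z => IsLong T Y → IsLong T Z → CommonLT F Y Z
  zeros : ¬ (HasZeros (RA + 1) u ∨ (∃ Y ∈ Ys, HasZeros (RA + 1) Y) ∨ HasZeros (RA + 1) v)
  nz : ¬ (HasNZ (RB + 1) u ∨ (∃ Y ∈ Ys, HasNZ (RB + 1) Y) ∨ HasNZ (RB + 1) v)

lemma Valid.countLong_eq (h : Valid T K u Ys v) :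
    {b | IsLB T K (u ++ (Ys.flatten ++ v)) b}.ncard = countLong T Ys := by
  simp only [h.isLB_iff]
  exact marks_ncard (fun Y hY => (h.piece Y hY).pos) _

lemma CommonLT.symm {Y Z : List ℕ} (h : CommonLT F Y Z) : CommonLT F Z Y :=
  fun x h1 h2 => h x h2 h1

/-- Disjointness of the long blocks, and the existence of one at each long run, come for free with
the decomposition. The remaining conditions do not depend on the order of the pieces, because having
only short common factors is a symmetric relation. -/
lemma Valid.goodList_iff (h : Valid T K u Ys v) :
    GoodList T K F RA RB N (u ++ (Ys.flatten ++ v)) ↔ GoodPieces T F RA RB N u Ys v := by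
  constructor
  · intro hg
    refine ⟨?_, ?_, ?_, ?_⟩
    · rw [← h.countLong_eq]; exact hg.many
    · have : (marks u.length Ys).Pairwise fun p q =>
          IsLong T p.2 → IsLong T q.2 → CommonLT F p.2 q.2 := by
        refine (marks_nodup fun Y hY => (h.piece Y hY).pos).pairwise_of_forall_ne ?_
        intro p hp q hq hpq hpl hql
        have := hg.commonFactor _ _ ((h.isLB_iff _).2 ⟨p, hp, hpl, rfl⟩)
          ((h.isLB_iff _).2 ⟨q, hq, hql, rfl⟩) (fun e => by
            have h1 := marks_separated hp hq hpq
            have h2 := (h.piece _ (mem_of_mem_marks hp)).pos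
            have h3 := (h.piece _ (mem_of_mem_marks hq)).pos
            simp only [Prod.mk.injEq] at e
            omega)
        rwa [sub_mark hp, sub_mark hq] at this
      rw [← marks_map_snd u.length Ys, List.pairwise_map]
      exact this
    · rw [← hasZeros_asm h.endsNZ h.piece]; exact hg.zeros
    · rw [← hasNZ_asm h.piece h.tail]; exact hg.nz
  · intro hg
    refine ⟨?_, ?_, ?_, ?_, ?_, ?_⟩
    · rw [h.countLong_eq]; exact hg.many
    · intro b c hb hc hbc
      obtain ⟨p, hp, hpl, rfl⟩ := (h.isLB_iff _).1 hb
      obtain ⟨q, hq, hql, rfl⟩ := (h.isLB_iff _).1 hc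
      exact marks_separated hp hq (fun e => hbc (by rw [e]))
    · intro b c hb hc hbc
      obtain ⟨p, hp, hpl, rfl⟩ := (h.isLB_iff _).1 hb
      obtain ⟨q, hq, hql, rfl⟩ := (h.isLB_iff _).1 hc
      rw [sub_mark hp, sub_mark hq]
      have hP := hg.common
      rw [← marks_map_snd u.length Ys, List.pairwise_map] at hP
      have : Std.Symm (fun p q : ℕ × List ℕ => IsLong T p.2 → IsLong T q.2 → CommonLT F p.2 q.2) :=
        ⟨fun _ _ h h1 h2 => (h h2 h1).symm⟩
      exact hP.forall hp hq (fun e => hbc (by rw [e])) hpl hql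
    · intro i hi
      obtain ⟨p, hp, hpl, rfl⟩ := (h.longStart_iff _).1 hi
      exact ⟨_, (h.isLB_iff _).2 ⟨p, hp, hpl, rfl⟩⟩
    · rw [hasZeros_asm h.endsNZ h.piece]; exact hg.zeros
    · rw [hasNZ_asm h.piece h.tail]; exact hg.nz

lemma Valid.perm (h : Valid T K u Ys v) {Zs : List (List ℕ)} (hp : Ys.Perm Zs) :
    Valid T K u Zs v :=
  ⟨h.prefix_ne, fun Y hY => h.piece Y (hp.mem_iff.2 hY), h.tail⟩

lemma GoodPieces.perm (h : GoodPieces T F RA RB N u Ys v) {Zs : List (List ℕ)}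
    (hp : Ys.Perm Zs) : GoodPieces T F RA RB N u Zs v := by
  refine ⟨?_, ?_, ?_, ?_⟩
  · rw [countLong, ← hp.countP_eq]; exact h.many
  · exact h.common.perm hp fun h h1 h2 => (h h2 h1).symm
  · simpa only [hp.mem_iff] using h.zeros
  · simpa only [hp.mem_iff] using h.nz

/-! ### Existence of the decomposition -/

lemma endsNZ_take {W : List ℕ} {x : ℕ} (hx : RunStart W x) : EndsNZ (W.take x) := by
  intro t ht
  have := hx.lt_length
  rw [List.length_take, min_eq_left this.le] at ht
  rw [letter_take (by omega)]
  exact hx.2 t ht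

/-- Cutting at two run starts removes a nonzero letter's successor on each side, so the runs of the
factor are exactly the runs of `W` that start in it. -/
lemma exists_split {W : List ℕ} {x y : ℕ} (hx : RunStart W x) (hxy : x < y) (hy : RunStart W y) :
    ∃ Y, W.drop x = Y ++ W.drop y ∧ Y.length = y - x ∧ letter Y 0 = 0 ∧ EndsNZ Y ∧
      (∀ t, RunStart Y t ↔ t < y - x ∧ RunStart W (x + t)) ∧
      (∀ t, LongStart T Y t ↔ t < y - x ∧ LongStart T W (x + t)) := by
  have hyl := hy.lt_length
  have hlY : ((W.drop x).take (y - x)).length = y - x := by simp; omega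
  have hd : W.drop x = (W.drop x).take (y - x) ++ W.drop y := by
    conv_lhs => rw [← List.take_append_drop (y - x) (W.drop x)]
    rw [List.drop_drop, show x + (y - x) = y by omega]
  have hW : W = W.take x ++ ((W.drop x).take (y - x) ++ W.drop y) := by
    rw [← hd, List.take_append_drop]
  generalize (W.drop x).take (y - x) = Y at hlY hd hW
  have hle : (W.take x).length = x := by simp; omega
  have hA := endsNZ_take hx
  generalize W.take x = A at hW hle hA
  have hE : EndsNZ Y := by
    intro t ht
    have := hy.2 (x + t) (by omega)
    rw [hW, ← hle, letter_append_add, letter_append_left (by omega)] at this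
    exact this
  refine ⟨Y, hd, hlY, ?_, hE, fun t => ?_, fun t => ?_⟩
  · have := hx.1
    rw [hW] at this
    rw [← hle] at this
    rwa [show A.length = A.length + 0 from rfl, letter_append_add,
      letter_append_left (by omega)] at this
  · constructor
    · intro h
      have hl := h.lt_length
      refine ⟨by omega, ?_⟩
      rw [hW]
      rw [← hle]
      rwa [runStart_append_add hA, runStart_append_left hl]
    · rintro ⟨h1, h2⟩
      rw [hW] at h2
      rw [← hle] at h2
      rwa [runStart_append_add hA, runStart_append_left (by omega)] at h2
  · constructor
    · intro h
      have hl := h.1.lt_length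
      refine ⟨by omega, ?_⟩
      rw [hW]
      rw [← hle]
      rwa [longStart_append_add hA, longStart_append_left hE hl]
    · rintro ⟨h1, h2⟩
      rw [hW] at h2
      rw [← hle] at h2
      rwa [longStart_append_add hA, longStart_append_left hE (by omega)] at h2

/-- The pieces are cut off greedily from a run start `x` that is not strictly inside a long block.
If the run at `x` is long, the piece is its long block; otherwise it reaches the next run start, and
if there is none the rest is the tail. `d` bounds the length that remains. -/
lemma GoodList.exists_pieces {W : List ℕ} (hK : 0 < K) (hg : GoodList T K F RA RB N W) (d : ℕ) :
    ∀ x, W.length - x ≤ d → RunStart W x → (∀ b, IsLB T K W b → ¬ (b.1 < x ∧ x < b.2)) →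
      ∃ (Ys : List (List ℕ)) (v : List ℕ), (∀ Y ∈ Ys, Piece T K Y) ∧ Tail T v ∧ W.drop x = Ys.flatten ++ v := by
  induction d with
  | zero => intro x hd hx; have := hx.lt_length; omega
  | succ d ih =>
    intro x hd hx hc
    have hxl := hx.lt_length
    suffices H : (Tail T (W.drop x)) ∨ ∃ y Y, x < y ∧ RunStart W y ∧
        (∀ b, IsLB T K W b → ¬ (b.1 < y ∧ y < b.2)) ∧ Piece T K Y ∧ W.drop x = Y ++ W.drop y by
      rcases H with H | ⟨y, Y, hxy, hy, hcy, hY, e⟩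
      · exact ⟨[], W.drop x, by simp, H, by simp⟩
      · obtain ⟨Ys, v, h1, h2, h3⟩ := ih y (by omega) hy hcy
        refine ⟨Y :: Ys, v, ?_, h2, by rw [e, h3]; simp⟩
        intro Z hZ
        rcases List.mem_cons.1 hZ with rfl | hZ
        exacts [hY, h1 Z hZ]
    by_cases hl : LongStart T W x
    · obtain ⟨j, hj⟩ := hg.everyLongRun x hl
      have hle := hj.le
      simp only at hle
      obtain ⟨Y, e, hlen, h0, hE, hrs, hls⟩ := exists_split (T := T) hx (by omega) hj.next
      right
      refine ⟨j, Y, by omega, hj.next, fun b hb hcon => ?_, ?_, e⟩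
      · have := hg.noOverlap b (x, j) hb hj (fun e => by rw [e] at hcon; simp at hcon)
        have hbx := hc b hb
        unfold NoOverlap at this
        simp only at this
        omega
      · have hlong : IsLong T Y := (longStart_zero h0).1 ((hls 0).2 ⟨by omega, hl⟩)
        refine ⟨h0, hE, fun h => absurd hlong h, fun _ => by omega, fun _ t ht => ?_, fun t ht => ?_⟩
        · obtain ⟨h1, h2⟩ := (hrs t).1 ht
          by_contra hc'
          have := hj.min _ h2 (by simp only; omega)
          simp only at this
          omega
        -- A second long run inside the piece would begin a long block of its own, overlapping the
        -- first.
        · obtain ⟨h1, h2⟩ := (hls t).1 ht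
          by_contra hne
          obtain ⟨j', hj'⟩ := hg.everyLongRun _ h2
          have := hg.noOverlap _ _ hj hj' (by simp; omega)
          have hle' := hj'.le
          unfold NoOverlap at this
          simp only at this hle'
          omega
    · by_cases hex : ∃ y, x < y ∧ RunStart W y
      · classical
        right
        obtain ⟨hxy, hy⟩ := Nat.find_spec hex
        have hmin : ∀ z, x < z → RunStart W z → Nat.find hex ≤ z :=
          fun z h1 h2 => Nat.find_min' hex ⟨h1, h2⟩
        generalize Nat.find hex = y at hxy hy hmin
        obtain ⟨Y, e, hlen, h0, hE, hrs, hls⟩ := exists_split (T := T) hx hxy hy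
        have hnl : ¬ IsLong T Y := fun h =>
          hl (by simpa using ((hls 0).1 ((longStart_zero h0).2 h)).2)
        have hz : ∀ t, RunStart Y t → t = 0 := fun t ht => by
          obtain ⟨h1, h2⟩ := (hrs t).1 ht
          by_contra hne
          have := hmin _ (by omega) h2
          omega
        refine ⟨y, Y, hxy, hy, fun b hb hcon => ?_, ⟨h0, hE, fun _ => hz, fun h => absurd h hnl,
          fun h => absurd h hnl, fun t ht => hz t ht.1⟩, e⟩
        rcases lt_trichotomy b.1 x with h | h | h
        · exact hc b hb ⟨h, by omega⟩
        · exact hl (h ▸ hb.start)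
        · have := hmin _ h hb.start.1
          omega
      · left
        have hA := endsNZ_take hx
        have hle : (W.take x).length = x := by simp; omega
        refine ⟨by rw [letter_drop]; exact hx.1, fun t ht => ?_, fun h => hl ⟨hx, fun t ht => ?_⟩⟩
        · by_contra hne
          refine hex ⟨x + t, by omega, ?_⟩
          have := (runStart_append_add hA t).2 ht
          rwa [List.take_append_drop, hle] at this
        · rw [← letter_drop]; exact h t ht

lemma GoodList.exists_valid {W : List ℕ} (hK : 0 < K) (hg : GoodList T K F RA RB N W)
    (hN : 0 < N) : ∃ u Ys v, Valid T K u Ys v ∧ W = u ++ (Ys.flatten ++ v) := by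
  classical
  -- Since `N` is positive there is a long block, hence a zero; the letters before the first zero
  -- form `u`.
  have hne : {b | IsLB T K W b}.Nonempty := by
    by_contra h
    have := hg.many
    rw [Set.not_nonempty_iff_eq_empty.1 h] at this
    simp at this
    omega
  have hex : ∃ x, letter W x = 0 := by
    obtain ⟨b, hb⟩ := hne
    exact ⟨_, hb.start.1.1⟩
  have hx := Nat.find_spec hex
  have hmin : ∀ z < Nat.find hex, letter W z ≠ 0 := fun z h => Nat.find_min hex h
  generalize Nat.find hex = x at hx hmin
  have hxl := lt_length_of_letter hx
  obtain ⟨Ys, v, h1, h2, h3⟩ := hg.exists_pieces hK _ x le_rfl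
    ⟨hx, fun j hj => hmin j (by omega)⟩ (fun b hb h => hmin _ h.1 hb.start.1.1)
  refine ⟨W.take x, Ys, v, ⟨fun t ht => ?_, h1, h2⟩, by rw [← h3, List.take_append_drop]⟩
  rw [List.length_take] at ht
  rw [letter_take (by omega)]
  exact hmin t (by omega)

/-! ### Uniqueness of the decomposition -/

lemma isLong_append_iff {A B : List ℕ} (hA : EndsNZ A) (h0 : 0 < A.length) :
    IsLong T (A ++ B) ↔ IsLong T A := by
  constructor
  · intro h t ht
    have := lt_of_zeros (i := 0) hA h0 (r := T) (by simpa [IsLong] using h)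
    rw [if_neg (by omega)] at this
    rw [← h t ht, letter_append_left (by omega)]
  · intro h t ht
    rw [letter_append_left (lt_length_of_letter (h t ht)), h t ht]

/-- If `Z` were longer than `Y`, the end of `Y` would be a run start inside `Z`. A short piece has
no run start except 0. If `Z` is long then so is `Y`, whose end is at distance at least `K`, where
`Z` has no run start. -/
lemma Piece.length_le_of_append_eq {Y Z A B : List ℕ} (hY : Piece T K Y) (hZ : Piece T K Z)
    (hA : letter A 0 = 0) (e : Y ++ A = Z ++ B) : Z.length ≤ Y.length := by
  by_contra h
  have h1 : RunStart Z Y.length := by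
    rw [← runStart_append_left (B := B) (not_le.1 h), ← e]
    exact (runStart_append_add hY.last 0).2 (runStart_zero.2 hA)
  by_cases hl : IsLong T Z
  · have := hZ.lt_of_runStart hl _ h1
    have := hY.length_le
      (by rwa [← isLong_append_iff hZ.last hZ.pos, ← e, isLong_append_iff hY.last hY.pos] at hl)
    omega
  · have := hZ.short hl _ h1
    have := hY.pos
    omega

lemma pieces_unique {Zs : List (List ℕ)} {w : List ℕ}
    (hY : ∀ Y ∈ Ys, Piece T K Y) (hv : Tail T v) (hZ : ∀ Y ∈ Zs, Piece T K Y) (hw : Tail T w)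
    (e : Ys.flatten ++ v = Zs.flatten ++ w) : Ys = Zs ∧ v = w := by
  -- A tail contains only one run of zeros, whereas a piece followed by anything admissible contains
  -- two.
  have key : ∀ {Y : List ℕ} {Zs : List (List ℕ)} {v w : List ℕ}, Tail T v → Piece T K Y →
      (∀ Y ∈ Zs, Piece T K Y) → Tail T w → v ≠ (Y :: Zs).flatten ++ w := by
    intro Y Zs v w hv hY hZ hw e
    rw [List.flatten_cons, List.append_assoc] at e
    have h1 : RunStart v (Y.length + 0) := by
      rw [e, runStart_append_add hY.last, runStart_zero]
      exact letter_flatten_append hZ hw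
    have := hv.runStart _ h1
    have := hY.pos
    omega
  induction Ys generalizing Zs with
  | nil =>
    cases Zs with
    | nil => simpa using e
    | cons Y Zs => exact absurd e (key hv (hZ Y (by simp)) (fun Z h => hZ Z (by simp [h])) hw)
  | cons Y Ys ih =>
    have hYs : ∀ Z ∈ Ys, Piece T K Z := fun Z h => hY Z (by simp [h])
    cases Zs with
    | nil => exact absurd e.symm (key hw (hY Y (by simp)) hYs hv)
    | cons Z Zs =>
      have hZs : ∀ Y ∈ Zs, Piece T K Y := fun Z h => hZ Z (by simp [h])
      simp only [List.flatten_cons, List.append_assoc] at e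
      have h1 := (hY Y (by simp)).length_le_of_append_eq (hZ Z (by simp))
        (letter_flatten_append hYs hv) e
      have h2 := (hZ Z (by simp)).length_le_of_append_eq (hY Y (by simp))
        (letter_flatten_append hZs hw) e.symm
      obtain ⟨rfl, e'⟩ := List.append_inj e (le_antisymm h2 h1)
      obtain ⟨rfl, rfl⟩ := ih hYs hZs e'
      exact ⟨rfl, rfl⟩

lemma Valid.unique {u' v' : List ℕ} {Zs : List (List ℕ)} (h : Valid T K u Ys v)
    (h' : Valid T K u' Zs v') (e : u ++ (Ys.flatten ++ v) = u' ++ (Zs.flatten ++ v')) :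
    u = u' ∧ Ys = Zs ∧ v = v' := by
  have key : ∀ {u u' A B : List ℕ}, (∀ t < u'.length, letter u' t ≠ 0) → letter A 0 = 0 →
      u ++ A = u' ++ B → u'.length ≤ u.length := by
    intro u u' A B hu' hA e
    by_contra hc
    refine hu' u.length (not_le.1 hc) ?_
    rw [← letter_append_left (B := B) (not_le.1 hc), ← e]
    exact (letter_append_add u A 0).trans hA
  have h1 := key h'.prefix_ne (letter_flatten_append h.piece h.tail) e
  have h2 := key h.prefix_ne (letter_flatten_append h'.piece h'.tail) e.symm
  obtain ⟨rfl, e'⟩ := List.append_inj e (le_antisymm h2 h1)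
  exact ⟨rfl, pieces_unique h.piece h.tail h'.piece h'.tail e'⟩

end

/-! ### The words `Fin n → ℕ` and their lists of letters -/

/-- The minimal length of a long run. -/
noncomputable def runPar (q ε : ℝ) (n : ℕ) : ℕ := ⌈(1 - ε) * Real.logb (1 / q) n⌉₊

/-- The minimal length of a long block. -/
noncomputable def blockPar (q : ℝ) (n : ℕ) : ℕ := ⌊1 + 3 * Real.logb (1 / beta q) n⌋₊ + 1

/-- The strict upper bound of the lengths of common factors. -/
noncomputable def factorPar (q : ℝ) (n : ℕ) : ℕ := ⌈3 * Real.logb (1 / beta q) n⌉₊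

/-- The maximal length of a run of the letter of probability `q`. -/
noncomputable def maxPar (q : ℝ) (n : ℕ) : ℕ := ⌊2 * Real.logb (1 / q) n⌋₊

/-- The minimal number of long blocks. -/
noncomputable def countPar (ε α : ℝ) (n : ℕ) : ℕ := ⌊α * (n : ℝ) ^ ε⌋₊

lemma blockPar_pos (q : ℝ) (n : ℕ) : 0 < blockPar q n := Nat.succ_pos _

lemma logb_inv_nonneg {b : ℝ} (hb0 : 0 < b) (hb1 : b < 1) (n : ℕ) :
    0 ≤ Real.logb (1 / b) n := by
  rcases Nat.eq_zero_or_pos n with rfl | hn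
  · simp
  · exact Real.logb_nonneg (by rw [lt_div_iff₀ hb0]; linarith) (by exact_mod_cast hn)

lemma beta_pos {q : ℝ} (hq0 : 0 < q) : 0 < beta q := lt_max_of_lt_left hq0

lemma beta_lt_one {q : ℝ} (hq0 : 0 < q) (hq1 : q < 1) : beta q < 1 :=
  max_lt hq1 (by linarith)

section
variable {q ε α : ℝ} {n : ℕ} {w : Fin n → ℕ}

lemma letter_ofFn (w : Fin n → ℕ) (t : Fin n) : letter (List.ofFn w) t = w t := by
  rw [letter_eq_getElem (by simp)]
  simp

lemma mem_runs {P : ℕ → Prop} [DecidablePred P] {r : ℕ × ℕ} :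
    r ∈ runs P w ↔ r.1 < r.2 ∧ r.2 ≤ n ∧ (∀ t, r.1 ≤ t → t < r.2 → P (letter (List.ofFn w) t)) ∧
      (∀ t, t + 1 = r.1 → ¬ P (letter (List.ofFn w) t)) ∧
      (r.2 < n → ¬ P (letter (List.ofFn w) r.2)) := by
  simp only [runs, Finset.mem_filter, Finset.mem_product, Finset.mem_range]
  constructor
  · rintro ⟨⟨_, h2⟩, h3, h4, h5, h6⟩
    refine ⟨h3, by omega, fun t h h' => ?_, fun t h => ?_, fun h => ?_⟩
    · rw [letter_ofFn w ⟨t, by omega⟩]; exact h4 _ h h'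
    · rw [letter_ofFn w ⟨t, by omega⟩]; exact h5 _ h
    · rw [letter_ofFn w ⟨r.2, h⟩]; exact h6 _ rfl
  · rintro ⟨h1, h2, h3, h4, h5⟩
    refine ⟨⟨by omega, by omega⟩, h1, fun t h h' => ?_, fun t h => ?_, fun t h => ?_⟩
    · rw [← letter_ofFn w t]; exact h3 _ h h'
    · rw [← letter_ofFn w t]; exact h4 _ h
    · rw [← letter_ofFn w t, h]; exact h5 (by omega)

lemma exists_run {P : ℕ → Prop} [DecidablePred P] {x r : ℕ} (hr : 0 < r) (hxn : x + r ≤ n)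
    (h : ∀ t < r, P (letter (List.ofFn w) (x + t))) :
    ∃ b ∈ runs P w, b.1 ≤ x ∧ x + r ≤ b.2 := by
  classical
  have hex1 : ∃ i, i ≤ x ∧ ∀ t, i ≤ t → t ≤ x → P (letter (List.ofFn w) t) :=
    ⟨x, le_rfl, fun t h1 h2 => by
      obtain rfl : t = x := le_antisymm h2 h1
      exact h 0 hr⟩
  have hi := Nat.find_spec hex1
  have hmin : ∀ z < Nat.find hex1, _ := fun z hz => Nat.find_min hex1 hz
  generalize Nat.find hex1 = i at hi hmin
  have hex2 : ∃ j, x < j ∧ (j = n ∨ ¬ P (letter (List.ofFn w) j)) := ⟨n, by omega, Or.inl rfl⟩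
  have hj := Nat.find_spec hex2
  have hjmin : ∀ z < Nat.find hex2, _ := fun z hz => Nat.find_min hex2 hz
  have hjn : Nat.find hex2 ≤ n := Nat.find_min' hex2 ⟨by omega, Or.inl rfl⟩
  generalize Nat.find hex2 = j at hj hjmin hjn
  refine ⟨(i, j), mem_runs.2 ⟨by simp only; omega, hjn, fun t h1 h2 => ?_, fun t ht hP => ?_,
    fun hlt => ?_⟩, hi.1, ?_⟩
  · rcases le_or_gt t x with h3 | h3
    · exact hi.2 t h1 h3
    · have := hjmin t h2
      by_contra hc
      exact this ⟨h3, Or.inr hc⟩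
  · refine hmin t (by simp only at ht; omega) ⟨by simp only at ht; omega, fun s h1 h2 => ?_⟩
    rcases h1.eq_or_lt with rfl | h1
    · exact hP
    · exact hi.2 s (by simp only at ht; omega) h2
  · exact hj.2.resolve_left hlt.ne
  · by_contra hc
    simp only at hc
    have := h (j - x) (by omega)
    rw [show x + (j - x) = j by omega] at this
    rcases hj.2 with h1 | h1
    · omega
    · exact h1 this

lemma mem_aRuns {r : ℕ × ℕ} : r ∈ aRuns w ↔ r.1 < r.2 ∧ RunStart (List.ofFn w) r.1 ∧
    (∀ t, r.1 ≤ t → t < r.2 → letter (List.ofFn w) t = 0) ∧ letter (List.ofFn w) r.2 ≠ 0 := by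
  rw [aRuns, mem_runs]
  constructor
  · rintro ⟨h1, h2, h3, h4, h5⟩
    refine ⟨h1, ⟨h3 _ le_rfl h1, h4⟩, h3, ?_⟩
    rcases h2.lt_or_eq with h | h
    · exact h5 h
    · rw [letter_of_le (by simp [h])]; exact one_ne_zero
  · rintro ⟨h1, h2, h3, h4⟩
    have := lt_length_of_letter (h3 (r.2 - 1) (by omega) (by omega))
    rw [List.length_ofFn] at this
    exact ⟨h1, by omega, h3, h2.2, fun _ => h4⟩

lemma exists_runEnd {W : List ℕ} {i : ℕ} (h : letter W i = 0) :
    ∃ j, i < j ∧ (∀ t, i ≤ t → t < j → letter W t = 0) ∧ letter W j ≠ 0 := by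
  classical
  have hex : ∃ j, i ≤ j ∧ letter W j ≠ 0 :=
    ⟨W.length + i, by omega, by rw [letter_of_le (by omega)]; exact one_ne_zero⟩
  have hj := Nat.find_spec hex
  have hmin : ∀ z < Nat.find hex, _ := fun z hz => Nat.find_min hex hz
  generalize Nat.find hex = j at hj hmin
  refine ⟨j, lt_of_le_of_ne hj.1 (fun e => hj.2 (e ▸ h)), fun t h1 h2 => ?_, hj.2⟩
  by_contra hc
  exact hmin t h2 ⟨h1, hc⟩

lemma exists_aRun_iff {i : ℕ} : (∃ r ∈ aRuns w, r.1 = i) ↔ RunStart (List.ofFn w) i := by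
  constructor
  · rintro ⟨r, hr, rfl⟩
    exact (mem_aRuns.1 hr).2.1
  · intro h
    obtain ⟨j, h1, h2, h3⟩ := exists_runEnd h.1
    exact ⟨(i, j), mem_aRuns.2 ⟨h1, h, h2, h3⟩, rfl⟩

lemma exists_longRun_iff {i : ℕ} :
    (∃ r ∈ longRuns q ε w, r.1 = i) ↔ LongStart (runPar q ε n) (List.ofFn w) i := by
  simp only [longRuns, Finset.mem_filter, ← Nat.ceil_le]
  constructor
  · rintro ⟨r, ⟨hr, hl⟩, rfl⟩
    rw [mem_aRuns] at hr
    refine ⟨hr.2.1, fun t ht => hr.2.2.1 _ (by omega) ?_⟩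
    change runPar q ε n ≤ _ at hl
    omega
  · rintro ⟨h, hz⟩
    obtain ⟨j, h1, h2, h3⟩ := exists_runEnd h.1
    refine ⟨(i, j), ⟨mem_aRuns.2 ⟨h1, h, h2, h3⟩, ?_⟩, rfl⟩
    change runPar q ε n ≤ j - i
    by_contra hc
    refine h3 ?_
    have := hz (j - i) (by omega)
    rwa [show i + (j - i) = j by omega] at this

lemma isLongFactor_iff (hq0 : 0 < q) (hq1 : q < 1) {b : ℕ × ℕ} :
    IsLongFactor q ε w b ↔ LongStart (runPar q ε n) (List.ofFn w) b.1 ∧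
      RunStart (List.ofFn w) b.2 ∧ b.1 + blockPar q n ≤ b.2 := by
  have h0 := logb_inv_nonneg (beta_pos hq0) (beta_lt_one hq0 hq1) n
  rw [IsLongFactor, exists_longRun_iff, exists_aRun_iff, ← Nat.floor_lt (by linarith), blockPar]
  refine and_congr_right fun _ => and_congr_right fun _ => ?_
  omega

lemma mem_longBlocks (hq0 : 0 < q) (hq1 : q < 1) {b : ℕ × ℕ} :
    b ∈ longBlocks q ε w ↔ IsLB (runPar q ε n) (blockPar q n) (List.ofFn w) b := by
  simp only [longBlocks, Finset.mem_filter, Finset.mem_product, Finset.mem_range,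
    isLongFactor_iff hq0 hq1]
  constructor
  · rintro ⟨_, ⟨h1, h2, h3⟩, h4⟩
    refine ⟨h1, h2, h3, fun j hj hle => ?_⟩
    exact h4 (b.1, j) ⟨h1, hj, hle⟩ rfl
  · rintro ⟨h1, h2, h3, h4⟩
    have l1 := h1.1.lt_length
    have l2 := h2.lt_length
    rw [List.length_ofFn] at l1 l2
    exact ⟨⟨by omega, by omega⟩, ⟨h1, h2, h3⟩, fun c hc e => h4 _ hc.2.1 (e ▸ hc.2.2)⟩

lemma card_longBlocks (hq0 : 0 < q) (hq1 : q < 1) : (longBlocks q ε w).card =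
    {b | IsLB (runPar q ε n) (blockPar q n) (List.ofFn w) b}.ncard := by
  rw [← Set.ncard_coe_finset]
  congr 1
  ext b
  simp [mem_longBlocks hq0 hq1]

lemma maxLength_le_iff {R : Finset (ℕ × ℕ)} {x : ℝ} (hx : 0 ≤ x) :
    (maxLength R : ℝ) ≤ x ↔ ∀ r ∈ R, r.2 - r.1 ≤ ⌊x⌋₊ := by
  rw [← Nat.le_floor_iff hx, maxLength, Finset.sup_le_iff]

/-- The real thresholds are rounded so that every comparison with an integer is kept exactly: up for
"at least" and for "shorter than", down for "at most", and down plus one for "longer than". -/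
lemma isGood_iff (hq0 : 0 < q) (hq1 : q < 1) :
    IsGood q ε α w ↔ GoodList (runPar q ε n) (blockPar q n) (factorPar q n) (maxPar q n)
      (maxPar (1 - q) n) (countPar ε α n) (List.ofFn w) := by
  have hz : (maxLength (aRuns w) : ℝ) ≤ 2 * Real.logb (1 / q) n ↔
      ¬ HasZeros (maxPar q n + 1) (List.ofFn w) := by
    rw [maxLength_le_iff (mul_nonneg zero_le_two (logb_inv_nonneg hq0 hq1 n))]
    change (∀ r ∈ aRuns w, r.2 - r.1 ≤ maxPar q n) ↔ _
    constructor
    · rintro h ⟨x, hx⟩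
      have hl := lt_length_of_letter (hx (maxPar q n) (by omega))
      rw [List.length_ofFn] at hl
      obtain ⟨b, hb, h1, h2⟩ := exists_run (P := fun x => x = 0) (w := w) (Nat.succ_pos _)
        (by omega) hx
      have := h b hb
      omega
    · intro h r hr
      by_contra hc
      rw [mem_aRuns] at hr
      exact h ⟨r.1, fun t ht => hr.2.2.1 _ (by omega) (by omega)⟩
  have hnz : (maxLength (otherRuns w) : ℝ) ≤ 2 * Real.logb (1 / (1 - q)) n ↔
      ¬ HasNZ (maxPar (1 - q) n + 1) (List.ofFn w) := by
    rw [maxLength_le_iff (mul_nonneg zero_le_two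
      (logb_inv_nonneg (by linarith) (by linarith) n))]
    change (∀ r ∈ otherRuns w, r.2 - r.1 ≤ maxPar (1 - q) n) ↔ _
    constructor
    · rintro h ⟨x, hl, hx⟩
      rw [List.length_ofFn] at hl
      obtain ⟨b, hb, h1, h2⟩ := exists_run (P := fun x => x ≠ 0) (w := w) (Nat.succ_pos _) hl hx
      have := h b hb
      omega
    · intro h r hr
      by_contra hc
      have hr := mem_runs.1 hr
      exact h ⟨r.1, by rw [List.length_ofFn]; omega, fun t ht =>
        hr.2.2.1 _ (by omega) (by omega)⟩
  constructor
  · rintro ⟨h1, h2, h3, h4, h5, h6⟩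
    refine ⟨by rwa [← card_longBlocks hq0 hq1], fun b c hb hc => ?_, fun b c hb hc hbc x hx hy => ?_,
      fun i hi => ?_, hz.1 h5, hnz.1 h6⟩
    · exact h2 b ((mem_longBlocks hq0 hq1).2 hb) c ((mem_longBlocks hq0 hq1).2 hc)
    · exact Nat.lt_ceil.2 (h3 b ((mem_longBlocks hq0 hq1).2 hb) c
        ((mem_longBlocks hq0 hq1).2 hc) hbc x hx hy)
    · obtain ⟨r, hr, rfl⟩ := exists_longRun_iff.2 hi
      obtain ⟨b, hb, e⟩ := h4 r hr
      exact ⟨b.2, by rw [← e]; exact (mem_longBlocks hq0 hq1).1 hb⟩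
  · rintro ⟨h1, h2, h3, h4, h5, h6⟩
    refine ⟨by rwa [← card_longBlocks hq0 hq1] at h1, fun b hb c hc => ?_,
      fun b hb c hc hbc x hx hy => ?_, fun r hr => ?_, hz.2 h5, hnz.2 h6⟩
    · exact h2 b c ((mem_longBlocks hq0 hq1).1 hb) ((mem_longBlocks hq0 hq1).1 hc)
    · exact Nat.lt_ceil.1 (h3 b c ((mem_longBlocks hq0 hq1).1 hb)
        ((mem_longBlocks hq0 hq1).1 hc) hbc x hx hy)
    · obtain ⟨j, hj⟩ := h4 r.1 (exists_longRun_iff.1 ⟨r, hr, rfl⟩)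
      exact ⟨_, (mem_longBlocks hq0 hq1).2 hj, rfl⟩

/-! ### Lexicographic comparisons and ranks -/

lemma lt_of_letter {A B : List ℕ} {i : ℕ} (hA : i < A.length) (hB : i < B.length)
    (h : ∀ j < i, letter A j = letter B j) (hi : letter A i < letter B i) : A < B := by
  refine List.lt_iff_exists.2 (Or.inr ⟨i, hA, hB, fun j hj => ?_, ?_⟩)
  · have := h j hj
    rwa [letter_eq_getElem (by omega), letter_eq_getElem (by omega)] at this
  · rwa [letter_eq_getElem hA, letter_eq_getElem hB] at hi

lemma length_sub {W : List ℕ} {b : ℕ × ℕ} (h : b.2 ≤ W.length) : (sub W b).length = b.2 - b.1 := by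
  simp [sub, h]

lemma letter_sub {W : List ℕ} {b : ℕ × ℕ} {t : ℕ} (h : b.1 + t < b.2) :
    letter (sub W b) t = letter W (b.1 + t) := by
  rw [sub, letter_drop, letter_take h]

lemma IsLB.lt_of_zeros {T K : ℕ} {W : List ℕ} {b : ℕ × ℕ} (hb : IsLB T K W b) (hK : 0 < K) {t : ℕ}
    (ht : t < T) : b.1 + t < b.2 := by
  by_contra hc
  have h1 := hb.le
  have h2 := hb.next.2 (b.2 - 1) (by omega)
  have h3 := hb.start.2 (b.2 - 1 - b.1) (by omega)
  rw [show b.1 + (b.2 - 1 - b.1) = b.2 - 1 by omega] at h3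
  exact h2 h3

/-- A short block begins with fewer than `runPar` zeros, for otherwise a long block would begin
there and overlap it. At its first nonzero letter the long block still has a zero. -/
lemma factor_lt_of_shortBlock (hq0 : 0 < q) (hq1 : q < 1) (hg : IsGood q ε α w) {b c : ℕ × ℕ}
    (hb : b ∈ longBlocks q ε w) (hc : c ∈ shortBlocks q ε w) : factor w b < factor w c := by
  rw [mem_longBlocks hq0 hq1] at hb
  simp only [shortBlocks, Finset.mem_filter, Finset.mem_product, Finset.mem_range] at hc
  obtain ⟨⟨_, hc2⟩, ⟨m, hm1, hm2⟩, hc3⟩ := hc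
  have hm1 := mem_aRuns.1 hm1
  have hm2 := mem_runs.1 hm2
  simp only at hm1 hm2
  have hnl : m - c.1 < runPar q ε n := by
    by_contra hlong
    obtain ⟨d, hd⟩ := ((isGood_iff hq0 hq1).1 hg).everyLongRun c.1
      ⟨hm1.2.1, fun t ht => hm1.2.2.1 _ (by omega) (by omega)⟩
    have h1 := hc3 _ ((mem_longBlocks hq0 hq1).2 hd)
    have h2 := hd.le
    have h3 := blockPar_pos q n
    unfold NoOverlap at h1
    simp only at h1 h2
    omega
  have hlt := hb.lt_of_zeros (blockPar_pos q n) hnl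
  have hbl := hb.next.lt_length
  refine lt_of_letter (A := sub (List.ofFn w) b) (B := sub (List.ofFn w) c) (i := m - c.1) ?_ ?_
    (fun j hj => ?_) ?_
  · rw [length_sub hbl.le]; omega
  · rw [length_sub (by simp; omega)]; omega
  · rw [letter_sub (by omega), letter_sub (by omega), hb.start.2 _ (by omega),
      hm1.2.2.1 _ (by omega) (by omega)]
  · rw [letter_sub (by omega), letter_sub (by omega), hb.start.2 _ (by omega),
      show c.1 + (m - c.1) = m by omega]
    exact Nat.pos_of_ne_zero hm1.2.2.2

lemma rank_lt_rank {b c : ℕ × ℕ} (hb : b ∈ blocks q ε w) (h : factor w b < factor w c) :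
    rank q ε w b < rank q ε w c := by
  refine Finset.card_lt_card ((Finset.ssubset_iff_of_subset fun d hd => ?_).2 ⟨b, ?_, ?_⟩)
  · rw [Finset.mem_filter] at hd ⊢
    exact ⟨hd.1, hd.2.trans h⟩
  · exact Finset.mem_filter.2 ⟨hb, h⟩
  · simp

lemma rank_of_longBlock (hq0 : 0 < q) (hq1 : q < 1) (hg : IsGood q ε α w) {b : ℕ × ℕ}
    (hb : b ∈ longBlocks q ε w) :
    rank q ε w b = ((longBlocks q ε w).filter fun c => factor w c < factor w b).card := by
  rw [rank, blocks, Finset.filter_union, Finset.union_eq_left.2]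
  intro c hc
  rw [Finset.mem_filter] at hc
  exact absurd hc.2 (factor_lt_of_shortBlock hq0 hq1 hg hb hc.1).asymm

end

/-! ### Decompositions of good words and positions of blocks -/

/-- The decomposition of the good word `w`. -/
structure Dec (q ε α : ℝ) {n : ℕ} (w : Fin n → ℕ) (u : List ℕ) (Ys : List (List ℕ))
    (v : List ℕ) : Prop where
  valid : Valid (runPar q ε n) (blockPar q n) u Ys v
  good : GoodPieces (runPar q ε n) (factorPar q n) (maxPar q n) (maxPar (1 - q) n)
    (countPar ε α n) u Ys v
  eq : List.ofFn w = u ++ (Ys.flatten ++ v)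

/-- The number of long words of `Ys` that are smaller than `Y`. -/
def rankIn (T : ℕ) (Ys : List (List ℕ)) (Y : List ℕ) : ℕ :=
  Ys.countP fun Z => IsLong T Z ∧ Z < Y

lemma rankIn_perm {T : ℕ} {Ys Zs : List (List ℕ)} (h : Ys.Perm Zs) (Y : List ℕ) :
    rankIn T Ys Y = rankIn T Zs Y := h.countP_eq _

section
variable {q ε α : ℝ} {n : ℕ} {w : Fin n → ℕ} {u v : List ℕ} {Ys : List (List ℕ)}

lemma Dec.isGood (hq0 : 0 < q) (hq1 : q < 1) (h : Dec q ε α w u Ys v) : IsGood q ε α w := by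
  rw [isGood_iff hq0 hq1, h.eq]
  exact h.valid.goodList_iff.2 h.good

lemma exists_dec (hq0 : 0 < q) (hq1 : q < 1) (hN : 0 < countPar ε α n) (hg : IsGood q ε α w) :
    ∃ u Ys v, Dec q ε α w u Ys v := by
  have hg' := (isGood_iff hq0 hq1).1 hg
  obtain ⟨u, Ys, v, h1, h2⟩ := hg'.exists_valid (blockPar_pos q n) hN
  exact ⟨u, Ys, v, h1, h1.goodList_iff.1 (h2 ▸ hg'), h2⟩

lemma Dec.unique (h : Dec q ε α w u Ys v) {u' v' : List ℕ} {Zs : List (List ℕ)}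
    (h' : Dec q ε α w u' Zs v') : u = u' ∧ Ys = Zs ∧ v = v' :=
  h.valid.unique h'.valid (h.eq.symm.trans h'.eq)

lemma Dec.mem_longBlocks_iff (hq0 : 0 < q) (hq1 : q < 1) (h : Dec q ε α w u Ys v) {b : ℕ × ℕ} :
    b ∈ longBlocks q ε w ↔
      ∃ p ∈ marks u.length Ys, IsLong (runPar q ε n) p.2 ∧ b = (p.1, p.1 + p.2.length) := by
  rw [mem_longBlocks hq0 hq1, h.eq, h.valid.isLB_iff]

lemma Dec.card_longBlocks (hq0 : 0 < q) (hq1 : q < 1) (h : Dec q ε α w u Ys v) :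
    (longBlocks q ε w).card = countLong (runPar q ε n) Ys := by
  rw [LyndonBlocks.card_longBlocks hq0 hq1, h.eq, h.valid.countLong_eq]

lemma Dec.factor_mark (h : Dec q ε α w u Ys v) {p : ℕ × List ℕ} (hp : p ∈ marks u.length Ys) :
    factor w (p.1, p.1 + p.2.length) = p.2 := by
  have := sub_mark (v := v) hp
  rwa [← h.eq] at this

/-- This makes long blocks pairwise distinct, and none a prefix of another: agreement on `factorPar`
letters would be a forbidden common factor. -/
lemma factorPar_lt_blockPar (hq0 : 0 < q) (hq1 : q < 1) (n : ℕ) : factorPar q n < blockPar q n := by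
  have h0 := logb_inv_nonneg (beta_pos hq0) (beta_lt_one hq0 hq1) n
  rw [factorPar, blockPar, Nat.lt_succ_iff, Nat.ceil_le, add_comm, Nat.floor_add_one (by linarith)]
  push_cast
  exact (Nat.lt_floor_add_one _).le

lemma Dec.commonLT (h : Dec q ε α w u Ys v) {p p' : ℕ × List ℕ} (hp : p ∈ marks u.length Ys)
    (hp' : p' ∈ marks u.length Ys) (hl : IsLong (runPar q ε n) p.2)
    (hl' : IsLong (runPar q ε n) p'.2) (hne : p ≠ p') : CommonLT (factorPar q n) p.2 p'.2 := by
  have hP := h.good.common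
  rw [← marks_map_snd u.length Ys, List.pairwise_map] at hP
  have : Std.Symm (fun p p' : ℕ × List ℕ => IsLong (runPar q ε n) p.2 →
      IsLong (runPar q ε n) p'.2 → CommonLT (factorPar q n) p.2 p'.2) :=
    ⟨fun _ _ h h1 h2 => (h h2 h1).symm⟩
  exact hP.forall hp hp' hne hl hl'

lemma Dec.mark_ext (hq0 : 0 < q) (hq1 : q < 1) (h : Dec q ε α w u Ys v) {p p' : ℕ × List ℕ}
    (hp : p ∈ marks u.length Ys) (hp' : p' ∈ marks u.length Ys)
    (hl : IsLong (runPar q ε n) p.2) (e : p.2 = p'.2) : p = p' := by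
  by_contra hne
  have h1 := h.commonLT hp hp' hl (e ▸ hl) hne p.2 List.infix_rfl (e ▸ List.infix_rfl)
  have h2 := (h.valid.piece _ (mem_of_mem_marks hp)).length_le hl
  have h3 := factorPar_lt_blockPar hq0 hq1 n
  omega

lemma Dec.rank_mark (hq0 : 0 < q) (hq1 : q < 1) (h : Dec q ε α w u Ys v) {p : ℕ × List ℕ}
    (hp : p ∈ marks u.length Ys) (hl : IsLong (runPar q ε n) p.2) :
    rank q ε w (p.1, p.1 + p.2.length) = rankIn (runPar q ε n) Ys p.2 := by
  rw [rank_of_longBlock hq0 hq1 (h.isGood hq0 hq1) ((h.mem_longBlocks_iff hq0 hq1).2 ⟨p, hp, hl, rfl⟩),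
    rankIn, ← marks_ncard (o := u.length) (fun Y hY => (h.valid.piece Y hY).pos)
      (fun Z => IsLong (runPar q ε n) Z ∧ Z < p.2), ← Set.ncard_coe_finset]
  congr 1
  ext b
  simp only [Finset.coe_filter, Set.mem_ofPred_eq, h.mem_longBlocks_iff hq0 hq1, h.factor_mark hp]
  constructor
  · rintro ⟨⟨p', hp', hl', rfl⟩, h2⟩
    exact ⟨p', hp', ⟨hl', by rwa [h.factor_mark hp'] at h2⟩, rfl⟩
  · rintro ⟨p', hp', ⟨hl', h2⟩, rfl⟩
    exact ⟨⟨p', hp', hl', rfl⟩, by rwa [h.factor_mark hp']⟩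

/-- Exactly one block has this rank, since long pieces are distinct words and short blocks are
larger. The infimum that defines `blockPos` is over a single position. -/
lemma Dec.blockPos_eq (hq0 : 0 < q) (hq1 : q < 1) (h : Dec q ε α w u Ys v) {p : ℕ × List ℕ}
    (hp : p ∈ marks u.length Ys) (hl : IsLong (runPar q ε n) p.2) :
    blockPos q ε w (rankIn (runPar q ε n) Ys p.2) = (p.1 : ℝ) / n := by
  have hb := (h.mem_longBlocks_iff hq0 hq1).2 ⟨p, hp, hl, rfl⟩
  have hg := h.isGood hq0 hq1
  have e : {s : ℕ | ∃ b ∈ blocks q ε w,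
      rank q ε w b = rankIn (runPar q ε n) Ys p.2 ∧ b.1 = s} = {p.1} := by
    ext s
    rw [← h.rank_mark hq0 hq1 hp hl]
    constructor
    · rintro ⟨b, hb', hr, rfl⟩
      rcases Finset.mem_union.1 hb' with hbl | hbs
      · rcases lt_trichotomy (factor w b) (factor w (p.1, p.1 + p.2.length)) with h1 | h1 | h1
        · exact absurd hr (rank_lt_rank hb' h1).ne
        · obtain ⟨p', hp', hl', rfl⟩ := (h.mem_longBlocks_iff hq0 hq1).1 hbl
          rw [h.factor_mark hp, h.factor_mark hp'] at h1
          rw [h.mark_ext hq0 hq1 hp' hp hl' h1]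
          rfl
        · exact absurd hr (rank_lt_rank (Finset.mem_union_left _ hb) h1).ne'
      · exact absurd hr (rank_lt_rank (Finset.mem_union_left _ hb)
          (factor_lt_of_shortBlock hq0 hq1 hg hb hbs)).ne'
    · rintro rfl
      exact ⟨_, Finset.mem_union_left _ hb, rfl, rfl⟩
  rw [blockPos, e, csInf_singleton]

/-- The rank is an injection from the long blocks to the numbers below their cardinality, hence a
bijection. -/
lemma Dec.exists_mark_rankIn (hq0 : 0 < q) (hq1 : q < 1) (h : Dec q ε α w u Ys v) {i : ℕ}
    (hi : i < countLong (runPar q ε n) Ys) :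
    ∃ p ∈ marks u.length Ys, IsLong (runPar q ε n) p.2 ∧ rankIn (runPar q ε n) Ys p.2 = i := by
  have hg := h.isGood hq0 hq1
  rw [← h.card_longBlocks hq0 hq1] at hi
  obtain ⟨b, hb, e⟩ := Finset.surj_on_of_inj_on_of_card_le (s := longBlocks q ε w)
    (t := Finset.range (longBlocks q ε w).card) (fun b _ => rank q ε w b)
    (fun b hb => by
      rw [Finset.mem_range, rank_of_longBlock hq0 hq1 hg hb]
      exact Finset.card_lt_card (Finset.filter_ssubset.2 ⟨b, hb, lt_irrefl _⟩))
    (fun b c hb hc hbc => by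
      rcases lt_trichotomy (factor w b) (factor w c) with h1 | h1 | h1
      · exact absurd hbc (rank_lt_rank (Finset.mem_union_left _ hb) h1).ne
      · obtain ⟨p, hp, hl, rfl⟩ := (h.mem_longBlocks_iff hq0 hq1).1 hb
        obtain ⟨p', hp', hl', rfl⟩ := (h.mem_longBlocks_iff hq0 hq1).1 hc
        rw [h.factor_mark hp, h.factor_mark hp'] at h1
        rw [h.mark_ext hq0 hq1 hp hp' hl h1]
      · exact absurd hbc (rank_lt_rank (Finset.mem_union_left _ hc) h1).ne')
    (by simp) i (Finset.mem_range.2 hi)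
  obtain ⟨p, hp, hl, rfl⟩ := (h.mem_longBlocks_iff hq0 hq1).1 hb
  exact ⟨p, hp, hl, by rw [e, h.rank_mark hq0 hq1 hp hl]⟩

end

/-! ### Lyndon words -/

lemma letter_rotate {W : List ℕ} {r t : ℕ} (h : r + t < W.length) :
    letter (W.rotate r) t = letter W (r + t) := by
  rw [letter_eq_getElem (by simp; omega), letter_eq_getElem h, List.getElem_rotate]
  congr 1
  rw [Nat.mod_eq_of_lt (by omega), add_comm]

lemma letter_rotate_succ {W : List ℕ} {r t : ℕ} (hr : r + 1 = W.length) (h : t + 1 < W.length) :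
    letter (W.rotate r) (t + 1) = letter W t := by
  rw [letter_eq_getElem (by simp; omega), letter_eq_getElem (by omega), List.getElem_rotate]
  congr 1
  rw [show t + 1 + r = t + W.length by omega, Nat.add_mod_right, Nat.mod_eq_of_lt (by omega)]

/-- The comparison of such words is decided at a letter and never by one being a prefix of the
other, so it persists when both are continued to the right. -/
lemma exists_diff {F : ℕ} {Y Z : List ℕ} (h : CommonLT F Y Z) (hY : F ≤ Y.length)
    (hZ : F ≤ Z.length) : ∃ L, L < Y.length ∧ L < Z.length ∧
      (∀ t < L, letter Y t = letter Z t) ∧ letter Y L ≠ letter Z L := by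
  classical
  have hex : ∃ L, L < F ∧ letter Y L ≠ letter Z L := by
    by_contra hc
    push Not at hc
    have e : Y.take F = Z.take F := by
      refine ext_letter (by simp [hY, hZ]) fun t ht => ?_
      have ht' : t < F := by simp at ht; omega
      rw [letter_take ht', letter_take ht', hc t ht']
    have := h (Y.take F) (List.take_prefix _ _).isInfix (e ▸ (List.take_prefix _ _).isInfix)
    simp [hY] at this
  have h1 := Nat.find_spec hex
  have hmin : ∀ z < Nat.find hex, _ := fun z hz => Nat.find_min hex hz
  generalize Nat.find hex = L at h1 hmin
  refine ⟨L, by omega, by omega, fun t ht => ?_, h1.2⟩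
  by_contra hc
  exact hmin t ht ⟨by omega, hc⟩

lemma letter_lt_of_lt {Y Z : List ℕ} {L : ℕ} (hY : L < Y.length) (hZ : L < Z.length)
    (h : ∀ t < L, letter Y t = letter Z t) (hne : letter Y L ≠ letter Z L) (hlt : Y < Z) :
    letter Y L < letter Z L := by
  rcases hne.lt_or_gt with h1 | h1
  · exact h1
  · exact absurd hlt (lt_of_letter hZ hY (fun j hj => (h j hj).symm) h1).asymm

lemma exists_first_nz {W : List ℕ} {a b : ℕ} (hab : a ≤ b) (h : letter W b ≠ 0) :
    ∃ L, a + L ≤ b ∧ (∀ t < L, letter W (a + t) = 0) ∧ letter W (a + L) ≠ 0 := by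
  classical
  have hex : ∃ L, letter W (a + L) ≠ 0 := ⟨b - a, by rwa [show a + (b - a) = b by omega]⟩
  refine ⟨Nat.find hex, ?_, fun t ht => ?_, Nat.find_spec hex⟩
  · have := Nat.find_min' hex (m := b - a) (by rwa [show a + (b - a) = b by omega])
    omega
  · exact not_not.1 (Nat.find_min hex ht)

lemma exists_runStart {W : List ℕ} {r : ℕ} (h : letter W r = 0) :
    ∃ i ≤ r, RunStart W i ∧ ∀ t, i ≤ t → t ≤ r → letter W t = 0 := by
  induction r with
  | zero => exact ⟨0, le_rfl, runStart_zero.2 h, fun t _ h2 => by rwa [Nat.le_zero.1 h2]⟩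
  | succ r ih =>
    by_cases h0 : letter W r = 0
    · obtain ⟨i, h1, h2, h3⟩ := ih h0
      refine ⟨i, by omega, h2, fun t h4 h5 => ?_⟩
      rcases Nat.le_succ_iff.1 h5 with h6 | rfl
      exacts [h3 t h4 h6, h]
    · refine ⟨r + 1, le_rfl, ⟨h, fun j hj => ?_⟩, fun t h1 h2 => by rwa [le_antisymm h2 h1]⟩
      rwa [show j = r by omega]

/-- Primitivity and minimality together say that the word is strictly smaller than its other
rotations. -/
lemma isLyndon_iff_forall_lt {n : ℕ} {w : Fin n → ℕ} :
    IsLyndon w ↔ ∀ r, 0 < r → r < n → List.ofFn w < (List.ofFn w).rotate r := by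
  have hlen : (List.ofFn w).length = n := List.length_ofFn
  generalize hW : List.ofFn w = W at hlen
  unfold IsLyndon necklace
  rw [hW, hlen]
  constructor
  · rintro ⟨h1, h2⟩ r hr hrn
    have hle := h2 (W.rotate r) (Finset.mem_image_of_mem _ (Finset.mem_range.2 hrn))
    refine lt_of_le_of_ne hle fun e => ?_
    have hinj := Finset.card_image_iff.1 (h1.trans (Finset.card_range n).symm)
    have := hinj (x₁ := 0) (x₂ := r) (by simp; omega) (by simpa using hrn)
      (by simpa using e)
    omega
  · intro h
    constructor
    · rw [Finset.card_image_of_injOn, Finset.card_range]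
      have key : ∀ r s, r < s → s < n → W.rotate r ≠ W.rotate s := by
        intro r s hrs hs e
        -- Rotating both sides by `n - s` turns the coincidence of two rotations into that of the
        -- word with a proper rotation of itself.
        have e2 := congrArg (fun l => l.rotate (n - s)) e
        simp only [List.rotate_rotate] at e2
        rw [show s + (n - s) = W.length by omega, List.rotate_length] at e2
        exact (h (r + (n - s)) (by omega) (by omega)).ne e2.symm
      intro r hr s hs e
      simp only [Finset.coe_range, Set.mem_Iio] at hr hs
      rcases lt_trichotomy r s with h1 | h1 | h1
      · exact absurd e (key r s h1 hs)
      · exact h1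
      · exact absurd e.symm (key s r h1 hr)
    · intro v hv
      obtain ⟨r, hr, rfl⟩ := Finset.mem_image.1 hv
      rcases Nat.eq_zero_or_pos r with rfl | h0
      · simp
      · exact (h r h0 (Finset.mem_range.1 hr)).le

lemma endsNZ_append_iff {A B : List ℕ} (hB : 0 < B.length) : EndsNZ (A ++ B) ↔ EndsNZ B := by
  constructor
  · intro h t ht
    have := h (A.length + t) (by simp; omega)
    rwa [letter_append_add] at this
  · intro h t ht
    rw [List.length_append] at ht
    rw [letter_append_right (by omega)]
    exact h _ (by omega)

/-- The decompositions of Lyndon words: there is no prefix, the last letter is not `0`, and the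
first piece is long and smaller than the other long pieces. -/
def LyndonPieces (T : ℕ) (u : List ℕ) (Ys : List (List ℕ)) (v : List ℕ) : Prop :=
  u = [] ∧ EndsNZ v ∧ ∃ Y Zs, Ys = Y :: Zs ∧ IsLong T Y ∧ ∀ Z ∈ Zs, IsLong T Z → Y < Z

lemma LyndonPieces.perm {T : ℕ} {u v Y : List ℕ} {Zs Zs' : List (List ℕ)}
    (h : LyndonPieces T u (Y :: Zs) v) (hp : Zs.Perm Zs') : LyndonPieces T u (Y :: Zs') v := by
  obtain ⟨h1, h2, Y', Zs'', e, h3, h4⟩ := h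
  obtain ⟨rfl, rfl⟩ := List.cons.inj e
  exact ⟨h1, h2, Y, Zs', rfl, h3, fun Z hZ => h4 Z (hp.mem_iff.2 hZ)⟩

section
variable {q ε α : ℝ} {n : ℕ} {w : Fin n → ℕ} {u v : List ℕ} {Ys : List (List ℕ)}

lemma Dec.exists_diff_marks (hq0 : 0 < q) (hq1 : q < 1) (h : Dec q ε α w u Ys v)
    {p p' : ℕ × List ℕ} (hp : p ∈ marks u.length Ys) (hp' : p' ∈ marks u.length Ys)
    (hl : IsLong (runPar q ε n) p.2) (hl' : IsLong (runPar q ε n) p'.2) (hne : p ≠ p') :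
    ∃ L, L < p.2.length ∧ L < p'.2.length ∧
      (∀ t < L, letter p.2 t = letter p'.2 t) ∧ letter p.2 L ≠ letter p'.2 L := by
  have h1 := (h.valid.piece _ (mem_of_mem_marks hp)).length_le hl
  have h2 := (h.valid.piece _ (mem_of_mem_marks hp')).length_le hl'
  have h3 := factorPar_lt_blockPar hq0 hq1 n
  exact exists_diff (h.commonLT hp hp' hl hl' hne) (by omega) (by omega)

lemma Dec.letter_mark (h : Dec q ε α w u Ys v) {p : ℕ × List ℕ} (hp : p ∈ marks u.length Ys)
    {t : ℕ} (ht : t < p.2.length) : letter (List.ofFn w) (p.1 + t) = letter p.2 t := by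
  rw [h.eq]
  exact letter_of_mem_marks hp ht

lemma Dec.mark_le (h : Dec q ε α w u Ys v) {p : ℕ × List ℕ} (hp : p ∈ marks u.length Ys) :
    p.1 + p.2.length < (List.ofFn w).length := by
  have h1 := (le_of_mem_marks hp).2
  have h2 := lt_length_of_letter h.valid.tail.head
  rw [h.eq]
  simp only [List.length_append]
  omega

/-- The word is compared with its rotations that start at a long piece, or at the last letter if
that letter were zero. A word smaller than all of these must have the required form. -/
lemma Dec.lyndonPieces (hq0 : 0 < q) (hq1 : q < 1) (hT : 0 < runPar q ε n)
    (h : Dec q ε α w u Ys v) (hN : 0 < countLong (runPar q ε n) Ys) (hL : IsLyndon w) :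
    LyndonPieces (runPar q ε n) u Ys v := by
  rw [isLyndon_iff_forall_lt] at hL
  obtain ⟨p, hp, hpl, -⟩ := h.exists_mark_rankIn hq0 hq1 hN
  have hlen : (List.ofFn w).length = n := List.length_ofFn
  have hv0 := lt_length_of_letter h.valid.tail.head
  -- The bound on `r + L` ensures that the comparison is decided before the rotation wraps around.
  have rot : ∀ r L, 0 < r → r + L < n →
      (∀ t < L, letter (List.ofFn w) (r + t) = letter (List.ofFn w) t) →
      ¬ letter (List.ofFn w) (r + L) < letter (List.ofFn w) L := by
    intro r L h0 h1 h2 h3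
    refine (hL r h0 (by omega)).asymm (lt_of_letter (i := L) (by simp; omega) (by omega)
      (fun j hj => ?_) ?_)
    · rw [letter_rotate (by omega), h2 j hj]
    · rwa [letter_rotate (by omega)]
  have hpz : ∀ t < runPar q ε n, letter (List.ofFn w) (p.1 + t) = 0 := fun t ht => by
    rw [h.letter_mark hp (lt_length_of_letter (hpl t ht)), hpl t ht]
  -- If `w` began with fewer zeros, rotating it to a long piece would make it smaller.
  have hzero : ∀ t < runPar q ε n, letter (List.ofFn w) t = 0 := by
    intro t ht
    by_contra hne
    obtain ⟨L, h1, h2, h3⟩ := exists_first_nz (Nat.zero_le t) hne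
    simp only [zero_add] at h1 h2 h3
    have h4 := hpz L (by omega)
    have h5 := lt_length_of_letter h4
    refine rot p.1 L ?_ (by omega) (fun s hs => by rw [h2 s hs, hpz s (by omega)]) ?_
    · rcases Nat.eq_zero_or_pos p.1 with h0 | h0
      · rw [h0, zero_add] at h4; exact absurd h4 h3
      · exact h0
    · rw [h4]; exact Nat.pos_of_ne_zero h3
  have hu : u = [] := by
    by_contra hne
    have hl := List.length_pos_iff.2 hne
    have := hzero 0 hT
    rw [h.eq, letter_append_left hl] at this
    exact h.valid.prefix_ne 0 hl this
  -- If the last letter were zero, moving it to the front would lengthen the initial run of zeros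
  -- and make the word smaller.
  have hE : EndsNZ v := by
    rw [← endsNZ_append_iff (A := u ++ Ys.flatten) hv0, List.append_assoc, ← h.eq]
    intro t ht hz
    rw [hlen] at ht
    have hpP := h.valid.piece _ (mem_of_mem_marks hp)
    have hpos := hpP.pos
    have h6 := hpP.last (p.2.length - 1) (by omega)
    rw [← h.letter_mark hp (by omega)] at h6
    have h7 := h.mark_le hp
    obtain ⟨L, h1, h2, h3⟩ := exists_first_nz (Nat.zero_le _) h6
    simp only [zero_add] at h1 h2 h3
    have hL0 : 0 < L := Nat.pos_of_ne_zero fun e => h3 (e ▸ hzero 0 hT)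
    refine (hL t (by omega) (by omega)).asymm (lt_of_letter (i := L) (by simp; omega) (by omega)
      (fun j hj => ?_) ?_)
    · rcases j with _ | j
      · rw [letter_rotate (by omega), h2 0 hj, add_zero, hz]
      · rw [letter_rotate_succ (by omega) (by omega), h2 _ hj, h2 j (by omega)]
    · obtain ⟨L, rfl⟩ := Nat.exists_eq_add_of_lt hL0
      rw [letter_rotate_succ (by omega) (by omega), h2 _ (by omega)]
      exact Nat.pos_of_ne_zero h3
  subst hu
  refine ⟨rfl, hE, ?_⟩
  cases Ys with
  | nil => simp [countLong] at hN
  | cons Y Zs =>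
    have hY0 : ((0, Y) : ℕ × List ℕ) ∈ marks ([] : List ℕ).length (Y :: Zs) := by simp [marks]
    have hYP := h.valid.piece Y (by simp)
    have hYl : IsLong (runPar q ε n) Y := by
      rw [← isLong_append_iff hYP.last hYP.pos (B := Zs.flatten ++ v)]
      intro t ht
      rw [← hzero t ht, h.eq]
      simp
    refine ⟨Y, Zs, rfl, hYl, fun Z hZ hZl => ?_⟩
    obtain ⟨p', hp', rfl⟩ := exists_mem_marks Y.length hZ
    have hpm : p' ∈ marks ([] : List ℕ).length (Y :: Zs) := by
      simp only [marks, List.mem_cons, List.length_nil, zero_add]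
      exact Or.inr hp'
    have hpos := (le_of_mem_marks hp').1
    have hYpos := hYP.pos
    obtain ⟨L, h1, h2, h3, h4⟩ := h.exists_diff_marks hq0 hq1 hY0 hpm hYl hZl
      (fun e => by rw [← e] at hpos; simp only at hpos; omega)
    simp only at h1 h2 h3 h4
    refine lt_of_letter h1 h2 h3 (h4.lt_or_gt.resolve_right fun h5 => ?_)
    have h6 := h.mark_le hpm
    have hYlet : ∀ t < Y.length, letter (List.ofFn w) t = letter Y t := fun t ht => by
      rw [← h.letter_mark hY0 ht, zero_add]
    refine rot p'.1 L (by omega) (by omega) (fun t ht => ?_) ?_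
    · rw [h.letter_mark hpm (by omega), hYlet t (by omega), h3 t ht]
    · rwa [h.letter_mark hpm h2, hYlet L h1]

/-- A rotation can compete with `w` only if it begins with as many zeros as `w`, that is, inside a
long run. Starting after the beginning of that run is hopeless, and at its beginning the long piece
there is compared with the smaller first piece. -/
lemma Dec.isLyndon (hq0 : 0 < q) (hq1 : q < 1) (hT : 0 < runPar q ε n)
    (h : Dec q ε α w u Ys v) (hL : LyndonPieces (runPar q ε n) u Ys v) : IsLyndon w := by
  rw [isLyndon_iff_forall_lt]
  obtain ⟨rfl, hE, Y, Zs, rfl, hYl, hlt⟩ := hL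
  intro r hr hrn
  have hlen : (List.ofFn w).length = n := List.length_ofFn
  have hv0 := lt_length_of_letter h.valid.tail.head
  have hY0 : ((0, Y) : ℕ × List ℕ) ∈ marks ([] : List ℕ).length (Y :: Zs) := by simp [marks]
  have hYP := h.valid.piece Y (by simp)
  have hYlet : ∀ t < Y.length, letter (List.ofFn w) t = letter Y t := fun t ht => by
    rw [← h.letter_mark hY0 ht, zero_add]
  have hEW : EndsNZ (List.ofFn w) := by
    rw [h.eq, ← List.append_assoc, endsNZ_append_iff hv0]
    exact hE
  have hsmall : ∀ p' ∈ marks ([] : List ℕ).length (Y :: Zs), p' ≠ (0, Y) →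
      IsLong (runPar q ε n) p'.2 → Y < p'.2 := by
    intro p' hp' hne hl
    rcases List.mem_cons.1 hp' with rfl | hp'
    · exact absurd rfl hne
    · exact hlt _ (mem_of_mem_marks hp') hl
  suffices H : ∃ L, r + L < n ∧
      (∀ t < L, letter (List.ofFn w) t = letter (List.ofFn w) (r + t)) ∧
      letter (List.ofFn w) L < letter (List.ofFn w) (r + L) by
    obtain ⟨L, h1, h2, h3⟩ := H
    refine lt_of_letter (i := L) (by omega) (by simp; omega) (fun j hj => ?_) ?_
    · rw [letter_rotate (by omega), h2 j hj]
    · rwa [letter_rotate (by omega)]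
  have hlast := hEW (n - 1) (by omega)
  obtain ⟨L, h1, h2, h3⟩ := exists_first_nz (show r ≤ n - 1 by omega) hlast
  -- `L` is the number of zeros that follow position `r`; they end before the word does, because its
  -- last letter is nonzero. If `w` begins with more zeros than that, it is smaller.
  by_cases hLz : ∀ t ≤ L, letter (List.ofFn w) t = 0
  · exact ⟨L, by omega, fun t ht => by rw [hLz t ht.le, h2 t ht], by
      rw [hLz L le_rfl]; exact Nat.pos_of_ne_zero h3⟩
  push Not at hLz
  obtain ⟨s, hsL, hs⟩ := hLz
  have hTL : runPar q ε n ≤ L := by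
    by_contra hc
    refine hs ?_
    have := hYl s (by omega)
    rw [hYlet s (lt_length_of_letter this), this]
  obtain ⟨i, hir, hi, hiz⟩ := exists_runStart (r := r) (h2 0 (by omega))
  have hiL : ∀ t, i + t < r + L → letter (List.ofFn w) (i + t) = 0 := by
    intro t ht
    rcases le_or_gt (i + t) r with h4 | h4
    · exact hiz _ (by omega) h4
    · have := h2 (i + t - r) (by omega)
      rwa [show r + (i + t - r) = i + t by omega] at this
  have hls : LongStart (runPar q ε n) (List.ofFn w) i :=
    ⟨hi, fun t ht => hiL t (by omega)⟩
  rw [h.eq] at hls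
  obtain ⟨p, hp, hpl, rfl⟩ := (h.valid.longStart_iff _).1 hls
  have hpP := h.valid.piece _ (mem_of_mem_marks hp)
  have hpos := hpP.pos
  have hpz : ∀ t, p.1 + t < r + L → letter p.2 t = 0 := by
    intro t ht
    rcases lt_or_ge t p.2.length with h4 | h4
    · rw [← h.letter_mark hp h4, hiL t ht]
    · exfalso
      refine hpP.last (p.2.length - 1) (by omega) ?_
      rw [← h.letter_mark hp (by omega), hiL _ (by omega)]
  rcases eq_or_ne p (0, Y) with rfl | hne
  · have := hpz s (by simp only; omega)
    simp only at this
    rw [hYlet s (lt_length_of_letter this), this] at hs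
    exact absurd rfl hs
  · obtain ⟨D, d1, d2, d3, d4⟩ := h.exists_diff_marks hq0 hq1 hY0 hp hYl hpl hne.symm
    simp only at d1 d2 d3 d4
    have d5 := letter_lt_of_lt d1 d2 d3 d4 (hsmall p hp hne hpl)
    -- If the run began before `r`, the piece `p` would begin with more than `L` zeros, while the
    -- first piece has a nonzero letter at `s ≤ L`; then `p` would be smaller than the first piece.
    rcases hir.lt_or_eq with h4 | h4
    · exfalso
      rcases lt_or_ge s D with h5 | h5
      · have := d3 s h5
        rw [hpz s (by omega)] at this
        rw [hYlet s (by omega), this] at hs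
        exact hs rfl
      · rw [hpz D (by omega)] at d5
        omega
    · have h6 := h.mark_le hp
      refine ⟨D, by omega, fun t ht => ?_, ?_⟩
      · rw [hYlet t (by omega), ← h4, h.letter_mark hp (by omega), d3 t ht]
      · rwa [hYlet D d1, ← h4, h.letter_mark hp d2]

end

/-! ### Lengths of the pieces -/

/-- The last run of zeros begins before `K` and has at most `RA` letters, and at most `RB` nonzero
letters can follow. In a longer word the last `RB + 1` letters would contain a zero, belonging to
too long a run. -/
lemma length_le_of_windows {K RA RB : ℕ} {Y : List ℕ} (hr : ∀ t, RunStart Y t → t < K)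
    (hz : ¬ HasZeros (RA + 1) Y) (hnz : ¬ HasNZ (RB + 1) Y) : Y.length ≤ K + RA + RB := by
  by_contra hc
  refine hnz ⟨Y.length - (RB + 1), by omega, fun t ht h0 => ?_⟩
  obtain ⟨i, hi, his, hiz⟩ := exists_runStart h0
  have := hr i his
  exact hz ⟨i, fun s hs => hiz _ (by omega) (by omega)⟩

/-- An upper bound of the lengths of the pieces of good words. -/
noncomputable def lengthBound (q : ℝ) (n : ℕ) : ℕ := blockPar q n + maxPar q n + maxPar (1 - q) n

section
variable {q ε α : ℝ} {n : ℕ} {w : Fin n → ℕ} {u v : List ℕ} {Ys : List (List ℕ)}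

lemma Dec.length_piece_le (h : Dec q ε α w u Ys v) {Y : List ℕ} (hY : Y ∈ Ys) :
    Y.length ≤ lengthBound q n := by
  have hP := h.valid.piece Y hY
  refine length_le_of_windows (fun t ht => ?_)
    (fun hz => h.good.zeros (Or.inr (Or.inl ⟨Y, hY, hz⟩)))
    (fun hz => h.good.nz (Or.inr (Or.inl ⟨Y, hY, hz⟩)))
  by_cases hl : IsLong (runPar q ε n) Y
  · exact hP.lt_of_runStart hl t ht
  · rw [hP.short hl t ht]; exact blockPar_pos q n

lemma Dec.length_tail_le (h : Dec q ε α w u Ys v) : v.length ≤ lengthBound q n :=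
  length_le_of_windows (fun t ht => by rw [h.valid.tail.runStart t ht]; exact blockPar_pos q n)
    (fun hz => h.good.zeros (Or.inr (Or.inr hz))) (fun hz => h.good.nz (Or.inr (Or.inr hz)))

lemma Dec.length_prefix_le (h : Dec q ε α w u Ys v) : u.length ≤ lengthBound q n :=
  length_le_of_windows
    (fun t ht => absurd ht.1 (h.valid.prefix_ne t ht.lt_length))
    (fun hz => h.good.zeros (Or.inl hz)) (fun hz => h.good.nz (Or.inl hz))

lemma Dec.length_eq (h : Dec q ε α w u Ys v) :
    u.length + (Ys.flatten.length + v.length) = n := by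
  have := congrArg List.length h.eq
  simpa only [List.length_ofFn, List.length_append] using this.symm

end

/-! ### Permutations of the pieces -/

/-- The list with the terms of `Zs` in the order given by `σ`. -/
def permList (σ : ∀ m, Equiv.Perm (Fin m)) (Zs : List (List ℕ)) : List (List ℕ) :=
  List.ofFn fun k : Fin Zs.length => Zs.get (σ Zs.length k)

/-- The pieces permuted by `σ`, except the `f` first ones. -/
def permPieces (σ : ∀ m, Equiv.Perm (Fin m)) (f : ℕ) (Ys : List (List ℕ)) : List (List ℕ) :=
  Ys.take f ++ permList σ (Ys.drop f)

lemma permList_ofFn (σ : ∀ m, Equiv.Perm (Fin m)) {m : ℕ} (z : Fin m → List ℕ) :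
    permList σ (List.ofFn z) = List.ofFn (z ∘ σ m) := by
  -- The length of `List.ofFn z` is only propositionally `m`, so `σ` is evaluated at two different
  -- expressions.
  have key : ∀ m' (h : m' = m) (k : ℕ) (h1 : k < m') (h2 : k < m),
      (σ m' ⟨k, h1⟩ : ℕ) = σ m ⟨k, h2⟩ := by
    rintro _ rfl k _ _
    rfl
  refine List.ext_getElem (by simp [permList]) fun k h1 h2 => ?_
  simp only [permList, List.getElem_ofFn, List.get_eq_getElem, Function.comp]
  congr 1
  exact Fin.ext (key _ (by simp) k _ _)

lemma permList_perm (σ : ∀ m, Equiv.Perm (Fin m)) (Zs : List (List ℕ)) :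
    (permList σ Zs).Perm Zs := by
  conv_rhs => rw [← List.ofFn_get Zs]
  exact Equiv.Perm.ofFn_comp_perm (σ Zs.length) Zs.get

lemma length_permList (σ : ∀ m, Equiv.Perm (Fin m)) (Zs : List (List ℕ)) :
    (permList σ Zs).length = Zs.length := (permList_perm σ Zs).length_eq

lemma permList_permList {σ τ : ∀ m, Equiv.Perm (Fin m)} (h : ∀ m k, σ m (τ m k) = k)
    (Zs : List (List ℕ)) : permList τ (permList σ Zs) = Zs := by
  conv_lhs => rw [← List.ofFn_get Zs]
  have e : (Zs.get ∘ σ Zs.length) ∘ τ Zs.length = Zs.get := funext fun k => by simp [h]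
  rw [permList_ofFn, permList_ofFn, e, List.ofFn_get]

lemma permPieces_perm (σ : ∀ m, Equiv.Perm (Fin m)) (f : ℕ) (Ys : List (List ℕ)) :
    (permPieces σ f Ys).Perm Ys := by
  conv_rhs => rw [← List.take_append_drop f Ys]
  exact (permList_perm σ _).append_left _

lemma permPieces_permPieces {σ τ : ∀ m, Equiv.Perm (Fin m)} (h : ∀ m k, σ m (τ m k) = k) (f : ℕ)
    (Ys : List (List ℕ)) : permPieces τ f (permPieces σ f Ys) = Ys := by
  have e : (permPieces σ f Ys).take f = Ys.take f ∧
      (permPieces σ f Ys).drop f = permList σ (Ys.drop f) := by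
    unfold permPieces
    rcases le_or_gt f Ys.length with hf | hf
    · exact ⟨List.take_left' (by simp [hf]), List.drop_left' (by simp [hf])⟩
    · have e0 : permList σ (Ys.drop f) = [] := List.length_eq_zero_iff.1 (by
        rw [length_permList, List.length_drop]; omega)
      rw [e0, List.append_nil, List.take_take, min_self]
      exact ⟨rfl, List.drop_eq_nil_of_le (by simp)⟩
  rw [permPieces, e.1, e.2, permList_permList h, List.take_append_drop]

lemma marks_append (o : ℕ) (A B : List (List ℕ)) :
    marks o (A ++ B) = marks o A ++ marks (o + A.flatten.length) B := by
  induction A generalizing o with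
  | nil => simp [marks]
  | cons Y A ih => simp only [List.cons_append, marks, ih, List.flatten_cons, List.length_append,
      add_assoc]

lemma mem_marks_getElem (o : ℕ) (Ys : List (List ℕ)) (k : ℕ) (hk : k < Ys.length) :
    (o + ((Ys.map List.length).take k).sum, Ys[k]) ∈ marks o Ys := by
  induction Ys generalizing o k with
  | nil => simp at hk
  | cons Y Ys ih =>
    rcases k with _ | k
    · simp [marks]
    · have := ih (o + Y.length) k (by simpa using hk)
      simp only [marks, List.map_cons, List.take_succ_cons, List.sum_cons, List.getElem_cons_succ,
        List.mem_cons]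
      right
      rwa [← add_assoc]

/-- Piece `j` goes to the place `σ⁻¹ j`, so exactly the pieces with smaller places precede it. -/
lemma mem_marks_permList (σ : ∀ m, Equiv.Perm (Fin m)) (o : ℕ) (Zs : List (List ℕ))
    (j : Fin Zs.length) :
    (o + ∑ i : Fin Zs.length, if (σ _).symm i < (σ _).symm j then (Zs.get i).length else 0,
      Zs.get j) ∈ marks o (permList σ Zs) := by
  have h := mem_marks_getElem o (permList σ Zs) ((σ _).symm j)
    (by rw [length_permList]; exact Fin.is_lt _)
  have e1 : (permList σ Zs)[((σ _).symm j : ℕ)]'(by rw [length_permList]; exact Fin.is_lt _) =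
      Zs.get j := by
    simp [permList]
  rw [e1] at h
  convert h using 3
  rw [permList, List.map_ofFn, List.sum_take_ofFn, Finset.sum_filter,
    ← Equiv.sum_comp (σ Zs.length)]
  simp

/-- The word with the given list of letters. -/
def toWord (n : ℕ) (L : List ℕ) : Fin n → ℕ := fun i => letter L i

lemma ofFn_toWord {n : ℕ} {L : List ℕ} (h : L.length = n) : List.ofFn (toWord n L) = L := by
  refine ext_letter (by simp [h]) fun t ht => ?_
  rw [List.length_ofFn] at ht
  exact letter_ofFn _ ⟨t, ht⟩

open Classical in
/-- The word obtained from a good word by a permutation of its pieces, the `f` first ones being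
fixed. -/
noncomputable def permWord (q ε α : ℝ) (f : ℕ) (σ : ∀ m, Equiv.Perm (Fin m)) {n : ℕ}
    (w : Fin n → ℕ) : Fin n → ℕ :=
  if h : ∃ d : List ℕ × List (List ℕ) × List ℕ, Dec q ε α w d.1 d.2.1 d.2.2 then
    toWord n (h.choose.1 ++ ((permPieces σ f h.choose.2.1).flatten ++ h.choose.2.2))
  else w

section
variable {q ε α : ℝ} {n : ℕ} {w : Fin n → ℕ} {u v : List ℕ} {Ys : List (List ℕ)}

lemma permWord_of_not {f : ℕ} {σ : ∀ m, Equiv.Perm (Fin m)}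
    (h : ¬ ∃ u Ys v, Dec q ε α w u Ys v) : permWord q ε α f σ w = w :=
  dif_neg fun ⟨_, hd⟩ => h ⟨_, _, _, hd⟩

lemma Dec.permWord_eq (h : Dec q ε α w u Ys v) (f : ℕ) (σ : ∀ m, Equiv.Perm (Fin m)) :
    permWord q ε α f σ w = toWord n (u ++ ((permPieces σ f Ys).flatten ++ v)) := by
  have hex : ∃ d : List ℕ × List (List ℕ) × List ℕ, Dec q ε α w d.1 d.2.1 d.2.2 :=
    ⟨(u, Ys, v), h⟩
  obtain ⟨e1, e2, e3⟩ := h.unique hex.choose_spec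
  rw [permWord, dif_pos hex, ← e1, ← e2, ← e3]

lemma Dec.permWord (h : Dec q ε α w u Ys v) (f : ℕ) (σ : ∀ m, Equiv.Perm (Fin m)) :
    Dec q ε α (permWord q ε α f σ w) u (permPieces σ f Ys) v := by
  have hp := permPieces_perm σ f Ys
  refine ⟨h.valid.perm hp.symm, h.good.perm hp.symm, ?_⟩
  rw [h.permWord_eq, ofFn_toWord]
  rw [← h.length_eq]
  simp only [List.length_append, hp.flatten.length_eq]

lemma permWord_permWord {σ τ : ∀ m, Equiv.Perm (Fin m)} (hστ : ∀ m k, σ m (τ m k) = k) (f : ℕ)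
    (w : Fin n → ℕ) : LyndonBlocks.permWord q ε α f τ (LyndonBlocks.permWord q ε α f σ w) = w := by
  by_cases h : ∃ u Ys v, Dec q ε α w u Ys v
  · obtain ⟨u, Ys, v, h⟩ := h
    have h2 := (h.permWord f σ).permWord f τ
    rw [permPieces_permPieces hστ] at h2
    exact List.ofFn_injective (h2.eq.trans h.eq.symm)
  · rw [permWord_of_not h, permWord_of_not h]

/-- The permutation of the pieces is a bijection of the set of words. -/
noncomputable def permEquiv (q ε α : ℝ) (f : ℕ) (σ : ∀ m, Equiv.Perm (Fin m)) (n : ℕ) :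
    (Fin n → ℕ) ≃ (Fin n → ℕ) where
  toFun := LyndonBlocks.permWord q ε α f σ
  invFun := LyndonBlocks.permWord q ε α f fun m => (σ m).symm
  left_inv := permWord_permWord (fun _ _ => by simp) f
  right_inv := permWord_permWord (fun _ _ => by simp) f

lemma ofFn_permWord_perm (f : ℕ) (σ : ∀ m, Equiv.Perm (Fin m)) (w : Fin n → ℕ) :
    (List.ofFn (LyndonBlocks.permWord q ε α f σ w)).Perm (List.ofFn w) := by
  by_cases h : ∃ u Ys v, Dec q ε α w u Ys v
  · obtain ⟨u, Ys, v, h⟩ := h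
    rw [h.eq, (h.permWord f σ).eq]
    exact ((permPieces_perm σ f Ys).flatten.append_right _).append_left _
  · rw [permWord_of_not h]

/-- The position of a piece that is not fixed, after a permutation of the pieces. -/
lemma Dec.blockPos_permWord (hq0 : 0 < q) (hq1 : q < 1) (h : Dec q ε α w u Ys v) (f : ℕ)
    (σ : ∀ m, Equiv.Perm (Fin m)) (j : Fin (Ys.drop f).length)
    (hl : IsLong (runPar q ε n) ((Ys.drop f).get j)) :
    blockPos q ε (LyndonBlocks.permWord q ε α f σ w) (rankIn (runPar q ε n) Ys ((Ys.drop f).get j)) =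
      ((u.length + (Ys.take f).flatten.length + ∑ i : Fin (Ys.drop f).length,
        if (σ _).symm i < (σ _).symm j then ((Ys.drop f).get i).length else 0 : ℕ) : ℝ) / n := by
  have h' := h.permWord f σ
  rw [← rankIn_perm (permPieces_perm σ f Ys)]
  refine h'.blockPos_eq hq0 hq1 (p := (_, (Ys.drop f).get j)) ?_ hl
  rw [permPieces, marks_append]
  exact List.mem_append_right _ (mem_marks_permList σ _ _ j)

end

/-! ### Sequences of independent uniform variables -/

instance : IsProbabilityMeasure unifIcc := ⟨by simp [unifIcc]⟩

/-- The law of a sequence of independent uniform variables on `[0,1]`. -/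
noncomputable def unifSeq : Measure (ℕ → ℝ) := Measure.infinitePi fun _ => unifIcc

instance : IsProbabilityMeasure unifSeq := by unfold unifSeq; infer_instance

lemma unifSeq_map_eval (i : ℕ) : unifSeq.map (fun θ => θ i) = unifIcc :=
  Measure.infinitePi_map_eval _ i

lemma iIndepFun_unifSeq : iIndepFun (fun (i : ℕ) (θ : ℕ → ℝ) => θ i) unifSeq :=
  iIndepFun_infinitePi (X := fun _ => id) fun _ => measurable_id

lemma ae_unifIcc : ∀ᵐ x ∂unifIcc, x ∈ Set.Icc (0 : ℝ) 1 := ae_restrict_mem measurableSet_Icc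

lemma ae_unifSeq (i : ℕ) : ∀ᵐ θ ∂unifSeq, θ i ∈ Set.Icc (0 : ℝ) 1 := by
  have := ae_unifIcc
  rw [← unifSeq_map_eval i] at this
  exact ae_of_ae_map (measurable_pi_apply i).aemeasurable this

lemma unifSeq_map_comp {k : ℕ} {σ : Fin k → ℕ} (hσ : Function.Injective σ) :
    unifSeq.map (fun θ => WithLp.toLp 2 fun i : Fin k => θ (σ i)) = unifCube k := by
  have hm : Measurable fun (θ : ℕ → ℝ) (i : Fin k) => θ (σ i) := by fun_prop
  have h := (iIndepFun_iff_map_fun_eq_pi_map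
    (fun i => (measurable_pi_apply (σ i)).aemeasurable)).1 (iIndepFun_unifSeq.precomp hσ)
  simp only [unifSeq_map_eval] at h
  have hvol := PiLp.volume_preserving_toLp (Fin k)
  have e : (fun θ : ℕ → ℝ => WithLp.toLp 2 fun i : Fin k => θ (σ i)) =
      WithLp.toLp 2 ∘ fun (θ : ℕ → ℝ) (i : Fin k) => θ (σ i) := rfl
  rw [e, ← Measure.map_map hvol.measurable hm, h, unifCube, ← hvol.map_eq]
  have hS : MeasurableSet {x : EuclideanSpace ℝ (Fin k) | ∀ i, x i ∈ Set.Icc (0 : ℝ) 1} := by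
    rw [Set.ofPred_forall]
    exact MeasurableSet.iInter fun i => measurableSet_Icc.preimage (by fun_prop)
  rw [Measure.restrict_map hvol.measurable hS]
  congr 1
  unfold unifIcc
  rw [← Measure.restrict_pi_pi, ← volume_pi]
  congr 1
  ext x
  simp [Pi.le_def, forall_and]

/-! ### Mean square of weighted sums of centred comparisons with a key -/

section
variable {φ : ℝ → ℝ → ℝ}

lemma abs_dev_le (hb : ∀ x z, φ x z ∈ Set.Icc (0 : ℝ) 1) (x : ℝ) {z : ℝ}
    (hz : z ∈ Set.Icc (0 : ℝ) 1) : |φ x z - z| ≤ 1 :=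
  abs_sub_le_of_le_of_le (hb x z).1 (hb x z).2 hz.1 hz.2 |>.trans (by norm_num)

lemma abs_dev_mul_le (hb : ∀ x z, φ x z ∈ Set.Icc (0 : ℝ) 1) (x y : ℝ) {z : ℝ}
    (hz : z ∈ Set.Icc (0 : ℝ) 1) : ‖(φ x z - z) * (φ y z - z)‖ ≤ 1 := by
  rw [Real.norm_eq_abs, abs_mul]
  exact mul_le_one₀ (abs_dev_le hb x hz) (abs_nonneg _) (abs_dev_le hb y hz)

lemma measurable_dev_mul (hm : Measurable (Function.uncurry φ)) (i k j : ℕ) :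
    Measurable fun θ : ℕ → ℝ => (φ (θ i) (θ j) - θ j) * (φ (θ k) (θ j) - θ j) := by
  have hp : ∀ i, Measurable fun θ : ℕ → ℝ => (θ i, θ j) := fun i => by fun_prop
  have h : ∀ i, Measurable fun θ : ℕ → ℝ => φ (θ i) (θ j) := fun i => hm.comp (hp i)
  exact ((h i).sub (measurable_pi_apply j)).mul ((h k).sub (measurable_pi_apply j))

lemma integrable_dev_mul (hm : Measurable (Function.uncurry φ))
    (hb : ∀ x z, φ x z ∈ Set.Icc (0 : ℝ) 1) (i k j : ℕ) :
    Integrable (fun θ : ℕ → ℝ => (φ (θ i) (θ j) - θ j) * (φ (θ k) (θ j) - θ j)) unifSeq :=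
  Integrable.of_bound (measurable_dev_mul hm i k j).aestronglyMeasurable 1
    ((ae_unifSeq j).mono fun _ hθ => abs_dev_mul_le hb _ _ hθ)

/-- Given `θ k` and `θ j`, the variable `θ i` is still uniform, and `φ (θ i) (θ j)` then has mean `θ
j`. In the applications `φ x z` indicates `x < z` or `x ≤ z`. -/
lemma integral_dev_mul_eq_zero (hm : Measurable (Function.uncurry φ))
    (hb : ∀ x z, φ x z ∈ Set.Icc (0 : ℝ) 1)
    (h0 : ∀ z ∈ Set.Icc (0 : ℝ) 1, ∫ x, φ x z ∂unifIcc = z) {i k j : ℕ} (hki : k ≠ i)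
    (hji : j ≠ i) :
    ∫ θ, (φ (θ i) (θ j) - θ j) * (φ (θ k) (θ j) - θ j) ∂unifSeq = 0 := by
  have hind := iIndepFun_unifSeq.indepFun_prodMk (fun i => measurable_pi_apply i) k j i hki hji
  have hkj : Measurable fun θ : ℕ → ℝ => (θ k, θ j) := by fun_prop
  rw [indepFun_iff_map_prod_eq_prod_map_map hkj.aemeasurable
    (measurable_pi_apply i).aemeasurable, unifSeq_map_eval] at hind
  have hae : ∀ᵐ y ∂(unifSeq.map fun θ => (θ k, θ j)), y.2 ∈ Set.Icc (0 : ℝ) 1 := by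
    rw [ae_map_iff hkj.aemeasurable (measurable_snd measurableSet_Icc)]
    exact ae_unifSeq j
  have hf : Measurable fun y : (ℝ × ℝ) × ℝ =>
      (φ y.2 y.1.2 - y.1.2) * (φ y.1.1 y.1.2 - y.1.2) := by
    have h1 : Measurable fun y : (ℝ × ℝ) × ℝ => φ y.2 y.1.2 :=
      hm.comp (measurable_snd.prodMk (by fun_prop))
    have h2 : Measurable fun y : (ℝ × ℝ) × ℝ => φ y.1.1 y.1.2 :=
      hm.comp measurable_fst
    fun_prop
  have e := integral_map (μ := unifSeq) (φ := fun θ : ℕ → ℝ => ((θ k, θ j), θ i))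
    (by fun_prop) hf.aestronglyMeasurable
  simp only at e
  have hkjp : IsProbabilityMeasure (unifSeq.map fun θ => (θ k, θ j)) :=
    Measure.isProbabilityMeasure_map hkj.aemeasurable
  rw [← e, hind, integral_prod]
  · refine integral_eq_zero_of_ae ?_
    filter_upwards [hae] with y hy
    have hp : Measurable fun x : ℝ => (x, y.2) := by fun_prop
    have hint : Integrable (fun x => φ x y.2) unifIcc :=
      Integrable.of_bound (hm.comp hp).aestronglyMeasurable 1
        (ae_of_all _ fun x => by
          rw [Real.norm_eq_abs, abs_of_nonneg (hb x y.2).1]; exact (hb x y.2).2)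
    rw [integral_mul_const, integral_sub hint (integrable_const _), h0 _ hy]
    simp
  · refine Integrable.of_bound hf.aestronglyMeasurable 1 ?_
    rw [← hind]
    refine (ae_map_iff (by fun_prop) (measurableSet_le hf.norm measurable_const)).2 ?_
    filter_upwards [ae_unifSeq j] with θ hθ
    exact abs_dev_mul_le hb _ _ hθ

/-- The square is expanded: cross terms vanish by orthogonality, and each diagonal term is at most
`a i ^ 2`. The weight of `j` has to vanish because `φ (θ j) (θ j)` is not centred. -/
lemma integral_sum_dev_sq_le (hm : Measurable (Function.uncurry φ))
    (hb : ∀ x z, φ x z ∈ Set.Icc (0 : ℝ) 1)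
    (h0 : ∀ z ∈ Set.Icc (0 : ℝ) 1, ∫ x, φ x z ∂unifIcc = z) {m : ℕ} (j : Fin m)
    (a : Fin m → ℝ) (haj : a j = 0) :
    Integrable (fun θ : ℕ → ℝ => (∑ i, a i * (φ (θ i) (θ j) - θ j)) ^ 2) unifSeq ∧
    ∫ θ, (∑ i, a i * (φ (θ i) (θ j) - θ j)) ^ 2 ∂unifSeq ≤ ∑ i, a i ^ 2 := by
  have e : ∀ θ : ℕ → ℝ, (∑ i, a i * (φ (θ i) (θ j) - θ j)) ^ 2 =
      ∑ i, ∑ k, a i * a k * ((φ (θ i) (θ j) - θ j) * (φ (θ k) (θ j) - θ j)) := by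
    intro θ
    rw [sq, Finset.sum_mul_sum]
    exact Finset.sum_congr rfl fun i _ => Finset.sum_congr rfl fun k _ => by ring
  simp only [e]
  have hI : ∀ i k : Fin m, Integrable (fun θ : ℕ → ℝ =>
      a i * a k * ((φ (θ i) (θ j) - θ j) * (φ (θ k) (θ j) - θ j))) unifSeq := fun i k =>
    (integrable_dev_mul hm hb i k j).const_mul _
  refine ⟨integrable_finsetSum _ fun i _ => integrable_finsetSum _ fun k _ => hI i k, ?_⟩
  rw [integral_finsetSum _ fun i _ => integrable_finsetSum _ fun k _ => hI i k]
  refine Finset.sum_le_sum fun i _ => ?_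
  rw [integral_finsetSum _ fun k _ => hI i k, Finset.sum_eq_single i]
  · rw [integral_const_mul, ← sq]
    refine mul_le_of_le_one_right (sq_nonneg _) ?_
    calc ∫ θ, (φ (θ i) (θ j) - θ j) * (φ (θ i) (θ j) - θ j) ∂unifSeq
        ≤ ∫ _, (1 : ℝ) ∂unifSeq := by
          refine integral_mono_ae (integrable_dev_mul hm hb i i j) (integrable_const _) ?_
          filter_upwards [ae_unifSeq j] with θ hθ
          exact (le_abs_self _).trans (abs_dev_mul_le hb _ _ hθ)
      _ = 1 := by simp
  · intro k _ hki
    rw [integral_const_mul]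
    rcases eq_or_ne i j with rfl | hij
    · simp [haj]
    · rw [integral_dev_mul_eq_zero hm hb h0 (fun h => hki (Fin.ext h))
        (fun h => hij (Fin.ext h.symm)), mul_zero]
  · simp

end

/-! ### Squeezing between strict and weak comparisons -/

lemma sq_le_add_sq_of_mem {x a b : ℝ} (h1 : a ≤ x) (h2 : x ≤ b) : x ^ 2 ≤ a ^ 2 + b ^ 2 := by
  rcases le_total 0 x with h | h
  · nlinarith [sq_nonneg a]
  · nlinarith [sq_nonneg b]

lemma integral_ite_lt {z : ℝ} (hz : z ∈ Set.Icc (0 : ℝ) 1) :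
    ∫ x, (if x < z then (1 : ℝ) else 0) ∂unifIcc = z := by
  have : (fun x : ℝ => if x < z then (1 : ℝ) else 0) = (Set.Iio z).indicator 1 := by
    ext x; simp [Set.indicator]
  rw [this, integral_indicator_one measurableSet_Iio, unifIcc, measureReal_restrict_apply
    measurableSet_Iio]
  have e : Set.Iio z ∩ Set.Icc 0 1 = Set.Ico 0 z := by
    ext x; simp only [Set.mem_inter_iff, Set.mem_Iio, Set.mem_Icc, Set.mem_Ico]
    have := hz.2
    constructor
    · rintro ⟨h1, h2, h3⟩; exact ⟨h2, h1⟩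
    · rintro ⟨h1, h2⟩; exact ⟨h2, h1, by linarith⟩
  rw [e]
  simp [measureReal_def, hz.1]

lemma integral_ite_le {z : ℝ} (hz : z ∈ Set.Icc (0 : ℝ) 1) :
    ∫ x, (if x ≤ z then (1 : ℝ) else 0) ∂unifIcc = z := by
  have : (fun x : ℝ => if x ≤ z then (1 : ℝ) else 0) = (Set.Iic z).indicator 1 := by
    ext x; simp [Set.indicator]
  rw [this, integral_indicator_one measurableSet_Iic, unifIcc, measureReal_restrict_apply
    measurableSet_Iic]
  have e : Set.Iic z ∩ Set.Icc 0 1 = Set.Icc 0 z := by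
    ext x; simp only [Set.mem_inter_iff, Set.mem_Iic, Set.mem_Icc]
    have := hz.2
    constructor
    · rintro ⟨h1, h2, h3⟩; exact ⟨h2, h1⟩
    · rintro ⟨h1, h2⟩; exact ⟨h2, h1, by linarith⟩
  rw [e]
  simp [measureReal_def, hz.1]

lemma lintegral_sq_le_of_between {Ω : Type*} [MeasurableSpace Ω] {μ : Measure Ω}
    {V₁ V₂ D : Ω → ℝ} {c : ℝ} (I₁ : Integrable (fun ω => V₁ ω ^ 2) μ)
    (I₂ : Integrable (fun ω => V₂ ω ^ 2) μ) (J₁ : ∫ ω, V₁ ω ^ 2 ∂μ ≤ c)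
    (J₂ : ∫ ω, V₂ ω ^ 2 ∂μ ≤ c) (h₁ : ∀ ω, V₁ ω ≤ D ω) (h₂ : ∀ ω, D ω ≤ V₂ ω) :
    ∫⁻ ω, ENNReal.ofReal (D ω ^ 2) ∂μ ≤ ENNReal.ofReal (2 * c) := by
  refine (lintegral_mono fun ω => ENNReal.ofReal_le_ofReal
    (sq_le_add_sq_of_mem (h₁ ω) (h₂ ω))).trans ?_
  have hI : Integrable (fun ω => V₁ ω ^ 2 + V₂ ω ^ 2) μ := I₁.add I₂
  rw [← ofReal_integral_eq_lintegral_ofReal hI (ae_of_all _ fun ω => by positivity),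
    integral_add I₁ I₂]
  exact ENNReal.ofReal_le_ofReal (by linarith)

/-- Sorting by keys determines the order only up to ties. Squeezing `D` between the sums with `<`
and with `≤`, both having small variance, avoids any discussion of ties and of the measurability of
`D`, at the cost of a factor 2. -/
lemma lintegral_sq_le {m : ℕ} (j : Fin m) (a : Fin m → ℝ) (haj : a j = 0)
    (D : (ℕ → ℝ) → ℝ)
    (hD1 : ∀ θ : ℕ → ℝ, ∑ i : Fin m, a i * (if θ i < θ j then 1 else 0) ≤ D θ)
    (hD2 : ∀ θ : ℕ → ℝ, D θ ≤ ∑ i : Fin m, a i * (if θ i ≤ θ j then 1 else 0)) :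
    ∫⁻ θ, ENNReal.ofReal ((D θ - (∑ i, a i) * θ j) ^ 2) ∂unifSeq ≤
      ENNReal.ofReal (2 * ∑ i, a i ^ 2) := by
  have m1 : Measurable (Function.uncurry fun x z : ℝ => if x < z then (1 : ℝ) else 0) :=
    Measurable.ite (measurableSet_lt measurable_fst measurable_snd) measurable_const
      measurable_const
  have m2 : Measurable (Function.uncurry fun x z : ℝ => if x ≤ z then (1 : ℝ) else 0) :=
    Measurable.ite (measurableSet_le measurable_fst measurable_snd) measurable_const
      measurable_const
  obtain ⟨I1, J1⟩ := integral_sum_dev_sq_le m1 (fun x z => by split_ifs <;> simp)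
    (fun z hz => integral_ite_lt hz) j a haj
  obtain ⟨I2, J2⟩ := integral_sum_dev_sq_le m2 (fun x z => by split_ifs <;> simp)
    (fun z hz => integral_ite_le hz) j a haj
  refine lintegral_sq_le_of_between I1 I2 J1 J2 (fun θ => ?_) (fun θ => ?_)
  · simp only [mul_sub, Finset.sum_sub_distrib, ← Finset.sum_mul]
    exact sub_le_sub_right (hD1 θ) _
  · simp only [mul_sub, Finset.sum_sub_distrib, ← Finset.sum_mul]
    exact sub_le_sub_right (hD2 θ) _

/-! ### Couplings -/

/-- Draw `ω` from `μ` and independently `θ` from `P`, and take the joint law of `X (T θ ω)` and `Z ω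
θ`. The first has the law of `X` since each `T θ` preserves `μ`; the second has law `ν` for almost
every fixed `ω`, so `Z` may depend on `ω`. The cost is integrated first over `θ`. -/
lemma exists_coupling {Ω Θ E : Type*} [MeasurableSpace Ω] [Countable Ω] [DiscreteMeasurableSpace Ω]
    [MeasurableSpace Θ] [PseudoEMetricSpace E] [MeasurableSpace E] [OpensMeasurableSpace E]
    [SecondCountableTopology E] {μ : Measure Ω} [IsProbabilityMeasure μ] {P : Measure Θ}
    [IsProbabilityMeasure P] {ν : Measure E} {T : Θ → Ω → Ω} {X : Ω → E} {Z : Ω → Θ → E}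
    {c : ℝ≥0∞} (hT : ∀ θ, μ.map (T θ) = μ) (hTm : ∀ ω, Measurable fun θ => T θ ω)
    (hZm : ∀ ω, Measurable (Z ω)) (hZ : ∀ᵐ ω ∂μ, P.map (Z ω) = ν)
    (hc : ∀ᵐ ω ∂μ, ∫⁻ θ, edist (X (T θ ω)) (Z ω θ) ^ 2 ∂P ≤ c) :
    ∃ γ : Measure (E × E), γ.map Prod.fst = μ.map X ∧ γ.map Prod.snd = ν ∧
      ∫⁻ z, edist z.1 z.2 ^ 2 ∂γ ≤ c := by
  have hX : Measurable X := Measurable.of_discrete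
  have m1 : Measurable fun x : Ω × Θ => X (T x.2 x.1) :=
    measurable_from_prod_countable_right fun ω => hX.comp (hTm ω)
  have m2 : Measurable fun x : Ω × Θ => Z x.1 x.2 :=
    measurable_from_prod_countable_right fun ω => hZm ω
  refine ⟨(μ.prod P).map fun x => (X (T x.2 x.1), Z x.1 x.2), ?_, ?_, ?_⟩
  · rw [Measure.map_map measurable_fst (m1.prodMk m2)]
    ext A hA
    have e : ∀ θ, μ ((fun ω => (ω, θ)) ⁻¹' ((fun x : Ω × Θ => X (T x.2 x.1)) ⁻¹' A)) =
        μ.map X A := by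
      intro θ
      conv_rhs => rw [← hT θ, Measure.map_map hX Measurable.of_discrete]
      rw [Measure.map_apply Measurable.of_discrete hA]
      rfl
    change (μ.prod P).map (fun x : Ω × Θ => X (T x.2 x.1)) A = _
    rw [Measure.map_apply m1 hA, Measure.prod_apply_symm (m1 hA)]
    simp only [e, lintegral_const, measure_univ, mul_one]
  · rw [Measure.map_map measurable_snd (m1.prodMk m2)]
    ext A hA
    change (μ.prod P).map (fun x : Ω × Θ => Z x.1 x.2) A = _
    rw [Measure.map_apply m2 hA, Measure.prod_apply (m2 hA)]
    have e : ∀ᵐ ω ∂μ, P (Prod.mk ω ⁻¹' ((fun x : Ω × Θ => Z x.1 x.2) ⁻¹' A)) = ν A := by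
      filter_upwards [hZ] with ω hω
      rw [← hω, Measure.map_apply (hZm ω) hA]
      rfl
    rw [lintegral_congr_ae e]
    simp
  · have m3 : Measurable fun z : E × E => edist z.1 z.2 ^ 2 := measurable_edist.pow_const 2
    rw [lintegral_map m3 (m1.prodMk m2), 
      lintegral_prod _ (m1.edist m2 |>.pow_const 2).aemeasurable]
    calc ∫⁻ ω, ∫⁻ θ, edist (X (T θ ω)) (Z ω θ) ^ 2 ∂P ∂μ ≤ ∫⁻ _, c ∂μ := lintegral_mono_ae hc
      _ = c := by simp

lemma cond_map_equiv {Ω : Type*} [MeasurableSpace Ω] [Countable Ω] [DiscreteMeasurableSpace Ω]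
    {μ : Measure Ω} (e : Ω ≃ Ω) (h : ∀ ω, μ {e ω} = μ {ω}) {G : Set Ω}
    (hG : ∀ ω, e ω ∈ G ↔ ω ∈ G) : (cond μ G).map e = cond μ G := by
  refine Measure.ext_of_singleton fun ω => ?_
  obtain ⟨ω, rfl⟩ := e.surjective ω
  rw [Measure.map_apply Measurable.of_discrete (MeasurableSet.of_discrete),
    cond_apply MeasurableSet.of_discrete, cond_apply MeasurableSet.of_discrete]
  congr 1
  have e1 : e ⁻¹' {e ω} = {ω} := by ext; simp
  rw [e1]
  by_cases hω : ω ∈ G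
  · rw [Set.inter_eq_right.2 (Set.singleton_subset_iff.2 hω),
      Set.inter_eq_right.2 (Set.singleton_subset_iff.2 ((hG ω).2 hω)), h]
  · rw [Set.inter_singleton_eq_empty.2 hω,
      Set.inter_singleton_eq_empty.2 fun h' => hω ((hG ω).1 h')]

/-! ### Permutations of the pieces sorted by random keys -/

/-- The permutations that sort the first terms of a sequence. -/
noncomputable def sortPerm (θ : ℕ → ℝ) (m : ℕ) : Equiv.Perm (Fin m) :=
  Tuple.sort fun i : Fin m => θ i

/-- `Tuple.sort` sends places to indices, so its inverse gives the place of an index in the sorted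
order. -/
lemma sortPerm_symm_lt {θ : ℕ → ℝ} {m : ℕ} {i j : Fin m} (h : θ i < θ j) :
    (sortPerm θ m).symm i < (sortPerm θ m).symm j := by
  by_contra hc
  have := Tuple.monotone_sort (fun i : Fin m => θ i) (not_lt.1 hc)
  simp only [Function.comp] at this
  change θ (sortPerm θ m _) ≤ θ (sortPerm θ m _) at this
  rw [Equiv.apply_symm_apply, Equiv.apply_symm_apply] at this
  exact absurd h (not_lt.2 this)

lemma le_of_sortPerm_symm_lt {θ : ℕ → ℝ} {m : ℕ} {i j : Fin m}
    (h : (sortPerm θ m).symm i < (sortPerm θ m).symm j) : θ i ≤ θ j := by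
  by_contra hc
  exact (sortPerm_symm_lt (not_le.1 hc)).asymm h

lemma measurableSet_sortPerm (m : ℕ) (π : Equiv.Perm (Fin m)) :
    MeasurableSet {θ | sortPerm θ m = π} := by
  have e : {θ | sortPerm θ m = π} = {θ : ℕ → ℝ | (∀ i j, i ≤ j → θ (π i) ≤ θ (π j)) ∧
      ∀ i j, i < j → θ (π i) = θ (π j) → π i < π j} := by
    ext θ
    exact eq_comm.trans Tuple.eq_sort_iff
  rw [e]
  refine measurableSet_setOfPred.2 (Measurable.and ?_ ?_)
  · refine Measurable.forall fun i => Measurable.forall fun j => measurable_const.imp ?_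
    exact measurableSet_setOfPred.1 (measurableSet_le (measurable_pi_apply _) (measurable_pi_apply _))
  · refine Measurable.forall fun i => Measurable.forall fun j => measurable_const.imp
      (Measurable.imp ?_ measurable_const)
    exact measurableSet_setOfPred.1
      (measurableSet_eq_fun (measurable_pi_apply _) (measurable_pi_apply _))

section
variable {q ε α : ℝ} {n : ℕ} {w : Fin n → ℕ} {u v : List ℕ} {Ys : List (List ℕ)}

/-- The word depends on the keys only through a permutation, an element of a finite set. -/
lemma measurable_permWord (f : ℕ) (w : Fin n → ℕ) :
    Measurable fun θ => permWord q ε α f (sortPerm θ) w := by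
  by_cases h : ∃ u Ys v, Dec q ε α w u Ys v
  · obtain ⟨u, Ys, v, h⟩ := h
    let H : Equiv.Perm (Fin (Ys.drop f).length) → (Fin n → ℕ) := fun π =>
      toWord n (u ++ ((Ys.take f ++ List.ofFn fun k => (Ys.drop f).get (π k)).flatten ++ v))
    have e : (fun θ => permWord q ε α f (sortPerm θ) w) =
        fun θ => H (sortPerm θ (Ys.drop f).length) := by
      funext θ
      rw [h.permWord_eq]
      rfl
    rw [e]
    let _ : MeasurableSpace (Equiv.Perm (Fin (Ys.drop f).length)) := ⊤
    have hs : Measurable fun θ => sortPerm θ (Ys.drop f).length :=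
      measurable_to_countable' fun π => measurableSet_sortPerm _ π
    exact (measurable_from_top (f := H)).comp hs
  · simp only [permWord_of_not h]
    exact measurable_const

lemma edist_sq_eq (x y : ℝ) : edist x y ^ 2 = ENNReal.ofReal ((x - y) ^ 2) := by
  rw [edist_dist, Real.dist_eq, ← ENNReal.ofReal_pow (abs_nonneg _), sq_abs]

/-- The mean square error of the approximation of the positions by the keys. -/
noncomputable def errorBound (q : ℝ) (n : ℕ) : ℝ :=
  2 / (n : ℝ) ^ 2 * (2 * (lengthBound q n * n) + (2 * lengthBound q n) ^ 2)

/-- The position times `n` is `b + D θ`, with `b` the length of the fixed initial part and `D θ` the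
total length of the movable pieces sorted before `j`. Its distance to `n * θ j` splits into the
fluctuation of `D θ`, of mean square at most `2 * (B * n)`, and a boundary term of size at most `2 *
B`. Squaring the sum costs the factor 2 in `errorBound`. -/
lemma Dec.lintegral_edist_sq_le (hq0 : 0 < q) (hq1 : q < 1) (hn : 0 < n)
    (h : Dec q ε α w u Ys v) {f : ℕ} (hf : f ≤ 1) (j : Fin (Ys.drop f).length)
    (hl : IsLong (runPar q ε n) ((Ys.drop f).get j)) :
    ∫⁻ θ, edist (blockPos q ε (LyndonBlocks.permWord q ε α f (sortPerm θ) w)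
      (rankIn (runPar q ε n) Ys ((Ys.drop f).get j))) (θ j) ^ 2 ∂unifSeq ≤
      ENNReal.ofReal (errorBound q n) := by
  set B := lengthBound q n with hB
  set l : Fin (Ys.drop f).length → ℕ := fun i => ((Ys.drop f).get i).length with hl'
  set b := u.length + (Ys.take f).flatten.length with hb
  -- A piece does not precede itself, so its own length gets weight 0, as the variance bound
  -- requires.
  set a : Fin (Ys.drop f).length → ℝ := fun i => if i = j then 0 else (l i : ℝ) with ha
  set D : (ℕ → ℝ) → ℝ := fun θ =>
    ∑ i, a i * (if (sortPerm θ _).symm i < (sortPerm θ _).symm j then 1 else 0) with hD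
  have hn' : (0 : ℝ) < n := by exact_mod_cast hn
  have hlB : ∀ i, l i ≤ B := fun i =>
    h.length_piece_le (List.mem_of_mem_drop (List.get_mem (Ys.drop f) i))
  have hbB : b ≤ 2 * B := by
    have h1 := h.length_prefix_le
    have h2 : (Ys.take f).flatten.length ≤ B := by
      rcases Nat.le_one_iff_eq_zero_or_eq_one.1 hf with rfl | rfl
      · simp
      · cases Ys with
        | nil => simp
        | cons Y Zs => simpa using h.length_piece_le (Y := Y) (by simp)
    omega
  have hsum : ∑ i, l i = (Ys.drop f).flatten.length := by
    rw [List.length_flatten, ← List.sum_ofFn]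
    conv_rhs => rw [← List.ofFn_get (Ys.drop f), List.map_ofFn]
    rfl
  have hn_eq : b + ∑ i, l i + v.length = n := by
    have := h.length_eq
    rw [← List.take_append_drop f Ys, List.flatten_append, List.length_append] at this
    omega
  have hsa : (∑ i, a i) + l j = ∑ i, (l i : ℝ) := by
    rw [ha, ← Finset.sum_erase_add _ _ (Finset.mem_univ j),
      ← Finset.sum_erase_add _ (fun i => (l i : ℝ)) (Finset.mem_univ j)]
    simp only [if_true, add_zero]
    congr 1
    exact Finset.sum_congr rfl fun i hi => if_neg (Finset.ne_of_mem_erase hi)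
  have hn_eq' : (b : ℝ) + (∑ i, a i) + l j + v.length = n := by
    have : (b : ℝ) + ∑ i, (l i : ℝ) + v.length = n := by exact_mod_cast hn_eq
    rw [← this, ← hsa]
    ring
  have ha0 : ∀ i, 0 ≤ a i := fun i => by
    simp only [ha]; split_ifs <;> positivity
  have haB : ∀ i, a i ≤ B := fun i => by
    simp only [ha]
    split_ifs
    · positivity
    · exact_mod_cast hlB i
  have hpos : ∀ θ, blockPos q ε (LyndonBlocks.permWord q ε α f (sortPerm θ) w)
      (rankIn (runPar q ε n) Ys ((Ys.drop f).get j)) = (b + D θ) / n := by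
    intro θ
    rw [h.blockPos_permWord hq0 hq1 f _ j hl]
    congr 1
    push_cast
    rw [hb, hD]
    push_cast
    congr 1
    refine Finset.sum_congr rfl fun i _ => ?_
    rcases eq_or_ne i j with rfl | hij
    · simp
    · simp only [ha, if_neg hij]
      split_ifs <;> simp [hl']
  have hD1 : ∀ θ : ℕ → ℝ, ∑ i, a i * (if θ i < θ j then 1 else 0) ≤ D θ := fun θ =>
    Finset.sum_le_sum fun i _ => mul_le_mul_of_nonneg_left (by
      split_ifs with h1 h2 h2
      exacts [le_rfl, absurd (sortPerm_symm_lt h1) h2, zero_le_one, le_rfl]) (ha0 i)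
  have hD2 : ∀ θ : ℕ → ℝ, D θ ≤ ∑ i, a i * (if θ i ≤ θ j then 1 else 0) := fun θ =>
    Finset.sum_le_sum fun i _ => mul_le_mul_of_nonneg_left (by
      split_ifs with h1 h2 h2
      exacts [le_rfl, absurd (le_of_sortPerm_symm_lt h1) h2, zero_le_one, le_rfl]) (ha0 i)
  have hvar := lintegral_sq_le j a (by simp [ha]) D hD1 hD2
  have hsq : ∑ i, a i ^ 2 ≤ B * n := by
    calc ∑ i, a i ^ 2 ≤ ∑ i, B * a i := Finset.sum_le_sum fun i _ => by
          rw [sq]; exact mul_le_mul_of_nonneg_right (haB i) (ha0 i)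
      _ = B * ∑ i, a i := by rw [Finset.mul_sum]
      _ ≤ B * n := mul_le_mul_of_nonneg_left (by
          rw [← hn_eq']
          have h1 : (0 : ℝ) ≤ b := by positivity
          have h2 : (0 : ℝ) ≤ l j := by positivity
          have h3 : (0 : ℝ) ≤ v.length := by positivity
          linarith) (by positivity)
  have hpt : ∀ᵐ θ ∂unifSeq, edist (blockPos q ε (LyndonBlocks.permWord q ε α f (sortPerm θ) w)
      (rankIn (runPar q ε n) Ys ((Ys.drop f).get j))) (θ j) ^ 2 ≤ ENNReal.ofReal (2 / (n : ℝ) ^ 2) *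
      (ENNReal.ofReal ((D θ - (∑ i, a i) * θ j) ^ 2) + ENNReal.ofReal ((2 * B) ^ 2)) := by
    filter_upwards [ae_unifSeq j] with θ hθ
    rw [edist_sq_eq, ← ENNReal.ofReal_add (by positivity) (by positivity),
      ← ENNReal.ofReal_mul (by positivity), hpos]
    refine ENNReal.ofReal_le_ofReal ?_
    -- The lengths not counted in the sum are `b`, `l j` and that of the tail. With a key in
    -- `[0,1]`, the difference lies between `-(l j + v.length)` and `b`.
    have hr : ((b : ℝ) - (n - ∑ i, a i) * θ j) ^ 2 ≤ (2 * B) ^ 2 := by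
      rw [sq_le_sq, abs_of_nonneg (a := 2 * (B : ℝ)) (by positivity), abs_le]
      have h1 : (n : ℝ) - ∑ i, a i = b + l j + v.length := by rw [← hn_eq']; ring
      have h2 : (l j : ℝ) ≤ B := by exact_mod_cast hlB j
      have h3 : (v.length : ℝ) ≤ B := by exact_mod_cast h.length_tail_le
      have h4 : (b : ℝ) ≤ 2 * B := by exact_mod_cast hbB
      have h5 : (0 : ℝ) ≤ b + l j + v.length := by positivity
      rw [h1]
      constructor
      · have := mul_le_of_le_one_right h5 hθ.2
        linarith
      · have := mul_nonneg h5 hθ.1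
        linarith
    have e : ((b : ℝ) + D θ) / n - θ j =
        ((D θ - (∑ i, a i) * θ j) + (b - (n - ∑ i, a i) * θ j)) / n := by
      field_simp
      ring
    rw [e, div_pow, div_eq_mul_inv, div_eq_mul_inv, mul_assoc, mul_comm]
    have h6 : ((D θ - (∑ i, a i) * θ j) + (b - (n - ∑ i, a i) * θ j)) ^ 2 ≤
        2 * ((D θ - (∑ i, a i) * θ j) ^ 2 + (2 * B) ^ 2) := by
      nlinarith [sq_nonneg ((D θ - (∑ i, a i) * θ j) - (b - (n - ∑ i, a i) * θ j))]
    calc _ ≤ ((n : ℝ) ^ 2)⁻¹ * (2 * ((D θ - (∑ i, a i) * θ j) ^ 2 + (2 * B) ^ 2)) :=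
          mul_le_mul_of_nonneg_left h6 (by positivity)
      _ = _ := by ring
  refine (lintegral_mono_ae hpt).trans ?_
  rw [lintegral_const_mul' _ _ ENNReal.ofReal_ne_top, lintegral_add_right _ measurable_const,
    lintegral_const, measure_univ, mul_one]
  calc _ ≤ ENNReal.ofReal (2 / (n : ℝ) ^ 2) *
        (ENNReal.ofReal (2 * ∑ i, a i ^ 2) + ENNReal.ofReal ((2 * B) ^ 2)) := by gcongr
    _ = ENNReal.ofReal (2 / (n : ℝ) ^ 2 * (2 * ∑ i, a i ^ 2 + (2 * B) ^ 2)) := by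
        rw [← ENNReal.ofReal_add (by positivity) (by positivity),
          ← ENNReal.ofReal_mul (by positivity)]
    _ ≤ _ := by
        refine ENNReal.ofReal_le_ofReal ?_
        unfold errorBound
        gcongr

end

/-! ### Couplings of the laws of positions with uniform laws -/

instance (p : PMF ℕ) (n : ℕ) : IsProbabilityMeasure (wordLaw p n) := by
  unfold wordLaw; infer_instance

lemma wordLaw_singleton (p : PMF ℕ) {n : ℕ} (w : Fin n → ℕ) :
    wordLaw p n {w} = ((List.ofFn w).map p).prod := by
  rw [wordLaw, Measure.pi_singleton, List.map_ofFn, List.prod_ofFn]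
  exact Finset.prod_congr rfl fun i _ =>
    PMF.toMeasure_apply_singleton p (w i) (measurableSet_singleton _)

lemma wordLaw_permWord (p : PMF ℕ) {n : ℕ} (q ε α : ℝ) (f : ℕ) (σ : ∀ m, Equiv.Perm (Fin m))
    (w : Fin n → ℕ) : wordLaw p n {permWord q ε α f σ w} = wordLaw p n {w} := by
  rw [wordLaw_singleton, wordLaw_singleton]
  exact ((ofFn_permWord_perm f σ w).map p).prod_eq

/-- Stability of `G` is assumed for all families `σ`; the inverse family gives the reverse
inclusion. -/
lemma cond_map_permWord (p : PMF ℕ) {n : ℕ} (q ε α : ℝ) (f : ℕ) (σ : ∀ m, Equiv.Perm (Fin m))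
    {G : Set (Fin n → ℕ)} (hG : ∀ (σ : ∀ m, Equiv.Perm (Fin m)) (w), w ∈ G →
      permWord q ε α f σ w ∈ G) :
    (cond (wordLaw p n) G).map (permWord q ε α f σ) = cond (wordLaw p n) G := by
  refine cond_map_equiv (permEquiv q ε α f σ n) (wordLaw_permWord p q ε α f σ)
    fun w => ⟨fun h => ?_, hG σ w⟩
  have := hG (fun m => (σ m).symm) _ h
  rwa [← (permEquiv q ε α f σ n).symm_apply_apply w]

section
variable {q ε α : ℝ} {n : ℕ} {w : Fin n → ℕ} {u v : List ℕ} {Ys : List (List ℕ)}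

lemma Dec.countPar_le (h : Dec q ε α w u Ys v) :
    countPar ε α n ≤ countLong (runPar q ε n) Ys := h.good.many

lemma Dec.exists_index (hq0 : 0 < q) (hq1 : q < 1) (h : Dec q ε α w u Ys v) (f : ℕ) {i : ℕ}
    (hi : i < countPar ε α n) (hf : ∀ Y ∈ Ys.take f, rankIn (runPar q ε n) Ys Y ≠ i) :
    ∃ j : Fin (Ys.drop f).length, IsLong (runPar q ε n) ((Ys.drop f).get j) ∧
      rankIn (runPar q ε n) Ys ((Ys.drop f).get j) = i := by
  obtain ⟨p, hp, hl, hr⟩ := h.exists_mark_rankIn hq0 hq1 (hi.trans_le h.countPar_le)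
  have hm := mem_of_mem_marks hp
  rw [← List.take_append_drop f Ys, List.mem_append] at hm
  obtain ⟨j, hj⟩ := List.mem_iff_get.1 (hm.resolve_left fun hm => hf _ hm hr)
  exact ⟨j, by rwa [hj], by rwa [hj]⟩

/-- The fixed first piece is the smallest block, so the second smallest one is among the pieces that
move. -/
lemma LyndonPieces.rankIn_take {T : ℕ} (h : LyndonPieces T u Ys v) :
    ∀ Y ∈ Ys.take 1, rankIn T Ys Y = 0 := by
  obtain ⟨-, -, Y, Zs, rfl, -, hlt⟩ := h
  intro Y' hY'
  obtain rfl : Y' = Y := by simpa using hY'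
  refine List.countP_eq_zero.2 fun Z hZ => ?_
  simp only [decide_eq_true_eq, not_and]
  intro hl
  rcases List.mem_cons.1 hZ with rfl | hZ
  · exact lt_irrefl _
  · exact (hlt Z hZ hl).asymm

end

section
variable {p : PMF ℕ} {ε α : ℝ} {n : ℕ}

lemma firstProb_pos (hp0 : 0 < p 0) : 0 < firstProb p :=
  ENNReal.toReal_pos hp0.ne' (p.apply_ne_top 0)

lemma firstProb_lt_one (hp1 : p 0 < 1) : firstProb p < 1 := by
  have := (ENNReal.toReal_lt_toReal (p.apply_ne_top 0) ENNReal.one_ne_top).2 hp1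
  simpa [firstProb] using this

lemma exists_coupling_posLaw (hp0 : 0 < p 0) (hp1 : p 0 < 1) (hn : 0 < n) {k : ℕ}
    (hk : k ≤ countPar ε α n) (hN : 0 < countPar ε α n)
    (hG : wordLaw p n (goodWords p ε α n) ≠ 0) :
    ∃ γ : Measure (EuclideanSpace ℝ (Fin k) × EuclideanSpace ℝ (Fin k)),
      γ.map Prod.fst = posLaw p ε α k n ∧ γ.map Prod.snd = unifCube k ∧
      ∫⁻ z, edist z.1 z.2 ^ 2 ∂γ ≤ k * ENNReal.ofReal (errorBound (firstProb p) n) := by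
  have hq0 := firstProb_pos hp0
  have hq1 := firstProb_lt_one hp1
  set q := firstProb p with hq
  have hprob := cond_isProbabilityMeasure hG
  -- `c i` is the place, in the list of pieces, of the long piece of rank `i`, and thus the index of
  -- its key. Distinct ranks have distinct places, so these keys are independent. Words without
  -- decomposition get an arbitrary injection.
  have hidx : ∀ w : Fin n → ℕ, ∃ c : Fin k → ℕ, Function.Injective c ∧
      ∀ u Ys v, Dec q ε α w u Ys v → ∀ i, ∃ j : Fin (Ys.drop 0).length, (j : ℕ) = c i ∧
        IsLong (runPar q ε n) ((Ys.drop 0).get j) ∧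
        rankIn (runPar q ε n) Ys ((Ys.drop 0).get j) = i := by
    intro w
    by_cases h : ∃ u Ys v, Dec q ε α w u Ys v
    · obtain ⟨u, Ys, v, h⟩ := h
      choose j hj1 hj2 using fun i : Fin k =>
        h.exists_index hq0 hq1 0 (i := i) (by omega) (by simp)
      refine ⟨fun i => j i, fun i i' e => ?_, fun u' Zs v' h' i => ?_⟩
      · have := hj2 i'
        rw [← Fin.ext e, hj2 i] at this
        exact Fin.ext this
      · obtain ⟨rfl, rfl, rfl⟩ := h.unique h'
        exact ⟨j i, rfl, hj1 i, hj2 i⟩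
    · exact ⟨fun i => i, Fin.val_injective, fun u Ys v h' => absurd ⟨u, Ys, v, h'⟩ h⟩
  choose c hc1 hc2 using hidx
  refine exists_coupling (μ := cond (wordLaw p n) (goodWords p ε α n)) (P := unifSeq)
    (T := fun θ => permWord q ε α 0 (sortPerm θ))
    (X := fun w => WithLp.toLp 2 fun i : Fin k => pos q ε w i)
    (Z := fun w θ => WithLp.toLp 2 fun i : Fin k => θ (c w i)) ?_ (measurable_permWord 0) ?_ ?_ ?_
  · refine fun θ => cond_map_permWord p q ε α 0 _ fun σ w hw => ?_
    obtain ⟨u, Ys, v, h⟩ := exists_dec hq0 hq1 hN hw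
    exact (h.permWord 0 σ).isGood hq0 hq1
  · intro w
    exact (PiLp.volume_preserving_toLp (Fin k)).measurable.comp
      (measurable_pi_lambda _ fun i => measurable_pi_apply (c w i))
  · exact ae_of_all _ fun w => unifSeq_map_comp (hc1 w)
  · filter_upwards [ae_cond_mem (μ := wordLaw p n)
      (MeasurableSet.of_discrete (s := goodWords p ε α n))] with w hw
    obtain ⟨u, Ys, v, h⟩ := exists_dec hq0 hq1 hN hw
    -- The permuted word is again good and has at least `k` long blocks, so `pos` never takes its
    -- default value 0 here.
    have e : ∀ θ : ℕ → ℝ, edist (WithLp.toLp 2 fun i : Fin k =>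
        pos q ε (permWord q ε α 0 (sortPerm θ) w) i)
        (WithLp.toLp 2 fun i : Fin k => θ (c w i)) ^ 2 = ∑ i : Fin k,
        edist (blockPos q ε (permWord q ε α 0 (sortPerm θ) w) i) (θ (c w i)) ^ 2 := by
      intro θ
      rw [EuclideanSpace.edist_eq, ← ENNReal.rpow_natCast, ← ENNReal.rpow_mul]
      norm_num
      refine Finset.sum_congr rfl fun i _ => ?_
      have h' := h.permWord 0 (sortPerm θ)
      rw [pos, if_pos]
      rw [h'.card_longBlocks hq0 hq1]
      have := h'.countPar_le
      omega
    simp only [e]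
    have hm : ∀ i : Fin k, Measurable fun θ : ℕ → ℝ =>
        edist (blockPos q ε (permWord q ε α 0 (sortPerm θ) w) i) (θ (c w i)) ^ 2 := fun i =>
      (((Measurable.of_discrete (f := fun w : Fin n → ℕ => blockPos q ε w i)).comp
        (measurable_permWord 0 w)).edist (measurable_pi_apply _)).pow_const 2
    rw [lintegral_finsetSum _ fun i _ => hm i]
    calc _ ≤ ∑ i : Fin k, ENNReal.ofReal (errorBound q n) := Finset.sum_le_sum fun i _ => by
          obtain ⟨j, hj, hl, hr⟩ := hc2 w u Ys v h i
          have := h.lintegral_edist_sq_le hq0 hq1 hn (f := 0) (by omega) j hl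
          rwa [hr, hj] at this
      _ = _ := by simp

lemma exists_coupling_secondPosLaw (hp0 : 0 < p 0) (hp1 : p 0 < 1) (hn : 0 < n)
    (hT : 0 < runPar (firstProb p) ε n) (hN : 1 < countPar ε α n)
    (hG : wordLaw p n (goodWords p ε α n ∩ lyndonWords n) ≠ 0) :
    ∃ γ : Measure (ℝ × ℝ),
      γ.map Prod.fst = secondPosLaw p ε α n ∧ γ.map Prod.snd = unifIcc ∧
      ∫⁻ z, edist z.1 z.2 ^ 2 ∂γ ≤ ENNReal.ofReal (errorBound (firstProb p) n) := by
  have hq0 := firstProb_pos hp0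
  have hq1 := firstProb_lt_one hp1
  set q := firstProb p with hq
  have hprob := cond_isProbabilityMeasure hG
  have hdec : ∀ w ∈ goodWords p ε α n ∩ lyndonWords n, ∃ u Ys v, Dec q ε α w u Ys v ∧
      LyndonPieces (runPar q ε n) u Ys v := by
    intro w hw
    obtain ⟨u, Ys, v, h⟩ := exists_dec hq0 hq1 (by omega) hw.1
    have := h.countPar_le
    exact ⟨u, Ys, v, h, h.lyndonPieces hq0 hq1 hT (by omega) hw.2⟩
  have hidx : ∀ w : Fin n → ℕ, ∃ c : ℕ, ∀ u Ys v, Dec q ε α w u Ys v →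
      LyndonPieces (runPar q ε n) u Ys v → ∃ j : Fin (Ys.drop 1).length, (j : ℕ) = c ∧
        IsLong (runPar q ε n) ((Ys.drop 1).get j) ∧
        rankIn (runPar q ε n) Ys ((Ys.drop 1).get j) = 1 := by
    intro w
    by_cases h : ∃ u Ys v, Dec q ε α w u Ys v ∧ LyndonPieces (runPar q ε n) u Ys v
    · obtain ⟨u, Ys, v, h, hL⟩ := h
      obtain ⟨j, hj1, hj2⟩ := h.exists_index hq0 hq1 1 hN
        fun Y hY => by rw [hL.rankIn_take Y hY]; exact zero_ne_one
      refine ⟨j, fun u' Zs v' h' _ => ?_⟩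
      obtain ⟨rfl, rfl, rfl⟩ := h.unique h'
      exact ⟨j, rfl, hj1, hj2⟩
    · exact ⟨0, fun u Ys v h1 h2 => absurd ⟨u, Ys, v, h1, h2⟩ h⟩
  choose c hc using hidx
  refine exists_coupling (μ := cond (wordLaw p n) (goodWords p ε α n ∩ lyndonWords n))
    (P := unifSeq) (T := fun θ => permWord q ε α 1 (sortPerm θ))
    (X := fun w => blockPos q ε w 1) (Z := fun w θ => θ (c w)) ?_ (measurable_permWord 1) ?_ ?_ ?_
  · refine fun θ => cond_map_permWord p q ε α 1 _ fun σ w hw => ?_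
    obtain ⟨u, Ys, v, h, hL⟩ := hdec w hw
    -- The first piece stays in place and the others are only permuted, so the form of Lyndon
    -- decompositions is kept.
    refine ⟨(h.permWord 1 σ).isGood hq0 hq1, (h.permWord 1 σ).isLyndon hq0 hq1 hT ?_⟩
    obtain ⟨-, -, Y, Zs, rfl, -⟩ := id hL
    exact hL.perm (permList_perm σ _).symm
  · exact fun w => measurable_pi_apply _
  · exact ae_of_all _ fun w => unifSeq_map_eval _
  · filter_upwards [ae_cond_mem (μ := wordLaw p n)
      (MeasurableSet.of_discrete (s := goodWords p ε α n ∩ lyndonWords n))] with w hw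
    obtain ⟨u, Ys, v, h, hL⟩ := hdec w hw
    obtain ⟨j, hj, hl, hr⟩ := hc w u Ys v h hL
    have := h.lintegral_edist_sq_le hq0 hq1 hn (f := 1) le_rfl j hl
    rwa [hr, hj] at this

end

/-! ### A good Lyndon word with two letters -/

/-- The letters of a long block that begins with `T` zeros and contains the binary digits of `i`. -/
def codeLetter (T K c i t : ℕ) : ℕ :=
  if t < T then 0 else if t = T then c else if t + 1 = K then c else
  if (t - T - 1) % 2 = 0 then (if i.testBit ((t - T - 1) / 2) then c else 0) else
  if (t - T - 1) % 4 = 1 then c else 0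

/-- The long block that contains the binary digits of `i`. -/
def codeBlock (T K c i : ℕ) : List ℕ := (List.range K).map (codeLetter T K c i)

section
variable {T K F RA RB N b c : ℕ}

lemma length_codeBlock (i : ℕ) : (codeBlock T K c i).length = K := by simp [codeBlock]

lemma letter_codeBlock (i : ℕ) {t : ℕ} (ht : t < K) :
    letter (codeBlock T K c i) t = codeLetter T K c i t := by
  rw [letter_eq_getElem (by simpa [codeBlock])]
  simp [codeBlock]

lemma codeLetter_of_lt {i t : ℕ} (ht : t < T) : codeLetter T K c i t = 0 := if_pos ht

lemma codeLetter_self {i : ℕ} : codeLetter T K c i T = c := by simp [codeLetter]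

lemma codeLetter_last {i t : ℕ} (hT : T ≤ t) (ht : t + 1 = K) : codeLetter T K c i t = c := by
  unfold codeLetter
  rw [if_neg (by omega)]
  split_ifs <;> rfl

lemma codeLetter_one {i t : ℕ} (hT : T < t) (h : (t - T - 1) % 4 = 1) :
    codeLetter T K c i t = c := by
  unfold codeLetter
  rw [if_neg (by omega), if_neg (by omega), if_neg (c := (t - T - 1) % 2 = 0) (by omega), if_pos h]
  split_ifs <;> rfl

lemma codeLetter_three {i t : ℕ} (hT : T < t) (hK : t + 1 < K) (h : (t - T - 1) % 4 = 3) :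
    codeLetter T K c i t = 0 := by
  unfold codeLetter
  rw [if_neg (by omega), if_neg (by omega), if_neg (by omega), if_neg (by omega),
    if_neg (by omega)]

lemma codeLetter_bit {i r : ℕ} (hK : T + 1 + 2 * r + 1 < K) :
    codeLetter T K c i (T + 1 + 2 * r) = if i.testBit r then c else 0 := by
  unfold codeLetter
  rw [if_neg (by omega), if_neg (by omega), if_neg (by omega), if_pos (by omega),
    show (T + 1 + 2 * r - T - 1) / 2 = r by omega]

lemma codeLetter_zero_le (i t : ℕ) : codeLetter T K c 0 t ≤ codeLetter T K c i t := by
  unfold codeLetter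
  split_ifs <;> simp_all

/-- After the initial run, one letter in four is forced to be `c`; hence four consecutive zeros
cannot occur there. -/
lemma not_zeros_codeBlock (hc : c ≠ 0) (i : ℕ) {x : ℕ} (hx : T < x)
    (h : ∀ s < 4, letter (codeBlock T K c i) (x + s) = 0) : False := by
  have h3 : x + 3 < K := by simpa [length_codeBlock] using lt_length_of_letter (h 3 (by omega))
  have key : ∀ s < 4, (x + s - T - 1) % 4 ≠ 1 := fun s hs h1 => by
    have h2 := h s hs
    rw [letter_codeBlock i (by omega), codeLetter_one (by omega) h1] at h2
    exact hc h2
  have k0 := key 0 (by omega)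
  have k1 := key 1 (by omega)
  have k2 := key 2 (by omega)
  have k3 := key 3 (by omega)
  omega

lemma isLong_codeBlock (hTK : T ≤ K) (i : ℕ) : IsLong T (codeBlock T K c i) := fun t ht => by
  rw [letter_codeBlock i (by omega), codeLetter_of_lt ht]

lemma piece_codeBlock (hc : c ≠ 0) (hT : 4 ≤ T) (hTK : T < K) (i : ℕ) :
    Piece T K (codeBlock T K c i) := by
  refine ⟨?_, fun t ht => ?_, fun h => absurd (isLong_codeBlock hTK.le i) h, fun _ => ?_,
    fun _ t ht => ?_, fun t ht => ?_⟩
  · rw [letter_codeBlock i (by omega), codeLetter_of_lt (by omega)]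
  · rw [length_codeBlock] at ht
    rw [letter_codeBlock i (by omega), codeLetter_last (by omega) ht]
    exact hc
  · rw [length_codeBlock]
  · simpa [length_codeBlock] using ht.lt_length
  · by_contra h0
    rcases lt_trichotomy t T with h | h | h
    · have := ht.1.2 (t - 1) (by omega)
      rw [letter_codeBlock i (by omega), codeLetter_of_lt (by omega)] at this
      exact this rfl
    · have := ht.1.1
      rw [h, letter_codeBlock i hTK, codeLetter_self] at this
      exact hc this
    · exact not_zeros_codeBlock hc i h fun s hs => ht.2 s (by omega)

lemma not_hasZeros_codeBlock (hc : c ≠ 0) (hT : 4 ≤ T) (hTK : T < K) (hRA : T ≤ RA) (i : ℕ) :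
    ¬ HasZeros (RA + 1) (codeBlock T K c i) := by
  rintro ⟨x, hx⟩
  rcases le_or_gt x T with h | h
  · have := hx (T - x) (by omega)
    rw [show x + (T - x) = T by omega, letter_codeBlock i hTK, codeLetter_self] at this
    exact hc this
  · exact not_zeros_codeBlock hc i h fun s hs => hx s (by omega)

/-- After the initial run and before the last letter, one letter in four is forced to be 0. -/
lemma not_hasNZ_codeBlock (hRB : 5 ≤ RB) (i : ℕ) :
    ¬ HasNZ (RB + 1) (codeBlock T K c i) := by
  rintro ⟨x, hl, hx⟩
  rw [length_codeBlock] at hl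
  rcases lt_or_ge x T with h | h
  · have := hx 0 (by omega)
    rw [letter_codeBlock i (by omega), codeLetter_of_lt (by omega)] at this
    exact this rfl
  · have key : ∀ s, 1 ≤ s → s < 5 → (x + s - T - 1) % 4 ≠ 3 := fun s hs hs' h1 => by
      have h2 := hx s (by omega)
      rw [letter_codeBlock i (by omega), codeLetter_three (by omega) (by omega) h1] at h2
      exact h2 rfl
    have k1 := key 1 (by omega) (by omega)
    have k2 := key 2 (by omega) (by omega)
    have k3 := key 3 (by omega) (by omega)
    have k4 := key 4 (by omega) (by omega)
    omega

lemma exists_letter_of_infix {x Y : List ℕ} (h : x <:+: Y) :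
    ∃ o, o + x.length ≤ Y.length ∧ ∀ t < x.length, letter x t = letter Y (o + t) := by
  obtain ⟨s, t, rfl⟩ := h
  refine ⟨s.length, by simp, fun r hr => ?_⟩
  rw [List.append_assoc, letter_append_add, letter_append_left hr]

/-- A common factor of length at least `F` misses at most two letters of each block. It contains the
end of the initial run of zeros, which forces equal offsets in both blocks, and it contains all `b`
binary digits, which then coincide. -/
lemma commonLT_codeBlock (hc : c ≠ 0) (hT : 4 ≤ T) (hFK : F < K) (hKF : K ≤ F + 2)
    (hbF : T + 2 + 2 * b ≤ F) {i j : ℕ} (hi : i < 2 ^ b) (hj : j < 2 ^ b) (hij : i ≠ j) :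
    CommonLT F (codeBlock T K c i) (codeBlock T K c j) := by
  intro x hxi hxj
  by_contra hlen
  obtain ⟨o, ho, hlo⟩ := exists_letter_of_infix hxi
  obtain ⟨o', ho', hlo'⟩ := exists_letter_of_infix hxj
  rw [length_codeBlock] at ho ho'
  have key : ∀ t < x.length, codeLetter T K c i (o + t) = codeLetter T K c j (o' + t) := by
    intro t ht
    rw [← letter_codeBlock i (by omega), ← letter_codeBlock j (by omega), ← hlo t ht, hlo' t ht]
  have hoo : o = o' := by
    rcases lt_trichotomy o o' with h | h | h
    · have := key (T - o') (by omega)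
      rw [show o' + (T - o') = T by omega, codeLetter_self, codeLetter_of_lt (by omega)] at this
      exact absurd this.symm hc
    · exact h
    · have := key (T - o) (by omega)
      rw [show o + (T - o) = T by omega, codeLetter_self, codeLetter_of_lt (by omega)] at this
      exact absurd this hc
  subst hoo
  obtain ⟨r, hr⟩ := Nat.exists_testBit_ne_of_ne hij
  have hrb : r < b := by
    by_contra hcon
    have h2 : 2 ^ b ≤ 2 ^ r := Nat.pow_le_pow_right (by omega) (by omega)
    rw [Nat.testBit_eq_false_of_lt (hi.trans_le h2), Nat.testBit_eq_false_of_lt (hj.trans_le h2)]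
      at hr
    exact hr rfl
  have := key (T + 1 + 2 * r - o) (by omega)
  rw [show o + (T + 1 + 2 * r - o) = T + 1 + 2 * r by omega, codeLetter_bit (by omega),
    codeLetter_bit (by omega)] at this
  cases h1 : i.testBit r <;> cases h2 : j.testBit r <;> simp_all

/-- The digits of 0 are all 0, so its block is letterwise at most any other, and the two differ at
some letter. -/
lemma codeBlock_lt (hc : c ≠ 0) (hT : 4 ≤ T) (hFK : F < K) (hKF : K ≤ F + 2)
    (hbF : T + 2 + 2 * b ≤ F) {i : ℕ} (hi : i < 2 ^ b) (h0 : i ≠ 0) :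
    codeBlock T K c 0 < codeBlock T K c i := by
  obtain ⟨L, h1, h2, h3, h4⟩ := exists_diff
    (commonLT_codeBlock hc hT hFK hKF hbF (Nat.two_pow_pos b) hi h0.symm)
    (by rw [length_codeBlock]; exact hFK.le) (by rw [length_codeBlock]; exact hFK.le)
  refine lt_of_letter h1 h2 h3 (lt_of_le_of_ne ?_ h4)
  rw [length_codeBlock] at h1
  rw [letter_codeBlock 0 h1, letter_codeBlock i h1]
  exact codeLetter_zero_le i L

lemma runStart_pair (hc : c ≠ 0) (l t : ℕ) (h : RunStart (0 :: List.replicate l c) t) : t = 0 := by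
  rcases t with _ | t
  · rfl
  · have h1 := h.1
    have h2 := h.lt_length
    rw [letter_eq_getElem h2] at h1
    simp at h1
    exact absurd h1 hc

lemma not_isLong_pair (hc : c ≠ 0) (hT : 4 ≤ T) {l : ℕ} :
    ¬ IsLong T (0 :: List.replicate l c) := by
  intro h
  have h1 := h 1 (by omega)
  have h2 := lt_length_of_letter h1
  rw [letter_eq_getElem h2] at h1
  simp at h1
  exact hc h1

lemma tail_pair (hc : c ≠ 0) (hT : 4 ≤ T) (l : ℕ) : Tail T (0 :: List.replicate l c) :=
  ⟨rfl, runStart_pair hc l, not_isLong_pair hc hT⟩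

lemma endsNZ_pair (hc : c ≠ 0) {l : ℕ} (hl : 0 < l) : EndsNZ (0 :: List.replicate l c) := by
  intro t ht
  simp only [List.length_cons, List.length_replicate] at ht
  obtain ⟨s, rfl⟩ : ∃ s, t = s + 1 := ⟨t - 1, by omega⟩
  rw [letter_eq_getElem (by simp; omega)]
  simpa using hc

lemma piece_pair (hc : c ≠ 0) (hT : 4 ≤ T) {l : ℕ} (hl : 0 < l) :
    Piece T K (0 :: List.replicate l c) :=
  ⟨rfl, endsNZ_pair hc hl, fun _ => runStart_pair hc l, fun h => absurd h (not_isLong_pair hc hT),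
    fun h => absurd h (not_isLong_pair hc hT), fun t ht => runStart_pair hc l t ht.1⟩

lemma not_hasZeros_pair (hc : c ≠ 0) (hRA : 4 ≤ RA) (l : ℕ) :
    ¬ HasZeros (RA + 1) (0 :: List.replicate l c) := by
  rintro ⟨x, hx⟩
  have h1 := hx 1 (by omega)
  have h2 := lt_length_of_letter h1
  rw [letter_eq_getElem h2] at h1
  simp at h1
  exact hc h1

lemma not_hasNZ_of_length {r : ℕ} {W : List ℕ} (h : W.length < r) : ¬ HasNZ r W := by
  rintro ⟨x, hl, -⟩
  omega

/-- The word consists of the code blocks of `0, …, N - 1`, then of pairs `0c` that fill up the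
length, then of the tail. The code block of 0 comes first and is the smallest long piece. -/
lemma exists_valid_lyndonPieces {n : ℕ} (hc : c ≠ 0) (hT : 4 ≤ T) (hRA : T ≤ RA) (hRB : 5 ≤ RB)
    (hFK : F < K) (hKF : K ≤ F + 2) (hbF : T + 2 + 2 * b ≤ F) (hN : 0 < N) (hNb : N ≤ 2 ^ b)
    (hn : N * K + 4 ≤ n) :
    ∃ Ys v, Valid T K [] Ys v ∧ GoodPieces T F RA RB N [] Ys v ∧ LyndonPieces T [] Ys v ∧
      (([] : List ℕ) ++ (Ys.flatten ++ v)).length = n ∧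
      ∀ x ∈ ([] : List ℕ) ++ (Ys.flatten ++ v), x = 0 ∨ x = c := by
  -- The tail is `0c` or `0cc`, according to the parity of the length left by the code blocks.
  obtain ⟨a, l, hl1, hl2, hal⟩ : ∃ a l, 0 < l ∧ l ≤ 2 ∧ N * K + (2 * a + (l + 1)) = n := by
    rcases Nat.even_or_odd' (n - N * K - 2) with ⟨a, ha | ha⟩
    · exact ⟨a, 1, by omega, by omega, by omega⟩
    · exact ⟨a, 2, by omega, by omega, by omega⟩
  have hTK : T < K := by omega
  set Ys := (List.range N).map (codeBlock T K c) ++ List.replicate a (0 :: List.replicate 1 c)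
    with hYs
  set v := 0 :: List.replicate l c with hv
  have hmem : ∀ Y ∈ Ys, (∃ i < N, Y = codeBlock T K c i) ∨ Y = 0 :: List.replicate 1 c := by
    intro Y hY
    rcases List.mem_append.1 hY with h | h
    · obtain ⟨i, hi, rfl⟩ := List.mem_map.1 h
      exact Or.inl ⟨i, List.mem_range.1 hi, rfl⟩
    · exact Or.inr (List.eq_of_mem_replicate h)
  refine ⟨Ys, v, ⟨by simp, fun Y hY => ?_, tail_pair hc hT l⟩, ⟨?_, ?_, ?_, ?_⟩,
    ⟨rfl, endsNZ_pair hc hl1, ?_⟩, ?_, ?_⟩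
  · rcases hmem Y hY with ⟨i, -, rfl⟩ | rfl
    exacts [piece_codeBlock hc hT hTK i, piece_pair hc hT one_pos]
  · rw [countLong, hYs, List.countP_append]
    have : List.countP (fun Y => decide (IsLong T Y)) ((List.range N).map (codeBlock T K c)) = N := by
      rw [List.countP_eq_length.2]
      · simp
      · intro Y hY
        obtain ⟨i, -, rfl⟩ := List.mem_map.1 hY
        exact decide_eq_true (isLong_codeBlock hTK.le i)
    omega
  · rw [hYs, List.pairwise_append]
    refine ⟨?_, ?_, ?_⟩
    · rw [List.pairwise_map]
      refine List.nodup_range.pairwise_of_forall_ne fun i hi j hj hij _ _ => ?_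
      rw [List.mem_range] at hi hj
      exact commonLT_codeBlock hc hT hFK hKF hbF (hi.trans_le hNb) (hj.trans_le hNb) hij
    · refine List.Pairwise.imp_of_mem (R := fun _ _ => True) (fun {Y _} hY _ _ h => ?_) (by simp)
      rw [List.eq_of_mem_replicate hY] at h
      exact absurd h (not_isLong_pair hc hT)
    · intro Y _ Z hZ _ h
      rw [List.eq_of_mem_replicate hZ] at h
      exact absurd h (not_isLong_pair hc hT)
  · rintro (⟨x, hx⟩ | ⟨Y, hY, h⟩ | h)
    · have := lt_length_of_letter (hx 0 (by omega))
      simp at this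
    · rcases hmem Y hY with ⟨i, -, rfl⟩ | rfl
      exacts [not_hasZeros_codeBlock hc hT hTK hRA i h, not_hasZeros_pair hc (by omega) 1 h]
    · exact not_hasZeros_pair hc (by omega) l h
  · rintro (h | ⟨Y, hY, h⟩ | h)
    · exact not_hasNZ_of_length (by simp) h
    · rcases hmem Y hY with ⟨i, -, rfl⟩ | rfl
      exacts [not_hasNZ_codeBlock hRB i h, not_hasNZ_of_length (by simp; omega) h]
    · exact not_hasNZ_of_length (by simp [hv]; omega) h
  · obtain ⟨M, rfl⟩ : ∃ M, N = M + 1 := ⟨N - 1, by omega⟩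
    refine ⟨codeBlock T K c 0, ((List.range M).map Nat.succ).map (codeBlock T K c) ++
      List.replicate a (0 :: List.replicate 1 c), ?_, isLong_codeBlock hTK.le 0, ?_⟩
    · rw [hYs, List.range_succ_eq_map, List.map_cons, List.cons_append]
    · intro Z hZ hl
      rcases List.mem_append.1 hZ with h | h
      · obtain ⟨i, hi, rfl⟩ := List.mem_map.1 h
        obtain ⟨i, hi', rfl⟩ := List.mem_map.1 hi
        rw [List.mem_range] at hi'
        exact codeBlock_lt hc hT hFK hKF hbF (by omega) (by omega)
      · rw [List.eq_of_mem_replicate h] at hl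
        exact absurd hl (not_isLong_pair hc hT)
  · rw [← hal, hYs, hv]
    have e : (List.length ∘ codeBlock T K c) = fun _ => K := funext fun i => length_codeBlock i
    simp [List.length_flatten, e]
    ring
  · intro x hx
    simp only [List.nil_append, List.mem_append, List.mem_flatten] at hx
    have hpair : ∀ l, x ∈ 0 :: List.replicate l c → x = 0 ∨ x = c := fun l h => by
      rcases List.mem_cons.1 h with h | h
      exacts [Or.inl h, Or.inr (List.eq_of_mem_replicate h)]
    rcases hx with ⟨Y, hY, hx⟩ | hx
    · rcases hmem Y hY with ⟨i, -, rfl⟩ | rfl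
      · obtain ⟨t, -, rfl⟩ := List.mem_map.1 hx
        unfold codeLetter
        split_ifs <;> simp
      · exact hpair _ hx
    · exact hpair _ hx

end

lemma exists_letter_pos {p : PMF ℕ} (hp1 : p 0 < 1) : ∃ c, c ≠ 0 ∧ p c ≠ 0 := by
  by_contra h
  push Not at h
  have := p.tsum_coe
  rw [tsum_eq_single 0 h] at this
  exact hp1.ne this

/-- One word whose letters all have positive probability is enough; the probability of the event
need not be estimated. -/
lemma wordLaw_good_lyndon_ne_zero {p : PMF ℕ} (hp0 : 0 < p 0) (hp1 : p 0 < 1) {ε α : ℝ} {n b : ℕ}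
    (hT : 4 ≤ runPar (firstProb p) ε n) (hRA : runPar (firstProb p) ε n ≤ maxPar (firstProb p) n)
    (hRB : 5 ≤ maxPar (1 - firstProb p) n)
    (hKF : blockPar (firstProb p) n ≤ factorPar (firstProb p) n + 2)
    (hbF : runPar (firstProb p) ε n + 2 + 2 * b ≤ factorPar (firstProb p) n)
    (hN : 0 < countPar ε α n) (hNb : countPar ε α n ≤ 2 ^ b)
    (hn : countPar ε α n * blockPar (firstProb p) n + 4 ≤ n) :
    wordLaw p n (goodWords p ε α n ∩ lyndonWords n) ≠ 0 := by
  have hq0 := firstProb_pos hp0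
  have hq1 := firstProb_lt_one hp1
  obtain ⟨c, hc, hpc⟩ := exists_letter_pos hp1
  obtain ⟨Ys, v, h1, h2, h3, h4, h5⟩ := exists_valid_lyndonPieces hc hT hRA hRB
    (factorPar_lt_blockPar hq0 hq1 n) hKF hbF hN hNb hn
  have hd : Dec (firstProb p) ε α (toWord n ([] ++ (Ys.flatten ++ v))) [] Ys v :=
    ⟨h1, h2, ofFn_toWord h4⟩
  have hmem : toWord n ([] ++ (Ys.flatten ++ v)) ∈ goodWords p ε α n ∩ lyndonWords n :=
    ⟨hd.isGood hq0 hq1, hd.isLyndon hq0 hq1 (by omega) h3⟩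
  intro h0
  have := measure_mono_null (Set.singleton_subset_iff.2 hmem) h0
  rw [wordLaw_singleton, hd.eq, List.prod_eq_zero_iff, List.mem_map] at this
  obtain ⟨x, hx, e⟩ := this
  rcases h5 x hx with rfl | rfl
  exacts [hp0.ne' e, hpc e]

/-! ### Asymptotics of the parameters -/

section
variable {q ε α : ℝ}

lemma tendsto_logb_inv {b : ℝ} (hb0 : 0 < b) (hb1 : b < 1) :
    Tendsto (fun n : ℕ => Real.logb (1 / b) n) atTop atTop :=
  (Real.tendsto_logb_atTop (by rw [lt_div_iff₀ hb0]; linarith)).comp tendsto_natCast_atTop_atTop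

lemma tendsto_runPar (hq0 : 0 < q) (hq1 : q < 1) (hε : ε < 1) :
    Tendsto (fun n => runPar q ε n) atTop atTop :=
  tendsto_nat_ceil_atTop.comp ((tendsto_logb_inv hq0 hq1).const_mul_atTop (by linarith))

lemma tendsto_maxPar (hq0 : 0 < q) (hq1 : q < 1) :
    Tendsto (fun n => maxPar q n) atTop atTop :=
  tendsto_nat_floor_atTop.comp ((tendsto_logb_inv hq0 hq1).const_mul_atTop two_pos)

lemma tendsto_countPar (hε : 0 < ε) (hα : 0 < α) :
    Tendsto (fun n => countPar ε α n) atTop atTop :=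
  tendsto_nat_floor_atTop.comp
    (((tendsto_rpow_atTop hε).comp tendsto_natCast_atTop_atTop).const_mul_atTop hα)

lemma eventually_mul_log_le (C : ℝ) : ∀ᶠ n : ℕ in atTop, C * Real.log n ≤ n := by
  have h := (Real.isLittleO_log_id_atTop.comp_tendsto tendsto_natCast_atTop_atTop).def
    (show (0 : ℝ) < 1 / (|C| + 1) by positivity)
  filter_upwards [h, eventually_ge_atTop 1] with n hn hn1
  have hn1' : (1 : ℝ) ≤ n := by exact_mod_cast hn1
  have hlog := Real.log_nonneg hn1'
  simp only [Function.comp, id, Real.norm_eq_abs, abs_of_nonneg hlog, Nat.abs_cast] at hn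
  rw [one_div, inv_mul_eq_div, le_div_iff₀ (by positivity)] at hn
  nlinarith [le_abs_self C]

lemma eventually_one_le_log : ∀ᶠ n : ℕ in atTop, 1 ≤ Real.log n :=
  (Real.tendsto_log_atTop.comp tendsto_natCast_atTop_atTop).eventually_ge_atTop 1

lemma exists_lengthBound_le (hq0 : 0 < q) (hq1 : q < 1) :
    ∃ C : ℝ, ∀ᶠ n : ℕ in atTop, (lengthBound q n : ℝ) ≤ C * Real.log n := by
  refine ⟨2 + 3 / Real.log (1 / beta q) + 2 / Real.log (1 / q) + 2 / Real.log (1 / (1 - q)), ?_⟩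
  filter_upwards [eventually_one_le_log] with n hn
  have h1 := logb_inv_nonneg (beta_pos hq0) (beta_lt_one hq0 hq1) n
  have h2 := logb_inv_nonneg hq0 hq1 n
  have h3 := logb_inv_nonneg (show 0 < 1 - q by linarith) (by linarith) n
  have e1 : (blockPar q n : ℝ) ≤ 1 + 3 * Real.logb (1 / beta q) n + 1 := by
    unfold blockPar
    push_cast
    have := Nat.floor_le (show 0 ≤ 1 + 3 * Real.logb (1 / beta q) n by linarith)
    linarith
  have e2 : (maxPar q n : ℝ) ≤ 2 * Real.logb (1 / q) n := Nat.floor_le (by linarith)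
  have e3 : (maxPar (1 - q) n : ℝ) ≤ 2 * Real.logb (1 / (1 - q)) n := Nat.floor_le (by linarith)
  unfold lengthBound
  push_cast
  calc _ ≤ 2 + 3 * Real.logb (1 / beta q) n + 2 * Real.logb (1 / q) n +
        2 * Real.logb (1 / (1 - q)) n := by linarith
    _ ≤ 2 * Real.log n + 3 * Real.logb (1 / beta q) n + 2 * Real.logb (1 / q) n +
        2 * Real.logb (1 / (1 - q)) n := by linarith
    _ = _ := by simp only [Real.logb]; ring

lemma exists_errorBound_le (hq0 : 0 < q) (hq1 : q < 1) :
    ∃ C : ℝ, 0 < C ∧ ∀ᶠ n : ℕ in atTop, errorBound q n ≤ C * (Real.log n / n) := by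
  obtain ⟨C, hC⟩ := exists_lengthBound_le hq0 hq1
  refine ⟨12 * |C| + 1, by positivity, ?_⟩
  filter_upwards [hC, eventually_mul_log_le C, eventually_gt_atTop 0, eventually_one_le_log]
    with n h1 h2 h3 h4
  have hn : (0 : ℝ) < n := by exact_mod_cast h3
  have hB : (0 : ℝ) ≤ lengthBound q n := by positivity
  unfold errorBound
  -- Since `lengthBound q n ≤ C * log n ≤ n`, the quadratic boundary term is absorbed by the
  -- variance term.
  calc _ ≤ 2 / (n : ℝ) ^ 2 * (2 * (lengthBound q n * n) + 4 * (lengthBound q n * n)) := by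
        gcongr
        nlinarith
    _ = 12 * lengthBound q n / n := by field_simp; ring
    _ ≤ 12 * (C * Real.log n) / n := by gcongr
    _ = 12 * C * (Real.log n / n) := by ring
    _ ≤ _ := by
        gcongr
        linarith [le_abs_self C]

lemma eventually_wordLaw_ne_zero {p : PMF ℕ} (hp0 : 0 < p 0) (hp1 : p 0 < 1) (hε0 : 0 < ε)
    (hε1 : ε < 1 / 2) (hα0 : 0 < α) (hα1 : α < 1) :
    ∀ᶠ n : ℕ in atTop, wordLaw p n (goodWords p ε α n ∩ lyndonWords n) ≠ 0 := by
  have hq0 := firstProb_pos hp0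
  have hq1 := firstProb_lt_one hp1
  set q := firstProb p with hq
  have hβ0 := beta_pos hq0
  have hβ1 := beta_lt_one hq0 hq1
  have hlβ : 0 < Real.log (1 / beta q) := Real.log_pos (by rw [lt_div_iff₀ hβ0]; linarith)
  -- At most `√n` long blocks, each of length at most `2 + 3 log_{1/β} n`, and four more letters
  -- have to fit in the word.
  have hsmall : ∀ᶠ n : ℕ in atTop,
      (n : ℝ) ^ (1 / 2 : ℝ) * (6 + 3 * Real.logb (1 / beta q) n) ≤ n := by
    have h := ((isLittleO_log_rpow_atTop (show (0 : ℝ) < 1 / 2 by norm_num)).comp_tendsto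
      tendsto_natCast_atTop_atTop).def (show 0 < 1 / (6 + 3 / Real.log (1 / beta q)) by positivity)
    filter_upwards [h, eventually_one_le_log, eventually_gt_atTop 0] with n h1 h2 h3
    have hn : (0 : ℝ) < n := by exact_mod_cast h3
    simp only [Function.comp, Real.norm_eq_abs] at h1
    rw [abs_of_nonneg (by linarith), abs_of_nonneg (by positivity), one_div, inv_mul_eq_div,
      le_div_iff₀ (by positivity)] at h1
    calc _ ≤ (n : ℝ) ^ (1 / 2 : ℝ) * (Real.log n * (6 + 3 / Real.log (1 / beta q))) := by
          gcongr
          rw [Real.logb, mul_add]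
          have : Real.log n * (3 / Real.log (1 / beta q)) =
            3 * (Real.log n / Real.log (1 / beta q)) := by ring
          linarith
      _ ≤ (n : ℝ) ^ (1 / 2 : ℝ) * (n : ℝ) ^ (1 / 2 : ℝ) := by gcongr
      _ = n := by rw [← Real.rpow_add hn]; norm_num
  filter_upwards [(tendsto_runPar (ε := ε) hq0 hq1 (by linarith)).eventually_ge_atTop 4,
    (tendsto_logb_inv hq0 hq1).eventually_ge_atTop 1,
    (tendsto_maxPar (q := 1 - q) (by linarith) (by linarith)).eventually_ge_atTop 5,
    (tendsto_logb_inv hβ0 hβ1).eventually_ge_atTop 6,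
    (tendsto_countPar hε0 hα0).eventually_ge_atTop 1, hsmall, eventually_one_le_log,
    eventually_ge_atTop 1] with n h1 h2 h3 h4 h5 h6 h7 h8
  have hn1 : (1 : ℝ) ≤ n := by exact_mod_cast h8
  have hA : 0 ≤ (1 - ε) * Real.logb (1 / q) n := mul_nonneg (by linarith) (by linarith)
  have hrun : (runPar q ε n : ℝ) < Real.logb (1 / q) n + 1 :=
    (Nat.ceil_lt_add_one hA).trans_le (by nlinarith)
  have hcount : (countPar ε α n : ℝ) ≤ (n : ℝ) ^ (1 / 2 : ℝ) := by
    calc (countPar ε α n : ℝ) ≤ α * (n : ℝ) ^ ε := Nat.floor_le (by positivity)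
      _ ≤ 1 * (n : ℝ) ^ (1 / 2 : ℝ) := by gcongr
      _ = _ := one_mul _
  have hblock : (blockPar q n : ℝ) ≤ 2 + 3 * Real.logb (1 / beta q) n := by
    unfold blockPar
    push_cast
    have := Nat.floor_le (show 0 ≤ 1 + 3 * Real.logb (1 / beta q) n by linarith)
    linarith
  have hqβ : Real.logb (1 / q) n ≤ Real.logb (1 / beta q) n := by
    simp only [Real.logb]
    refine div_le_div_of_nonneg_left (by linarith) hlβ (Real.log_le_log (by positivity) ?_)
    exact one_div_le_one_div_of_le hq0 (le_max_left _ _)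
  have h2β : Real.logb 2 n ≤ Real.logb (1 / beta q) n := by
    simp only [Real.logb]
    refine div_le_div_of_nonneg_left (by linarith) hlβ (Real.log_le_log (by positivity) ?_)
    rw [div_le_iff₀ hβ0]
    have h1 : q ≤ beta q := le_max_left _ _
    have h2 : 1 - q ≤ beta q := le_max_right _ _
    linarith
  have hl2 : 0 ≤ Real.logb 2 n := Real.logb_nonneg one_lt_two hn1
  have hhalf : (1 : ℝ) ≤ (n : ℝ) ^ (1 / 2 : ℝ) := Real.one_le_rpow hn1 (by norm_num)
  -- With this number of digits, `2 ^ b ≥ √n`, which bounds the number of blocks to be encoded.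
  refine wordLaw_good_lyndon_ne_zero (b := ⌈1 / 2 * Real.logb 2 n⌉₊) hp0 hp1 h1 ?_ h3 ?_ ?_ h5 ?_ ?_
  · rw [maxPar, Nat.le_floor_iff (by linarith)]
    linarith
  · rw [blockPar, factorPar, add_comm (1 : ℝ), Nat.floor_add_one (by linarith)]
    have := Nat.floor_le_ceil (3 * Real.logb (1 / beta q) n)
    rw [← hq]
    omega
  -- With `L = log_{1/β} n`, which dominates both `log_{1/q} n` and `log_2 n` as `β ≥ max q (1/2)`,
  -- the left side is less than `2 * L + 5`, while `factorPar` is at least `3 * L`, and `L ≥ 6`.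
  · have hb := Nat.ceil_lt_add_one (show 0 ≤ 1 / 2 * Real.logb 2 n by linarith)
    have hF := Nat.le_ceil (3 * Real.logb (1 / beta q) n)
    have : (runPar q ε n : ℝ) + 2 + 2 * ⌈1 / 2 * Real.logb 2 n⌉₊ ≤ factorPar q n := by
      unfold factorPar
      linarith
    exact_mod_cast this
  · have h9 : ((2 : ℝ) ^ (1 / 2 * Real.logb 2 n)) = (n : ℝ) ^ (1 / 2 : ℝ) := by
      rw [mul_comm, Real.rpow_mul (by norm_num), Real.rpow_logb two_pos (by norm_num) (by linarith)]
    have : (countPar ε α n : ℝ) ≤ 2 ^ ⌈1 / 2 * Real.logb 2 n⌉₊ := by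
      rw [← Real.rpow_natCast]
      refine (hcount.trans_eq h9.symm).trans ?_
      exact Real.rpow_le_rpow_of_exponent_le one_le_two (Nat.le_ceil _)
    exact_mod_cast this
  · have : (countPar ε α n : ℝ) * blockPar q n + 4 ≤ n := by
      calc _ ≤ (n : ℝ) ^ (1 / 2 : ℝ) * (2 + 3 * Real.logb (1 / beta q) n) +
            (n : ℝ) ^ (1 / 2 : ℝ) * 4 := by
            refine add_le_add (mul_le_mul hcount hblock (by positivity) (by positivity)) ?_
            linarith
        _ = (n : ℝ) ^ (1 / 2 : ℝ) * (6 + 3 * Real.logb (1 / beta q) n) := by ring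
        _ ≤ n := h6
    exact_mod_cast this

end

/-! ### Wasserstein distances and moments -/

lemma W2_le_of_coupling {E : Type*} [MeasurableSpace E] [PseudoEMetricSpace E] {μ ν : Measure E}
    {γ : Measure (E × E)} (h1 : γ.map Prod.fst = μ) (h2 : γ.map Prod.snd = ν) {c : ℝ} (hc : 0 ≤ c)
    (h : ∫⁻ z, edist z.1 z.2 ^ 2 ∂γ ≤ ENNReal.ofReal c) :
    W2 μ ν ≤ ENNReal.ofReal (Real.sqrt c) := by
  refine (iInf₂_le γ ⟨h1, h2⟩).trans ((ENNReal.rpow_le_rpow h (by norm_num)).trans_eq ?_)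
  rw [ENNReal.ofReal_rpow_of_nonneg hc (by norm_num), Real.sqrt_eq_rpow]

lemma blockPos_mem_Icc {q ε : ℝ} {n : ℕ} (w : Fin n → ℕ) (i : ℕ) :
    blockPos q ε w i ∈ Set.Icc (0 : ℝ) 1 := by
  refine ⟨by unfold blockPos; positivity, div_le_one_of_le₀ ?_ (by positivity)⟩
  rw [Nat.cast_le]
  rcases Set.eq_empty_or_nonempty
    {s : ℕ | ∃ b ∈ blocks q ε w, rank q ε w b = i ∧ b.1 = s} with h | h
  · rw [h, Nat.sInf_empty]; exact Nat.zero_le _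
  · obtain ⟨b, hb, -, e⟩ := Nat.sInf_mem h
    rw [← e]
    have : b.1 < n + 1 := by
      rcases Finset.mem_union.1 hb with hb | hb
      · simp only [longBlocks, Finset.mem_filter, Finset.mem_product, Finset.mem_range] at hb
        exact hb.1.1
      · simp only [shortBlocks, Finset.mem_filter, Finset.mem_product, Finset.mem_range] at hb
        exact hb.1.1
    omega

lemma abs_pow_sub_pow_le_of_mem {x y : ℝ} (hx : x ∈ Set.Icc (0 : ℝ) 1) (hy : y ∈ Set.Icc (0 : ℝ) 1)
    (m : ℕ) : |x ^ m - y ^ m| ≤ m * |x - y| := by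
  induction m with
  | zero => simp
  | succ m ih =>
    have e : x ^ (m + 1) - y ^ (m + 1) = x * (x ^ m - y ^ m) + (x - y) * y ^ m := by ring
    rw [e]
    refine (abs_add_le _ _).trans ?_
    rw [abs_mul, abs_mul, abs_of_nonneg hx.1, abs_of_nonneg (pow_nonneg hy.1 m)]
    have h1 : x * |x ^ m - y ^ m| ≤ |x ^ m - y ^ m| :=
      mul_le_of_le_one_left (abs_nonneg _) hx.2
    have h2 : |x - y| * y ^ m ≤ |x - y| :=
      mul_le_of_le_one_right (abs_nonneg _) (pow_le_one₀ hy.1 hy.2)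
    push_cast
    linarith

/-- On `[0,1]` the `m`-th power is `m`-Lipschitz. With `s = √c`, the inequality `|x - y| ≤ (s ^ 2 +
(x - y) ^ 2) / (2 * s)` takes the place of Cauchy–Schwarz and integrates to at most `s`. -/
lemma abs_moment_sub_le {μ ν : Measure ℝ} [IsProbabilityMeasure ν]
    (hμ : ∀ᵐ x ∂μ, x ∈ Set.Icc (0 : ℝ) 1) (hν : ∀ᵐ x ∂ν, x ∈ Set.Icc (0 : ℝ) 1)
    {γ : Measure (ℝ × ℝ)} (h1 : γ.map Prod.fst = μ) (h2 : γ.map Prod.snd = ν) {c : ℝ} (hc : 0 < c)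
    (h : ∫⁻ z, edist z.1 z.2 ^ 2 ∂γ ≤ ENNReal.ofReal c) (m : ℕ) :
    |∫ x, x ^ m ∂μ - ∫ x, x ^ m ∂ν| ≤ m * Real.sqrt c := by
  subst h1 h2
  have hγ : IsProbabilityMeasure γ := by
    refine ⟨?_⟩
    have := measure_univ (μ := γ.map Prod.snd)
    rwa [Measure.map_apply measurable_snd MeasurableSet.univ] at this
  have hx := ae_of_ae_map measurable_fst.aemeasurable hμ
  have hy := ae_of_ae_map measurable_snd.aemeasurable hν
  have hpow : ∀ t ∈ Set.Icc (0 : ℝ) 1, ‖t ^ m‖ ≤ 1 := fun t ht => by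
    rw [Real.norm_eq_abs, abs_of_nonneg (pow_nonneg ht.1 m)]
    exact pow_le_one₀ ht.1 ht.2
  have i1 : Integrable (fun z : ℝ × ℝ => z.1 ^ m) γ :=
    Integrable.of_bound (by fun_prop) 1 (hx.mono fun z hz => hpow _ hz)
  have i2 : Integrable (fun z : ℝ × ℝ => z.2 ^ m) γ :=
    Integrable.of_bound (by fun_prop) 1 (hy.mono fun z hz => hpow _ hz)
  have i3 : Integrable (fun z : ℝ × ℝ => (z.1 - z.2) ^ 2) γ := by
    refine Integrable.of_bound (by fun_prop) 1 ?_
    filter_upwards [hx, hy] with z h1 h2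
    rw [Real.norm_eq_abs, abs_of_nonneg (sq_nonneg _), sq_le_one_iff_abs_le_one, abs_le]
    exact ⟨by linarith [h1.1, h2.2], by linarith [h1.2, h2.1]⟩
  have hsq : ∫ z, (z.1 - z.2) ^ 2 ∂γ ≤ c := by
    rw [← ENNReal.ofReal_le_ofReal_iff hc.le,
      ofReal_integral_eq_lintegral_ofReal i3 (ae_of_all _ fun z => sq_nonneg _)]
    simpa only [edist_sq_eq] using h
  have hs : 0 < Real.sqrt c := Real.sqrt_pos.2 hc
  have hss : Real.sqrt c ^ 2 = c := Real.sq_sqrt hc.le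
  rw [integral_map measurable_fst.aemeasurable (by fun_prop),
    integral_map measurable_snd.aemeasurable (by fun_prop), ← integral_sub i1 i2]
  refine (abs_integral_le_integral_abs).trans ?_
  have i4 : Integrable (fun z : ℝ × ℝ => m * ((Real.sqrt c ^ 2 + (z.1 - z.2) ^ 2) /
      (2 * Real.sqrt c))) γ :=
    (((integrable_const _).add i3).div_const _).const_mul _
  calc ∫ z, |z.1 ^ m - z.2 ^ m| ∂γ
      ≤ ∫ z, m * ((Real.sqrt c ^ 2 + (z.1 - z.2) ^ 2) / (2 * Real.sqrt c)) ∂γ := by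
        refine integral_mono_ae (i1.sub i2).abs i4 ?_
        filter_upwards [hx, hy] with z h1 h2
        refine (abs_pow_sub_pow_le_of_mem h1 h2 m).trans ?_
        refine mul_le_mul_of_nonneg_left ?_ (Nat.cast_nonneg m)
        rw [le_div_iff₀ (by positivity), ← sq_abs (z.1 - z.2)]
        nlinarith [sq_nonneg (Real.sqrt c - |z.1 - z.2|)]
    _ = m * ((Real.sqrt c ^ 2 + ∫ z, (z.1 - z.2) ^ 2 ∂γ) / (2 * Real.sqrt c)) := by
        rw [integral_const_mul, integral_div, integral_add (integrable_const _) i3]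
        simp
    _ ≤ m * ((Real.sqrt c ^ 2 + Real.sqrt c ^ 2) / (2 * Real.sqrt c)) := by
        rw [hss]; gcongr
    _ = m * Real.sqrt c := by field_simp; ring

/-! ### The limit laws -/

section
variable {p : PMF ℕ} {ε α : ℝ}

lemma exists_W2_posLaw_le (hp0 : 0 < p 0) (hp1 : p 0 < 1) (hε0 : 0 < ε) (hε1 : ε < 1 / 2)
    (hα0 : 0 < α) (hα1 : α < 1) {k : ℕ} (hk : 1 ≤ k) :
    ∃ C : ℝ, ∀ᶠ n : ℕ in atTop, W2 (posLaw p ε α k n) (unifCube k) ≤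
      ENNReal.ofReal (C * Real.sqrt (Real.log n / n)) := by
  obtain ⟨C, hC0, hC⟩ := exists_errorBound_le (firstProb_pos hp0) (firstProb_lt_one hp1)
  refine ⟨Real.sqrt (k * C), ?_⟩
  filter_upwards [eventually_wordLaw_ne_zero hp0 hp1 hε0 hε1 hα0 hα1, hC,
    (tendsto_countPar hε0 hα0).eventually_ge_atTop k, eventually_gt_atTop 0,
    eventually_one_le_log] with n h1 h2 h3 h4 h5
  have hG : wordLaw p n (goodWords p ε α n) ≠ 0 := fun h0 =>
    h1 (measure_mono_null Set.inter_subset_left h0)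
  obtain ⟨γ, g1, g2, g3⟩ := exists_coupling_posLaw hp0 hp1 h4 h3 (by omega) hG
  rw [← Real.sqrt_mul (by positivity)]
  refine W2_le_of_coupling g1 g2 (by positivity) (g3.trans ?_)
  rw [← ENNReal.ofReal_natCast, ← ENNReal.ofReal_mul (by positivity), mul_assoc]
  exact ENNReal.ofReal_le_ofReal (by gcongr)

lemma exists_eventually_coupling_secondPosLaw (hp0 : 0 < p 0) (hp1 : p 0 < 1) (hε0 : 0 < ε)
    (hε1 : ε < 1 / 2) (hα0 : 0 < α) (hα1 : α < 1) :
    ∃ C : ℝ, 0 < C ∧ ∀ᶠ n : ℕ in atTop, 0 < C * (Real.log n / n) ∧ ∃ γ : Measure (ℝ × ℝ),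
      γ.map Prod.fst = secondPosLaw p ε α n ∧ γ.map Prod.snd = unifIcc ∧
      ∫⁻ z, edist z.1 z.2 ^ 2 ∂γ ≤ ENNReal.ofReal (C * (Real.log n / n)) := by
  have hq0 := firstProb_pos hp0
  have hq1 := firstProb_lt_one hp1
  obtain ⟨C, hC0, hC⟩ := exists_errorBound_le hq0 hq1
  refine ⟨C, hC0, ?_⟩
  filter_upwards [eventually_wordLaw_ne_zero hp0 hp1 hε0 hε1 hα0 hα1, hC,
    (tendsto_countPar hε0 hα0).eventually_ge_atTop 2, eventually_gt_atTop 0,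
    (tendsto_runPar (ε := ε) hq0 hq1 (by linarith)).eventually_ge_atTop 1,
    eventually_one_le_log] with n h1 h2 h3 h4 h5 h6
  obtain ⟨γ, g1, g2, g3⟩ := exists_coupling_secondPosLaw hp0 hp1 h4 h5 (by omega) h1
  have hn : (0 : ℝ) < n := by exact_mod_cast h4
  exact ⟨mul_pos hC0 (div_pos (by linarith) hn), γ, g1, g2,
    g3.trans (ENNReal.ofReal_le_ofReal h2)⟩

lemma exists_W2_secondPosLaw_le (hp0 : 0 < p 0) (hp1 : p 0 < 1) (hε0 : 0 < ε) (hε1 : ε < 1 / 2)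
    (hα0 : 0 < α) (hα1 : α < 1) :
    ∃ C : ℝ, ∀ᶠ n : ℕ in atTop, W2 (secondPosLaw p ε α n) unifIcc ≤
      ENNReal.ofReal (C * Real.sqrt (Real.log n / n)) := by
  obtain ⟨C, hC0, h⟩ := exists_eventually_coupling_secondPosLaw hp0 hp1 hε0 hε1 hα0 hα1
  refine ⟨Real.sqrt C, ?_⟩
  filter_upwards [h] with n ⟨hc, γ, g1, g2, g3⟩
  rw [← Real.sqrt_mul hC0.le]
  exact W2_le_of_coupling g1 g2 hc.le g3

lemma tendsto_moment_secondPosLaw (hp0 : 0 < p 0) (hp1 : p 0 < 1) (hε0 : 0 < ε)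
    (hε1 : ε < 1 / 2) (hα0 : 0 < α) (hα1 : α < 1) (m : ℕ) :
    Tendsto (fun n : ℕ => ∫ x, x ^ m ∂(secondPosLaw p ε α n)) atTop
      (𝓝 (∫ x, x ^ m ∂unifIcc)) := by
  obtain ⟨C, hC0, h⟩ := exists_eventually_coupling_secondPosLaw hp0 hp1 hε0 hε1 hα0 hα1
  rw [tendsto_iff_dist_tendsto_zero]
  have hlim : Tendsto (fun n : ℕ => (m : ℝ) * Real.sqrt (C * (Real.log n / n))) atTop (𝓝 0) := by
    have h1 : Tendsto (fun n : ℕ => Real.log n / n) atTop (𝓝 0) :=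
      (Real.isLittleO_log_id_atTop.tendsto_div_nhds_zero).comp tendsto_natCast_atTop_atTop
    simpa using ((h1.const_mul C).sqrt).const_mul (m : ℝ)
  refine squeeze_zero' (Eventually.of_forall fun _ => dist_nonneg) ?_ hlim
  filter_upwards [h] with n ⟨hc, γ, g1, g2, g3⟩
  rw [Real.dist_eq]
  refine abs_moment_sub_le ?_ ae_unifIcc g1 g2 hc g3 m
  exact (ae_map_iff Measurable.of_discrete.aemeasurable measurableSet_Icc).2
    (ae_of_all _ fun w => blockPos_mem_Icc w 1)

end

end LyndonBlocks

theorem mainTheorem4 (p : PMF ℕ) (hp0 : 0 < p 0) (hp1 : p 0 < 1)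
    (ε α : ℝ) (hε0 : 0 < ε) (hε1 : ε < 1 / 2) (hα0 : 0 < α)
    (hα1 : α < LyndonBlocks.firstProb p * (1 - LyndonBlocks.firstProb p) / 4) :
    (∀ k : ℕ, 1 ≤ k → ∃ C : ℝ, ∀ᶠ n : ℕ in atTop,
      LyndonBlocks.W2 (LyndonBlocks.posLaw p ε α k n) (LyndonBlocks.unifCube k)
        ≤ ENNReal.ofReal (C * Real.sqrt (Real.log n / n))) ∧
    (∃ C : ℝ, ∀ᶠ n : ℕ in atTop,
      LyndonBlocks.W2 (LyndonBlocks.secondPosLaw p ε α n) LyndonBlocks.unifIcc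
        ≤ ENNReal.ofReal (C * Real.sqrt (Real.log n / n))) ∧
    (∀ m : ℕ, Tendsto (fun n : ℕ => ∫ x, x ^ m ∂(LyndonBlocks.secondPosLaw p ε α n)) atTop
      (𝓝 (∫ x, x ^ m ∂LyndonBlocks.unifIcc))) := by
  -- Together with `ε < 1/2` this keeps the required number of long blocks below `√n`.
  have hα : α < 1 := by
    have h0 := LyndonBlocks.firstProb_pos hp0
    have h1 := LyndonBlocks.firstProb_lt_one hp1
    nlinarith
  exact ⟨fun _ hk => LyndonBlocks.exists_W2_posLaw_le hp0 hp1 hε0 hε1 hα0 hα hk,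
    LyndonBlocks.exists_W2_secondPosLaw_le hp0 hp1 hε0 hε1 hα0 hα,
    LyndonBlocks.tendsto_moment_secondPosLaw hp0 hp1 hε0 hε1 hα0 hα⟩
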